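/- Setting. Let $\Omega\subset\mathbb R^2$ be a bounded open polygon (nonempty, open, equal to the interior of its closure, the closure being a finite union of triangles). For $\delta>0$ let $\Omega_\delta^c=\{y\notin\Omega:\operatorname{dist}(y,\partial\Omega)<\delta\}$ and $\widehat\Omega_\delta=\Omega\cup\Omega_\delta^c$. For an open set $D$, $C_b^n(D)$ is the space of $C^n$ functions on $D$ with bounded derivatives of orders $0,\dots,n$. Let $u_0\in C_b^4(\Omega)$, continuous on $\overline\Omega$, solve $-\Delta u_0=f_0$ in $\Omega$, $u_0=g_0$ on $\partial\Omega$; let $\delta_0>0$ and let $\tilde u_0\in C_b^4(\widehat\Omega_{\delta_0})$ satisfy $\tilde u_0=u_0$ on $\Omega$. Consider a family of discretizations, with horizons $0<\delta\le\delta_0$ and mesh sizes $0<h<\delta$, consisting of the following objects. All constants in the hypotheses, unless stated otherwise, are independent of the member of the family. (a) Data. $f_\delta$ (measurable) on $\Omega$ and $g_\delta$ on $\Omega_\delta^c$ satisfy $\|f_\delta-f_0\|_{C(\Omega)}=O(\delta^2)$ and $\|g_\delta-\tilde u_0\|_{C(\Omega_\delta^c)}=O(\delta^{2+\mu})$, where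 $\mu\in\{0,1\}$. (b) Meshes. $\mathcal T_\delta^h$ is a finite conforming triangulation of a polygonal region containing $\widehat\Omega_\delta$, such that the triangles contained in $\overline\Omega$ triangulate $\overline\Omega$. Every triangle has diameter at most $h$ and contains a disc of radius $\rho h$, where $\rho>0$ may depend on $\delta$. On the union of the triangles not contained in $\overline\Omega$ (which contains $\Omega_\delta^c$), $g_\delta$ is defined and continuous, and it is $C^2$ in the interior with derivatives of order at most $2$ bounded uniformly over the family. (c) Polygons. For $x\in\widehat\Omega_\delta$, $B_x=B_{\delta,n_\delta^x}(x)$ is a polygon with $n_\delta^x\ge3$ vertices, all on the circle of radius $\delta$ around $x$; the set of pairs $(x,y)$ with $x\in\widehat\Omega_\delta$, $y\in B_x$ is measurable. The family is weakly quasi-uniform: if $H_x$ is the length of the longest side of $B_x$ and $r_x$ the radius of the largest circle centred at $x$ and contained in $B_x$, then $H_x/(2\sin(\pi/n_\delta^x))\le C_1\delta$ and $r_x\ge C_2\delta$ for all $x\in\widehat\Omega_\delta$, with constants $C_1,C_2>0$. The polygons are tied to the mesh in one of two ways, the same for the whole family: either they are the "nocaps" polygons (inside the meshed region, the vertices of $B_x$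 are exactly the points where the circle of radius $\delta$ around $x$ meets the edges of $\mathcal T_\delta^h$), or they are arbitrary with $n_\delta^x\sim\delta/h$ uniformly in $x\in\widehat\Omega_\delta$. (d) Kernel. With the constant kernel $\gamma_\delta(x,y)=\frac{4}{\pi\delta^4}$ for $|x-y|\le\delta$ and $0$ otherwise, put $$\gamma_{\delta,n_\delta}(x,y)=\tfrac12\gamma_\delta(x,y)\bigl(\chi_{B_x}(y)+\chi_{B_y}(x)\bigr),\qquad \|u\|_{\delta,n_\delta}^2=\int_{\widehat\Omega_\delta}\int_{\widehat\Omega_\delta}(u(y)-u(x))^2\gamma_{\delta,n_\delta}(x,y)\,dy\,dx .$$ Assume that the first moments vanish in the limit: for $i=1,2$ and every $x\in\Omega$, $\int_{\widehat\Omega_\delta}(y_i-x_i)\gamma_{\delta,n_\delta}(x,y)\,dy\to0$ as $\delta\to0$. (e) Conforming DG (CDG) solution. $V_\delta^{0,h}$ (resp. $V_\delta^{c,h}$) is the space of continuous piecewise linear functions on the union of the triangles contained in $\overline\Omega$ (resp. of the other triangles), extended by zero. Let $g_\delta^h\in V_\delta^{c,h}$ agree with $g_\delta$ up to $O(h^2)$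 at the nodes (for example, the nodal interpolant). Let $u^{0,h}_{\delta,n_\delta}\in V_\delta^{0,h}$ satisfy, for all $w\in V_\delta^{0,h}$, $$-2\int_\Omega w(x)\int_\Omega(u^{0,h}_{\delta,n_\delta}(y)-u^{0,h}_{\delta,n_\delta}(x))\gamma_{\delta,n_\delta}(x,y)\,dy\,dx=\int_\Omega f_\delta w\,dx+2\int_\Omega w(x)\int_{\Omega_\delta^c}(g_\delta^h(y)-u^{0,h}_{\delta,n_\delta}(x))\gamma_{\delta,n_\delta}(x,y)\,dy\,dx,$$ and put $u^h_{\delta,n_\delta}=u^{0,h}_{\delta,n_\delta}+g_\delta^h$. Theorem. With $\lambda=2$, there is a constant $C$ such that for all members of the family both $\|\tilde u_0-u^h_{\delta,n_\delta}\|_{\delta,n_\delta}$ and $\|u_0-u^h_{\delta,n_\delta}\|_{L^2(\Omega)}$ are at most $$C\left(\delta^{(3+\mu)/2}+\delta^{-1}h^2+\delta^{-\lambda-1}h^\lambda\right),$$ and $\delta^{(3+\mu)/2}+\delta^{-1}h^2+\delta^{-\lambda-1}h^\lambda\sim\delta^{(3+\mu)/2}+\delta^{-3}h^2$, with constants independent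 of the member of the family. -/

import Mathlib

open MeasureTheory Filter Topology

noncomputable section

namespace NonlocalFEM

/-- The Euclidean plane. -/
abbrev Plane := EuclideanSpace ℝ (Fin 2)

/-! ### Domains, spaces of smooth functions, the local problem -/

/-- A bounded open polygon: a nonempty open set that is the interior of its closure, the closure
being a finite union of nondegenerate closed triangles. -/
def IsPolygonalDomain (Ω : Set Plane) : Prop :=
  IsOpen Ω ∧ Ω.Nonempty ∧ interior (closure Ω) = Ω ∧
    ∃ S : Set (Finset Plane), S.Finite ∧
      (∀ s ∈ S, s.card = 3 ∧ AffineIndependent ℝ ((↑) : s → Plane)) ∧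
      closure Ω = ⋃ s ∈ S, convexHull ℝ (s : Set Plane)

/-- The interaction domain `Ω_δ^c = {y ∉ Ω : dist(y, ∂Ω) < δ}`. -/
def interactionDomain (Ω : Set Plane) (δ : ℝ) : Set Plane :=
  {y | y ∉ Ω ∧ Metric.infDist y (frontier Ω) < δ}

/-- The enlarged domain `Ω ∪ Ω_δ^c`. -/
def enlarged (Ω : Set Plane) (δ : ℝ) : Set Plane :=
  Ω ∪ interactionDomain Ω δ

/-- `u ∈ C_b^n(D)`, all derivatives of order at most `n` being bounded by `M` (for open `D`). -/
def CbBound (n : ℕ) (D : Set Plane) (M : ℝ) (u : Plane → ℝ) : Prop :=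
  ContDiffOn ℝ n u D ∧ ∀ j ≤ n, ∀ x ∈ D, ‖iteratedFDeriv ℝ j u x‖ ≤ M

/-- `u` solves `-Δ u = f` on `Ω`, `u = g` on `∂Ω`, the boundary values being attained
continuously. -/
def IsLocalSolution (Ω : Set Plane) (f g u : Plane → ℝ) : Prop :=
  ContinuousOn u (closure Ω) ∧
    (∀ x ∈ Ω, -(Laplacian.laplacian u x) = f x) ∧ ∀ x ∈ frontier Ω, u x = g x

/-! ### Inscribed polygons -/

/-- The (closed) polygon with the given set of vertices. -/
def polygon (V : Finset Plane) : Set Plane := convexHull ℝ (V : Set Plane)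

/-- `V` is the vertex set of a polygon inscribed in the circle of radius `δ` around `x`. Its number
of sides is `V.card`. -/
def IsInscribed (x : Plane) (δ : ℝ) (V : Finset Plane) : Prop :=
  (V : Set Plane) ⊆ Metric.sphere x δ ∧ 3 ≤ V.card

/-- The length of the longest side of the polygon with vertices `V`: a side is a segment
between two distinct vertices that is contained in the boundary of the polygon. -/
def longestSide (V : Finset Plane) : ℝ :=
  sSup {l | ∃ a ∈ V, ∃ b ∈ V, a ≠ b ∧ segment ℝ a b ⊆ frontier (polygon V) ∧ l = dist a b}

/-- The radius of the largest circle centred at `x` and contained in the polygon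
with vertices `V`. -/
def inradiusAt (x : Plane) (V : Finset Plane) : ℝ :=
  Metric.infDist x (polygon V)ᶜ

/-- Weak quasi-uniformity of a family of inscribed polygons: `V k x` is the vertex set of the
polygon of the point `x ∈ S k`, inscribed in the circle of radius `δ k` around `x`. -/
def WeaklyQuasiUniform {ι : Type*} (S : ι → Set Plane) (δ : ι → ℝ)
    (V : ι → Plane → Finset Plane) : Prop :=
  ∃ C₁ > 0, ∃ C₂ > 0, ∀ k, ∀ x ∈ S k,
    longestSide (V k x) / (2 * Real.sin (Real.pi / (V k x).card)) ≤ C₁ * δ k ∧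
      C₂ * δ k ≤ inradiusAt x (V k x)

/-! ### Kernels, energy norm -/

/-- The constant kernel `γ_δ(x, y) = 4 / (π δ⁴)` for `|x - y| ≤ δ`, and `0` otherwise. -/
def constKernel (δ : ℝ) (x y : Plane) : ℝ :=
  if dist x y ≤ δ then 4 / (Real.pi * δ ^ 4) else 0

/-- The kernel `γ_{δ,n_δ}(x, y) = ½ γ_δ(x, y) (χ_{B_x}(y) + χ_{B_y}(x))`, where `B_x` is the
polygon of the point `x`. -/
def polyKernel (δ : ℝ) (V : Plane → Finset Plane) (x y : Plane) : ℝ :=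
  1 / 2 * constKernel δ x y *
    ((polygon (V x)).indicator (fun _ => (1 : ℝ)) y +
      (polygon (V y)).indicator (fun _ => (1 : ℝ)) x)

/-- The energy norm `(∫_D ∫_D (u(y) - u(x))² γ(x, y) dy dx)^{1/2}` (for `γ ≥ 0`), as an
extended nonnegative real number. -/
def energyNorm (D : Set Plane) (γ : Plane → Plane → ℝ) (u : Plane → ℝ) : ENNReal :=
  (∫⁻ x in D, ∫⁻ y in D, ENNReal.ofReal ((u y - u x) ^ 2 * γ x y)) ^ (1 / 2 : ℝ)

/-- The first moment `∫_D (y_i - x_i) γ(x, y) dy`. -/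
def firstMoment (D : Set Plane) (γ : Plane → Plane → ℝ) (i : Fin 2) (x : Plane) : ℝ :=
  ∫ y in D, (y i - x i) * γ x y

/-! ### Triangulations -/

/-- The (vertex sets of the) triangles of a simplicial complex in the plane. -/
def triangles (K : Geometry.SimplicialComplex ℝ Plane) : Set (Finset Plane) :=
  {s | s ∈ K.faces ∧ s.card = 3}

/-- The union of the edges of a simplicial complex. -/
def skeleton (K : Geometry.SimplicialComplex ℝ Plane) : Set Plane :=
  ⋃ s ∈ {s | s ∈ K.faces ∧ s.card = 2}, convexHull ℝ (s : Set Plane)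

/-- The triangles of `K` that are contained in the closure of `Ω`. -/
def domainTriangles (Ω : Set Plane) (K : Geometry.SimplicialComplex ℝ Plane) :
    Set (Finset Plane) :=
  {s | s ∈ triangles K ∧ convexHull ℝ (s : Set Plane) ⊆ closure Ω}

/-- The other triangles of `K`; they triangulate the interaction domain. -/
def collarTriangles (Ω : Set Plane) (K : Geometry.SimplicialComplex ℝ Plane) :
    Set (Finset Plane) :=
  {s | s ∈ triangles K ∧ ¬ convexHull ℝ (s : Set Plane) ⊆ closure Ω}

/-- The region covered by the triangles outside `Ω`: a polygonal region that contains the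
interaction domain. -/
def collar (Ω : Set Plane) (K : Geometry.SimplicialComplex ℝ Plane) : Set Plane :=
  ⋃ s ∈ collarTriangles Ω K, convexHull ℝ (s : Set Plane)

/-- `K` is a consistent triangulation for `Ω` and `δ`: a finite conforming mesh of triangles which
covers `Ω ∪ Ω_δ^c` and simultaneously triangulates `Ω`. (The mesh covers a polygonal region that
may be larger than `Ω ∪ Ω_δ^c`, since the latter has rounded corners.) -/
structure IsConsistentTriangulation (Ω : Set Plane) (δ : ℝ)
    (K : Geometry.SimplicialComplex ℝ Plane) : Prop where
  finite : K.faces.Finite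
  pure : ∀ s ∈ K.faces, ∃ t ∈ triangles K, s ⊆ t
  covers : enlarged Ω δ ⊆ K.space
  consistent : (⋃ s ∈ domainTriangles Ω K, convexHull ℝ (s : Set Plane)) = closure Ω

/-- Every triangle of `K` has diameter at most `h` and contains a disc of radius `ρ h`. -/
def QuasiUniformMesh (K : Geometry.SimplicialComplex ℝ Plane) (h ρ : ℝ) : Prop :=
  ∀ s ∈ triangles K, Metric.diam (convexHull ℝ (s : Set Plane)) ≤ h ∧
    ∃ c, Metric.closedBall c (ρ * h) ⊆ convexHull ℝ (s : Set Plane)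

/-- The *nocaps* polygon at `x`, given by its vertices `V`: inside the meshed region, the vertices
are exactly the points at which the circle of radius `δ` around `x` meets the mesh edges. -/
def IsNocaps (K : Geometry.SimplicialComplex ℝ Plane) (δ : ℝ) (x : Plane)
    (V : Finset Plane) : Prop :=
  (V : Set Plane) ∩ K.space = Metric.sphere x δ ∩ skeleton K

/-- How the polygons are tied to the mesh: they are the nocaps polygons of the mesh, or,
alternatively, they are arbitrary inscribed polygons with numbers of sides `n_δ ∼ δ / h`. -/
def PolygonsMatchMesh {ι : Type*} (S : ι → Set Plane) (δ h : ι → ℝ)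
    (K : ι → Geometry.SimplicialComplex ℝ Plane) (V : ι → Plane → Finset Plane) : Prop :=
  (∀ k, ∀ x ∈ S k, IsNocaps (K k) (δ k) x (V k x)) ∨
    ∃ c > 0, ∃ C > 0, ∀ k, ∀ x ∈ S k,
      c * (δ k / h k) ≤ ((V k x).card : ℝ) ∧ ((V k x).card : ℝ) ≤ C * (δ k / h k)

/-! ### The linear CDG method -/

/-- `v` coincides with an affine function on each (closed) triangle of `S`, and vanishes off the
union of these triangles. For the triangles of a conforming mesh, `v` is then
continuous on that union, so these are the continuous piecewise linear functions on it,
extended by zero. -/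
def PiecewiseLinear (S : Set (Finset Plane)) (v : Plane → ℝ) : Prop :=
  (∀ s ∈ S, ∃ a : Plane →ᵃ[ℝ] ℝ, ∀ x ∈ convexHull ℝ (s : Set Plane), v x = a x) ∧
    ∀ x, x ∉ (⋃ s ∈ S, convexHull ℝ (s : Set Plane)) → v x = 0

/-- The space `V_δ^{0,h}`. -/
def domainSpace (Ω : Set Plane) (K : Geometry.SimplicialComplex ℝ Plane) : Set (Plane → ℝ) :=
  {v | PiecewiseLinear (domainTriangles Ω K) v}

/-- The space `V_δ^{c,h}`. -/
def collarSpace (Ω : Set Plane) (K : Geometry.SimplicialComplex ℝ Plane) : Set (Plane → ℝ) :=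
  {v | PiecewiseLinear (collarTriangles Ω K) v}

/-- `u ∈ V_δ^{0,h}` solves the linear CDG equations with kernel `γ`, right-hand side `f` and
discrete volume constraint `gh`; the CDG solution is then `u + gh`. -/
def IsCDGSolution (Ω : Set Plane) (δ : ℝ) (K : Geometry.SimplicialComplex ℝ Plane)
    (γ : Plane → Plane → ℝ) (f gh u : Plane → ℝ) : Prop :=
  u ∈ domainSpace Ω K ∧ ∀ w ∈ domainSpace Ω K,
    -2 * ∫ x in Ω, w x * ∫ y in Ω, (u y - u x) * γ x y =
      (∫ x in Ω, f x * w x) +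
        2 * ∫ x in Ω, w x * ∫ y in interactionDomain Ω δ, (gh y - u x) * γ x y

/-- `δ^{(3+μ)/2} + δ^{-1} h² + δ^{-λ-1} h^λ`. -/
def rate (μ lam : ℕ) (δ h : ℝ) : ℝ :=
  δ ^ (((3 : ℝ) + μ) / 2) + δ⁻¹ * h ^ 2 + (δ ^ (lam + 1))⁻¹ * h ^ lam

/-- `δ^{(3+μ)/2} + δ^{-3} h²`. -/
def simpleRate (μ : ℕ) (δ h : ℝ) : ℝ :=
  δ ^ (((3 : ℝ) + μ) / 2) + (δ ^ 3)⁻¹ * h ^ 2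

end NonlocalFEM

end

open NonlocalFEM

/-! The proof combines coercivity, consistency and interpolation. Put `D = Ω ∪ Ω_δ^c`, let `B` be
the bilinear form of the energy, and let `v` be the nodal interpolant of the extended solution `ue`
on the mesh of `Ω`. On `D` the error is `z + w`, where `z = ue - (v + gh)` is an interpolation error
and `w = v - uh` is an admissible test function. The CDG equation then reads `B(z + w, w) = ∫ R w`,
with `R` the residual of `ue` in the nonlocal equation (`integral_mul_integral_eq_of_cdg`,
`energyForm_eq`).

The polygons contain discs of radius `η δ`, and this yields a Poincaré inequality `‖w‖² ≤ P B(w, w)`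
with `P` independent of `δ` (`lintegral_sq_le_energy`): a walk with steps of length about `δ` leaves
the support after about `1/δ` of them, and the resulting `δ⁻⁴` is the size of the kernel. Hence
`B(w, w) ≤ 2 B(z, z) + 2 P ‖R‖²` (`energyForm_le_of_galerkin`), and the `L²` bound follows from
Poincaré again.

Interpolation: the kernel has mass at most `4/δ²`, so `B(z, z) ≤ 16 δ⁻² ‖z‖²`. In `Ω`, `z = O(h²)`;
in the collar, `z = O(h² + δ^(2+μ))`, and the collar has area `O(δ)`. In the energy norm this
amounts to `δ⁻¹h² + δ^((3+2μ)/2)`.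

Consistency: on full discs the odd Taylor terms cancel and the operator is `Δ + O(δ²)`. If `H`
bounds the sides of the polygons, Pythagoras bounds their inradii below by `√(δ² - H²/4)`
(`sq_le_inradiusAt_sq_add`), so polygons and discs differ only in an annulus of area `O(H²)`, where
the integrand is `O(δ · δ⁻⁴)`. Since `H = O(h)` (`exists_longestSide_le`), the residual is `O(δ² +
δ⁻³h²)`, which is the case `λ = 2`. For the nocaps polygons `H = O(h)` rests on counting the arcs of
the circle that must cross a mesh edge (`div_le_card_of_isNocaps`).

For `μ = 0` the collar data dictate the power `δ^(3/2)`, for `μ = 1` the residual dictates `δ²`;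
both are `δ^((3+μ)/2)`. -/

noncomputable section

namespace NonlocalFEM

/-! ### Taylor's formula along segments -/

/-- Integral form of the remainder. The factors `1/n!` and `(1 - t)^n` are bounded by 1, since only
the order matters. -/
theorem abs_sub_taylor_le {n : ℕ} {u : Plane → ℝ} {S : Set Plane} (hS : IsOpen S) {M : ℝ}
    (hu : ContDiffOn ℝ (n + 1 : ℕ) u S) (hM : ∀ x ∈ S, ‖iteratedFDeriv ℝ (n + 1) u x‖ ≤ M)
    {x z : Plane} (hseg : ∀ t ∈ Set.Icc (0 : ℝ) 1, x + t • z ∈ S) :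
    |u (x + z) - ∑ k ∈ Finset.range (n + 1),
      (k.factorial : ℝ)⁻¹ * iteratedFDeriv ℝ k u x (fun _ => z)| ≤ M * ‖z‖ ^ (n + 1) := by
  have h := map_add_eq_sum_add_integral_iteratedFDeriv (f := u) (x := x) (y := z) (n := n)
    (fun t ht => by
      have := hu.contDiffAt (hS.mem_nhds (hseg t ht))
      exact_mod_cast this)
  have hM0 : 0 ≤ M := (norm_nonneg _).trans (hM _ (hseg 0 (by simp)))
  rw [h]
  simp only [smul_eq_mul, add_sub_cancel_left]
  rw [abs_mul]
  have h1 : |∫ t in (0 : ℝ)..1, (1 - t) ^ n * iteratedFDeriv ℝ (n + 1) u (x + t • z) fun _ => z|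
      ≤ M * ‖z‖ ^ (n + 1) := by
    have := intervalIntegral.norm_integral_le_of_norm_le_const (a := (0 : ℝ)) (b := 1)
      (f := fun t : ℝ => (1 - t) ^ n * iteratedFDeriv ℝ (n + 1) u (x + t • z) fun _ => z)
      (C := M * ‖z‖ ^ (n + 1)) (fun t ht => by
        rw [Set.uIoc_of_le zero_le_one] at ht
        have ht' : t ∈ Set.Icc (0 : ℝ) 1 := ⟨ht.1.le, ht.2⟩
        rw [norm_mul]
        have h2 : ‖(1 - t) ^ n‖ ≤ 1 := by
          rw [norm_pow, Real.norm_eq_abs, abs_of_nonneg (by linarith [ht.2])]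
          exact pow_le_one₀ (by linarith [ht.2]) (by linarith [ht.1])
        have h3 : ‖iteratedFDeriv ℝ (n + 1) u (x + t • z) fun _ => z‖ ≤ M * ‖z‖ ^ (n + 1) := by
          refine (ContinuousMultilinearMap.le_opNorm _ _).trans ?_
          simp only [Finset.prod_const, Finset.card_univ, Fintype.card_fin]
          gcongr
          exact hM _ (hseg t ht')
        calc _ ≤ 1 * (M * ‖z‖ ^ (n + 1)) := by gcongr
          _ = _ := one_mul _)
    simpa using this
  have h4 : |((n.factorial : ℝ)⁻¹)| ≤ 1 := by
    rw [abs_inv, Nat.abs_cast]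
    exact inv_le_one_of_one_le₀ (by exact_mod_cast Nat.one_le_of_lt n.factorial_pos)
  calc _ ≤ 1 * (M * ‖z‖ ^ (n + 1)) := by gcongr
    _ = _ := one_mul _

/-- First order Taylor bound on a segment whose far end point may lie on the boundary. -/
theorem abs_sub_linear_le {u : Plane → ℝ} {S : Set Plane} (hS : IsOpen S) {M : ℝ}
    (hu : ContDiffOn ℝ 2 u S) (hM : ∀ x ∈ S, ‖iteratedFDeriv ℝ 2 u x‖ ≤ M)
    {x p : Plane} (hseg : ∀ t ∈ Set.Ico (0 : ℝ) 1, x + t • (p - x) ∈ S)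
    (hc : ContinuousOn u (segment ℝ x p)) :
    |u p - u x - fderiv ℝ u x (p - x)| ≤ M * ‖p - x‖ ^ 2 := by
  set z := p - x with hz
  -- The end point `p` need not lie in `S`, so the estimate is proved for `t < 1` and carried to `t
  -- = 1` by continuity of `u` on the closed segment.
  have key : ∀ t ∈ Set.Ico (0 : ℝ) 1,
      |u (x + t • z) - u x - fderiv ℝ u x (t • z)| ≤ M * ‖t • z‖ ^ 2 := by
    intro t ht
    have := abs_sub_taylor_le (n := 1) hS (by exact_mod_cast hu) hM (x := x) (z := t • z)
      (fun s hs => by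
        rw [smul_smul]
        exact hseg _ ⟨mul_nonneg hs.1 ht.1, by nlinarith [hs.1, hs.2, ht.1, ht.2]⟩)
    simpa [Finset.sum_range_succ, iteratedFDeriv_one_apply, sub_sub] using this
  have hmap : ∀ t ∈ Set.Icc (0 : ℝ) 1, x + t • z ∈ segment ℝ x p := by
    intro t ht
    rw [segment_eq_image']
    exact ⟨t, ht, rfl⟩
  have h1 : ContinuousOn (fun t : ℝ => |u (x + t • z) - u x - fderiv ℝ u x (t • z)|)
      (Set.Icc 0 1) := by
    have h2 : ContinuousOn (fun t : ℝ => u (x + t • z)) (Set.Icc 0 1) :=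
      hc.comp (by fun_prop) hmap
    have h2' : ContinuousOn (fun t : ℝ => fderiv ℝ u x (t • z)) (Set.Icc 0 1) := by fun_prop
    exact ((h2.sub continuousOn_const).sub h2').abs
  have h3 : ContinuousOn (fun t : ℝ => M * ‖t • z‖ ^ 2) (Set.Icc 0 1) := by fun_prop
  have hcl : Set.Icc (0 : ℝ) 1 ⊆ closure (Set.Ico 0 1) := by
    rw [closure_Ico zero_ne_one]
  have := ContinuousWithinAt.closure_le (f := fun t : ℝ => |u (x + t • z) - u x - fderiv ℝ u x (t • z)|)
    (g := fun t : ℝ => M * ‖t • z‖ ^ 2) (s := Set.Ico 0 1) (x := 1) (hcl (by simp))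
    ((h1 1 (by simp)).mono Set.Ico_subset_Icc_self) ((h3 1 (by simp)).mono Set.Ico_subset_Icc_self)
    key
  simpa [hz] using this

/-! ### Moments of a disc -/

theorem setIntegral_ball_comp_isometry (φ : Plane ≃ₗᵢ[ℝ] Plane) (f : Plane → ℝ) (δ : ℝ) :
    ∫ z in Metric.ball 0 δ, f (φ z) = ∫ z in Metric.ball 0 δ, f z := by
  have := φ.measurePreserving.setIntegral_preimage_emb φ.toHomeomorph.measurableEmbedding f
    (Metric.ball 0 δ)
  rw [← this]
  congr 2
  ext z
  simp

/-- The rotation by a right angle. -/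
def rotation : Plane ≃ₗᵢ[ℝ] Plane where
  toFun z := !₂[-z 1, z 0]
  invFun z := !₂[z 1, -z 0]
  map_add' x y := by ext i; fin_cases i <;> simp; ring
  map_smul' c x := by ext i; fin_cases i <;> simp
  left_inv x := by ext i; fin_cases i <;> simp
  right_inv x := by ext i; fin_cases i <;> simp
  norm_map' x := by
    simp [EuclideanSpace.norm_eq, Fin.sum_univ_two, add_comm]

theorem rotation_apply_zero (z : Plane) : rotation z 0 = -z 1 := rfl

theorem rotation_apply_one (z : Plane) : rotation z 1 = z 0 := rfl

theorem norm_sq_plane (z : Plane) : ‖z‖ ^ 2 = z 0 ^ 2 + z 1 ^ 2 := by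
  rw [EuclideanSpace.norm_sq_eq, Fin.sum_univ_two]; simp

theorem integrableOn_ball_of_continuous {f : Plane → ℝ} (hf : Continuous f) (x : Plane) (δ : ℝ) :
    IntegrableOn f (Metric.ball x δ) :=
  (hf.continuousOn.integrableOn_compact (isCompact_closedBall x δ)).mono_set
    Metric.ball_subset_closedBall

theorem setIntegral_ball_norm_sq {δ : ℝ} (hδ : 0 < δ) :
    ∫ z in Metric.ball (0 : Plane) δ, ‖z‖ ^ 2 = Real.pi * δ ^ 4 / 2 := by
  have h1 : ∫ z in Metric.ball (0 : Plane) δ, ‖z‖ ^ 2 =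
      ∫ z : Plane, (Set.Iio δ).indicator (fun r : ℝ => r ^ 2) ‖z‖ := by
    rw [← integral_indicator Metric.isOpen_ball.measurableSet]
    congr 1
    ext z
    by_cases hz : ‖z‖ < δ <;> simp [Set.indicator, hz]
  have hb : (volume : Measure Plane).real (Metric.ball 0 1) = Real.pi := by
    simp [Measure.real, EuclideanSpace.volume_ball_fin_two, Real.pi_pos.le]
  rw [h1, integral_fun_norm_addHaar, hb]
  have h2 : ∫ y in Set.Ioi (0 : ℝ), y ^ (Module.finrank ℝ Plane - 1) •
      (Set.Iio δ).indicator (fun r : ℝ => r ^ 2) y = δ ^ 4 / 4 := by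
    have : ∀ y : ℝ, y ^ (Module.finrank ℝ Plane - 1) •
      (Set.Iio δ).indicator (fun r : ℝ => r ^ 2) y = (Set.Iio δ).indicator (fun r => r ^ 3) y := by
      intro y
      by_cases hy : y < δ
      · simp [hy]; ring
      · simp [hy]
    simp_rw [this]
    rw [setIntegral_indicator measurableSet_Iio, Set.Ioi_inter_Iio,
      ← integral_Ioc_eq_integral_Ioo, ← intervalIntegral.integral_of_le hδ.le, integral_pow]
    norm_num
  rw [h2]
  simp
  ring

/-- A quarter turn preserves the disc, exchanges the two squares and changes the sign of the mixed
product. -/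
theorem setIntegral_ball_coord {δ : ℝ} (hδ : 0 < δ) :
    ∫ z in Metric.ball (0 : Plane) δ, z 0 * z 0 = Real.pi * δ ^ 4 / 4 ∧
    ∫ z in Metric.ball (0 : Plane) δ, z 1 * z 1 = Real.pi * δ ^ 4 / 4 ∧
    ∫ z in Metric.ball (0 : Plane) δ, z 0 * z 1 = 0 := by
  have h1 := setIntegral_ball_comp_isometry rotation (fun z => z 0 * z 0) δ
  have h2 := setIntegral_ball_comp_isometry rotation (fun z => z 0 * z 1) δ
  simp only [rotation_apply_zero, rotation_apply_one] at h1 h2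
  have h3 := setIntegral_ball_norm_sq hδ
  simp_rw [norm_sq_plane, pow_two] at h3
  rw [integral_add (integrableOn_ball_of_continuous (by fun_prop) _ _)
    (integrableOn_ball_of_continuous (by fun_prop) _ _)] at h3
  simp only [neg_mul_neg] at h1
  simp only [neg_mul, integral_neg] at h2
  have h2' : ∫ z in Metric.ball (0 : Plane) δ, z 0 * z 1 = ∫ z in Metric.ball (0 : Plane) δ, z 1 * z 0 := by
    simp_rw [mul_comm]
  refine ⟨by linarith, by linarith, by linarith⟩

/-- Only the trace survives, which turns the second order Taylor term into the Laplacian. The factor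
`π δ⁴ / 4` is the inverse of the kernel constant. -/
theorem setIntegral_ball_bilin {δ : ℝ} (hδ : 0 < δ) (A : Plane →L[ℝ] Plane →L[ℝ] ℝ) :
    ∫ z in Metric.ball (0 : Plane) δ, A z z =
      Real.pi * δ ^ 4 / 4 * (A (EuclideanSpace.single 0 1) (EuclideanSpace.single 0 1) +
        A (EuclideanSpace.single 1 1) (EuclideanSpace.single 1 1)) := by
  obtain ⟨h0, h1, h2⟩ := setIntegral_ball_coord hδ
  set e₀ : Plane := EuclideanSpace.single 0 1
  set e₁ : Plane := EuclideanSpace.single 1 1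
  have hz : ∀ z : Plane, A z z = A e₀ e₀ * (z 0 * z 0) + (A e₀ e₁ + A e₁ e₀) * (z 0 * z 1)
      + A e₁ e₁ * (z 1 * z 1) := by
    intro z
    have : z = z 0 • e₀ + z 1 • e₁ := by
      ext i; fin_cases i <;> simp [e₀, e₁]
    have hexp : ∀ a b : ℝ, A (a • e₀ + b • e₁) (a • e₀ + b • e₁) =
        A e₀ e₀ * (a * a) + (A e₀ e₁ + A e₁ e₀) * (a * b) + A e₁ e₁ * (b * b) := by
      intro a b
      simp only [map_add, map_smul, add_apply, smul_apply, smul_eq_mul]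
      ring
    rw [← hexp, ← this]
  rw [integral_congr_ae (ae_of_all _ hz)]
  have i1 : IntegrableOn (fun z : Plane => A e₀ e₀ * (z 0 * z 0)) (Metric.ball 0 δ) :=
    integrableOn_ball_of_continuous (by fun_prop) _ _
  have i2 : IntegrableOn (fun z : Plane => (A e₀ e₁ + A e₁ e₀) * (z 0 * z 1)) (Metric.ball 0 δ) :=
    integrableOn_ball_of_continuous (by fun_prop) _ _
  have i3 : IntegrableOn (fun z : Plane => A e₁ e₁ * (z 1 * z 1)) (Metric.ball 0 δ) :=
    integrableOn_ball_of_continuous (by fun_prop) _ _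
  have i12 : IntegrableOn (fun z : Plane => A e₀ e₀ * (z 0 * z 0) +
    (A e₀ e₁ + A e₁ e₀) * (z 0 * z 1)) (Metric.ball 0 δ) := i1.add i2
  rw [integral_add i12 i3, integral_add i1 i2]
  simp only [integral_const_mul, h0, h1, h2]
  ring

theorem setIntegral_ball_odd (f : Plane → ℝ) (hf : ∀ z, f (-z) = -f z) (δ : ℝ) :
    ∫ z in Metric.ball (0 : Plane) δ, f z = 0 := by
  have := setIntegral_ball_comp_isometry (LinearIsometryEquiv.neg ℝ) f δ
  simp only [LinearIsometryEquiv.coe_neg, hf, integral_neg] at this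
  linarith

theorem volume_real_ball (x : Plane) {r : ℝ} (hr : 0 ≤ r) :
    (volume : Measure Plane).real (Metric.ball x r) = Real.pi * r ^ 2 := by
  simp [Measure.real, EuclideanSpace.volume_ball_fin_two, Real.pi_pos.le, hr, mul_comm]

/-- The nonlocal operator with the constant kernel on discs is second order consistent. -/
theorem abs_ball_operator_sub_laplacian_le {u : Plane → ℝ} {S : Set Plane} (hS : IsOpen S) {M : ℝ}
    (hu : ContDiffOn ℝ 4 u S) (hM : ∀ x ∈ S, ‖iteratedFDeriv ℝ 4 u x‖ ≤ M) {x : Plane} {δ : ℝ}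
    (hδ : 0 < δ) (hx : Metric.ball x δ ⊆ S) (hi : IntegrableOn u (Metric.ball x δ)) :
    |2 * (∫ y in Metric.ball x δ, (u y - u x) * (4 / (Real.pi * δ ^ 4))) -
      Laplacian.laplacian u x| ≤ 8 * M * δ ^ 2 := by
  have hseg : ∀ z ∈ Metric.ball (0 : Plane) δ, ∀ t ∈ Set.Icc (0 : ℝ) 1, x + t • z ∈ S := by
    intro z hz t ht
    apply hx
    simp only [mem_ball_zero_iff] at hz
    simp only [Metric.mem_ball, dist_self_add_left, norm_smul, Real.norm_eq_abs, abs_of_nonneg ht.1]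
    nlinarith [ht.1, ht.2, norm_nonneg z]
  set A := fderiv ℝ (fderiv ℝ u) x with hA
  have hlap : Laplacian.laplacian u x = A (EuclideanSpace.single 0 1) (EuclideanSpace.single 0 1) +
        A (EuclideanSpace.single 1 1) (EuclideanSpace.single 1 1) := by
    have := congrFun (InnerProductSpace.laplacian_eq_iteratedFDeriv_orthonormalBasis u
      (EuclideanSpace.basisFun (Fin 2) ℝ)) x
    rw [this, Fin.sum_univ_two]
    simp [iteratedFDeriv_two_apply, hA]
  have hM0 : 0 ≤ M := (norm_nonneg _).trans (hM x (hx (Metric.mem_ball_self hδ)))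
  have hshift : ∫ y in Metric.ball x δ, (u y - u x) =
      ∫ z in Metric.ball (0 : Plane) δ, (u (x + z) - u x) := by
    have := (measurePreserving_add_left (volume : Measure Plane) x).setIntegral_preimage_emb
      (measurableEmbedding_addLeft x) (fun y => u y - u x) (Metric.ball x δ)
    rw [← this]
    congr 2
    ext z; simp
  have hi' : IntegrableOn (fun z => u (x + z)) (Metric.ball (0 : Plane) δ) := by
    have := (measurePreserving_add_left (volume : Measure Plane) x).integrableOn_comp_preimage
      (measurableEmbedding_addLeft x) (f := u) (s := Metric.ball x δ)
    have h2 : (fun z => x + z) ⁻¹' Metric.ball x δ = Metric.ball (0 : Plane) δ := by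
      ext z; simp
    rw [h2] at this
    exact this.2 hi
  have ic : IntegrableOn (fun _ : Plane => u x) (Metric.ball (0 : Plane) δ) :=
    integrableOn_ball_of_continuous continuous_const _ _
  have i2 : IntegrableOn (fun z => (1 / 2 : ℝ) * A z z) (Metric.ball (0 : Plane) δ) :=
    integrableOn_ball_of_continuous (by fun_prop) _ _
  have i1 : IntegrableOn (fun z => fderiv ℝ u x z) (Metric.ball (0 : Plane) δ) :=
    integrableOn_ball_of_continuous (by fun_prop) _ _
  have i3 : IntegrableOn (fun z => (1 / 6 : ℝ) * iteratedFDeriv ℝ 3 u x (fun _ => z))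
      (Metric.ball (0 : Plane) δ) :=
    integrableOn_ball_of_continuous (by
      exact continuous_const.mul ((iteratedFDeriv ℝ 3 u x).cont.comp (by fun_prop))) _ _
  -- The first and third order terms are odd and drop out; this is what makes the operator second
  -- order consistent.
  have hodd1 : ∫ z in Metric.ball (0 : Plane) δ, fderiv ℝ u x z = 0 :=
    setIntegral_ball_odd _ (fun z => by simp) δ
  have hodd3 : ∫ z in Metric.ball (0 : Plane) δ,
      (1 / 6 : ℝ) * iteratedFDeriv ℝ 3 u x (fun _ => z) = 0 := by
    refine setIntegral_ball_odd _ (fun z => ?_) δ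
    have := (iteratedFDeriv ℝ 3 u x).map_smul_univ (fun _ => (-1 : ℝ)) (fun _ => z)
    simp only [neg_smul, one_smul, Finset.prod_const, Finset.card_univ, Fintype.card_fin] at this
    rw [this]
    norm_num
  have hrem : ∀ z ∈ Metric.ball (0 : Plane) δ, ‖u (x + z) - u x - (fderiv ℝ u x z +
      (1 / 2 : ℝ) * A z z + (1 / 6 : ℝ) * iteratedFDeriv ℝ 3 u x (fun _ => z))‖ ≤ M * δ ^ 4 := by
    intro z hz
    have := abs_sub_taylor_le (n := 3) hS (by exact_mod_cast hu) hM (hseg z hz)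
    simp only [Nat.reduceAdd, Finset.sum_range_succ, Finset.range_zero, Finset.sum_empty,
      iteratedFDeriv_one_apply, iteratedFDeriv_two_apply, iteratedFDeriv_zero_apply, zero_add,
      Nat.factorial] at this
    rw [mem_ball_zero_iff] at hz
    have h4 : M * ‖z‖ ^ 4 ≤ M * δ ^ 4 := by gcongr
    refine le_trans (le_of_eq ?_) (this.trans h4)
    rw [Real.norm_eq_abs]
    congr 1
    norm_num
    ring
  have hint : ∫ z in Metric.ball (0 : Plane) δ, (u (x + z) - u x - (fderiv ℝ u x z +
      (1 / 2 : ℝ) * A z z + (1 / 6 : ℝ) * iteratedFDeriv ℝ 3 u x (fun _ => z))) =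
      (∫ y in Metric.ball x δ, (u y - u x)) -
        1 / 2 * (Real.pi * δ ^ 4 / 4 * Laplacian.laplacian u x) := by
    have j1 : IntegrableOn (fun z => u (x + z) - u x) (Metric.ball (0 : Plane) δ) := hi'.sub ic
    have j2 : IntegrableOn (fun z => fderiv ℝ u x z + (1 / 2 : ℝ) * A z z)
      (Metric.ball (0 : Plane) δ) := i1.add i2
    have j3 : IntegrableOn (fun z => fderiv ℝ u x z + (1 / 2 : ℝ) * A z z +
      (1 / 6 : ℝ) * iteratedFDeriv ℝ 3 u x (fun _ => z)) (Metric.ball (0 : Plane) δ) := j2.add i3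
    rw [integral_sub j1 j3, integral_add j2 i3, integral_add i1 i2, hodd1, hodd3,
      integral_const_mul, setIntegral_ball_bilin hδ, hshift, hlap]
    ring
  have hb := norm_setIntegral_le_of_norm_le_const (μ := volume) (measure_ball_lt_top) hrem
  rw [volume_real_ball _ hδ.le, hint, Real.norm_eq_abs] at hb
  rw [integral_mul_const]
  have hpos : 0 < Real.pi * δ ^ 4 := by positivity
  have : 2 * ((∫ y in Metric.ball x δ, (u y - u x)) * (4 / (Real.pi * δ ^ 4))) -
      Laplacian.laplacian u x = 8 / (Real.pi * δ ^ 4) * ((∫ y in Metric.ball x δ, (u y - u x)) -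
        1 / 2 * (Real.pi * δ ^ 4 / 4 * Laplacian.laplacian u x)) := by
    field_simp
    ring
  rw [this, abs_mul, abs_of_pos (by positivity)]
  calc _ ≤ 8 / (Real.pi * δ ^ 4) * (M * δ ^ 4 * (Real.pi * δ ^ 2)) := by gcongr
    _ = 8 * M * δ ^ 2 := by field_simp

/-! ### Inscribed polygons: the inradius is controlled by the longest side -/

theorem isCompact_polygon (V : Finset Plane) : IsCompact (polygon V) :=
  V.finite_toSet.isCompact_convexHull ℝ

theorem inner_plane (a b : Plane) : inner ℝ a b = a 0 * b 0 + a 1 * b 1 := by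
  simp [PiLp.inner_apply, Fin.sum_univ_two, mul_comm]

/-- In the plane the orthogonal complement of `p` is a line. Algebraically, `‖q - q'‖² ‖q + q'‖² =
(‖q‖² - ‖q'‖²)² + 4 (q × q')²`, and both squares vanish. -/
theorem eq_or_eq_neg_of_inner_eq_zero {p q q' : Plane} (hp : p ≠ 0) (hq : inner ℝ q p = 0)
    (hq' : inner ℝ q' p = 0) (hn : ‖q‖ = ‖q'‖) : q = q' ∨ q = -q' := by
  rw [inner_plane] at hq hq'
  have hn2 : ‖q‖ ^ 2 = ‖q'‖ ^ 2 := by rw [hn]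
  rw [norm_sq_plane, norm_sq_plane] at hn2
  have hcross : q 0 * q' 1 - q 1 * q' 0 = 0 := by
    by_contra hne
    apply hp
    have h0 : p 0 = 0 := by
      have : (q 0 * q' 1 - q 1 * q' 0) * p 0 = 0 := by linear_combination q' 1 * hq - q 1 * hq'
      exact (mul_eq_zero.1 this).resolve_left hne
    have h1 : p 1 = 0 := by
      have : (q 0 * q' 1 - q 1 * q' 0) * p 1 = 0 := by linear_combination q 0 * hq' - q' 0 * hq
      exact (mul_eq_zero.1 this).resolve_left hne
    ext i; fin_cases i <;> simp [h0, h1]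
  have key : ‖q - q'‖ ^ 2 * ‖q + q'‖ ^ 2 = 0 := by
    rw [norm_sq_plane, norm_sq_plane]
    simp only [PiLp.sub_apply, PiLp.add_apply]
    linear_combination (q 0 ^ 2 + q 1 ^ 2 - (q' 0 ^ 2 + q' 1 ^ 2)) * hn2 +
      4 * (q 0 * q' 1 - q 1 * q' 0) * hcross
  rcases mul_eq_zero.1 key with h | h
  · left; exact sub_eq_zero.1 (norm_eq_zero.1 (pow_eq_zero_iff two_ne_zero |>.1 h))
  · right; exact eq_neg_of_add_eq_zero_left (norm_eq_zero.1 (pow_eq_zero_iff two_ne_zero |>.1 h))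

/-- A convex compact set containing a disc is supported, at a boundary point of the disc, by the
tangent line of the disc. -/
theorem inner_le_of_mem_of_ball_subset {P : Set Plane} (hP : Convex ℝ P) (hPc : IsClosed P)
    {x b : Plane} {r : ℝ} (hr : 0 < r) (hball : Metric.ball x r ⊆ P) (hb : dist x b = r)
    (hbi : b ∉ interior P) {z : Plane} (hz : z ∈ P) : inner ℝ (z - x) (b - x) ≤ r ^ 2 := by
  obtain ⟨f, hf⟩ := geometric_hahn_banach_open_point hP.interior isOpen_interior hbi
  set v : Plane := (InnerProductSpace.toDual ℝ Plane).symm f with hv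
  have hfv : ∀ a, f a = inner ℝ v a := fun a => by
    rw [hv, InnerProductSpace.toDual_symm_apply]
  have hxint : x ∈ interior P :=
    interior_maximal hball Metric.isOpen_ball (Metric.mem_ball_self hr)
  have hle : ∀ a ∈ P, inner ℝ v a ≤ inner ℝ v b := by
    intro a ha
    have hcl : a ∈ closure (interior P) := by
      rw [hP.closure_interior_eq_closure_of_nonempty_interior ⟨x, hxint⟩]
      exact subset_closure ha
    have : closure (interior P) ⊆ {a | f a ≤ f b} :=
      closure_minimal (fun a ha => (hf a ha).le) (isClosed_le f.continuous continuous_const)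
    have := this hcl
    simpa [hfv] using this
  have hv0 : v ≠ 0 := by
    intro h0
    have := hf x hxint
    simp [hfv, h0] at this
  have hvn : 0 < ‖v‖ := norm_pos_iff.2 hv0
  have hclosed : Metric.closedBall x r ⊆ P := by
    rw [← closure_ball x hr.ne']
    exact closure_minimal hball hPc
  -- This is the point of the disc farthest in the direction of the normal `v`. The supporting half
  -- plane contains it, which forces equality in Cauchy–Schwarz, so `b - x` is parallel to `v`.
  have hmem : x + (r / ‖v‖) • v ∈ P := by
    apply hclosed
    rw [Metric.mem_closedBall, dist_self_add_left, norm_smul, Real.norm_eq_abs,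
      abs_of_pos (by positivity), div_mul_cancel₀ _ hvn.ne']
  have h1 := hle _ hmem
  rw [inner_add_right, inner_smul_right, real_inner_self_eq_norm_sq] at h1
  have hbn : ‖b - x‖ = r := by rw [← dist_eq_norm, dist_comm, hb]
  have h2 : inner ℝ v (b - x) = ‖v‖ * ‖b - x‖ := by
    apply le_antisymm (real_inner_le_norm _ _)
    rw [inner_sub_right, hbn]
    have : r / ‖v‖ * ‖v‖ ^ 2 = ‖v‖ * r := by field_simp
    linarith
  rw [inner_eq_norm_mul_iff_real, hbn] at h2
  have h3 : r * inner ℝ (z - x) v ≤ r * (inner ℝ v b - inner ℝ v x) := by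
    have := hle z hz
    rw [inner_sub_left, real_inner_comm v z, real_inner_comm v x]
    gcongr
  have h4 : ‖v‖ * inner ℝ (z - x) (b - x) ≤ ‖v‖ * r ^ 2 := by
    calc ‖v‖ * inner ℝ (z - x) (b - x) = inner ℝ (z - x) (‖v‖ • (b - x)) := by
          rw [inner_smul_right]
      _ = r * inner ℝ (z - x) v := by rw [← h2, inner_smul_right]
      _ ≤ r * (inner ℝ v b - inner ℝ v x) := h3
      _ = inner ℝ (r • v) (b - x) := by rw [real_inner_smul_left, inner_sub_right]
      _ = ‖v‖ * r ^ 2 := by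
        rw [h2, real_inner_smul_left, real_inner_self_eq_norm_sq, hbn]
  exact le_of_mul_le_mul_left h4 hvn

theorem longestSide_nonneg (V : Finset Plane) : 0 ≤ longestSide V := by
  apply Real.sSup_nonneg
  rintro l ⟨a, -, b, -, -, -, rfl⟩
  exact dist_nonneg

theorem dist_le_longestSide {V : Finset Plane} {a b : Plane} (ha : a ∈ V) (hb : b ∈ V)
    (hab : a ≠ b) (hseg : segment ℝ a b ⊆ frontier (polygon V)) : dist a b ≤ longestSide V := by
  apply le_csSup
  · refine (((V ×ˢ V).image (fun p => dist p.1 p.2)).finite_toSet.subset ?_).bddAbove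
    rintro l ⟨a, ha, b, hb, -, -, rfl⟩
    simp only [Finset.coe_image, Set.mem_image, Finset.mem_coe, Finset.mem_product]
    exact ⟨(a, b), ⟨ha, hb⟩, rfl⟩
  · exact ⟨a, ha, b, hb, hab, hseg, rfl⟩

/-- The point `b` of the polygon's boundary nearest to `x` is the midpoint of a side, or a vertex.
In the first case Pythagoras in the triangle formed by `x`, `b` and an end of that side gives the
bound; in the second the inradius is `δ`. -/
theorem sq_le_inradiusAt_sq_add {x : Plane} {δ : ℝ} {V : Finset Plane} (hV : IsInscribed x δ V)
    (hr : 0 < inradiusAt x V) :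
    δ ^ 2 ≤ inradiusAt x V ^ 2 + longestSide V ^ 2 / 4 := by
  set r := inradiusAt x V with hrdef
  set P := polygon V with hPdef
  have hPconv : Convex ℝ P := convex_convexHull ℝ _
  have hPcl : IsClosed P := (isCompact_polygon V).isClosed
  have hne : (Pᶜ).Nonempty := by
    by_contra h
    rw [Set.not_nonempty_iff_eq_empty] at h
    rw [hrdef, inradiusAt, ← hPdef, h, Metric.infDist_empty] at hr
    exact lt_irrefl _ hr
  obtain ⟨b, hbc, hbr⟩ := Metric.exists_mem_closure_infDist_eq_dist hne x
  have hbr' : dist x b = r := by rw [hrdef, inradiusAt, hbr]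
  have hbi : b ∉ interior P := by rwa [closure_compl] at hbc
  have hball : Metric.ball x r ⊆ P := by
    intro y hy
    by_contra hyP
    have := Metric.infDist_le_dist_of_mem (x := x) (show y ∈ Pᶜ from hyP)
    rw [Metric.mem_ball, dist_comm] at hy
    exact absurd hy (not_lt.2 this)
  have hbP : b ∈ P := by
    have : Metric.closedBall x r ⊆ P := by
      rw [← closure_ball x hr.ne']
      exact closure_minimal hball hPcl
    exact this (by rw [Metric.mem_closedBall, dist_comm, hbr'])
  have hsupp : ∀ z ∈ P, inner ℝ (z - x) (b - x) ≤ r ^ 2 := fun z hz =>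
    inner_le_of_mem_of_ball_subset hPconv hPcl hr hball hbr' hbi hz
  have hpn : ‖b - x‖ = r := by rw [← dist_eq_norm, dist_comm, hbr']
  obtain ⟨w, hw0, hw1, hwb⟩ := Finset.mem_convexHull'.1 hbP
  -- `b` is a convex combination of vertices and lies on the supporting line, so every vertex of
  -- positive weight lies on that line too.
  have hsum : ∑ z ∈ V, w z * (r ^ 2 - inner ℝ (z - x) (b - x)) = 0 := by
    have h1 : ∑ z ∈ V, w z * inner ℝ (z - x) (b - x) = r ^ 2 := by
      have : ∑ z ∈ V, w z • (z - x) = b - x := by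
        simp only [smul_sub, Finset.sum_sub_distrib, hwb, ← Finset.sum_smul, hw1, one_smul]
      calc _ = inner ℝ (∑ z ∈ V, w z • (z - x)) (b - x) := by
            rw [sum_inner]
            simp [real_inner_smul_left]
        _ = r ^ 2 := by rw [this, real_inner_self_eq_norm_sq, hpn]
    simp only [mul_sub, Finset.sum_sub_distrib, h1, ← Finset.sum_mul, hw1]
    ring
  have hVP : ∀ z ∈ V, z ∈ P := fun z hz => subset_convexHull ℝ _ hz
  have hF : ∀ z ∈ V, 0 < w z → inner ℝ (z - x) (b - x) = r ^ 2 := by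
    intro z hz hwz
    have := (Finset.sum_eq_zero_iff_of_nonneg (fun z hz => mul_nonneg (hw0 z hz)
      (sub_nonneg.2 (hsupp z (hVP z hz))))).1 hsum z hz
    rcases mul_eq_zero.1 this with h | h
    · exact absurd h hwz.ne'
    · linarith
  have hq : ∀ z ∈ V, 0 < w z → inner ℝ (z - b) (b - x) = 0 ∧ ‖z - b‖ ^ 2 = δ ^ 2 - r ^ 2 := by
    intro z hz hwz
    have h1 := hF z hz hwz
    have h2 : inner ℝ (z - b) (b - x) = 0 := by
      have : z - b = (z - x) - (b - x) := by abel
      rw [this, inner_sub_left, h1, real_inner_self_eq_norm_sq, hpn, sub_self]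
    refine ⟨h2, ?_⟩
    have h3 : ‖z - x‖ = δ := by rw [← dist_eq_norm]; exact hV.1 hz
    have h4 : z - x = (z - b) + (b - x) := by abel
    have h5 := norm_add_sq_real (z - b) (b - x)
    rw [← h4, h3, h2, hpn] at h5
    linarith
  obtain ⟨z, hz, hwz⟩ : ∃ z ∈ V, 0 < w z := by
    by_contra! h
    have : ∑ z ∈ V, w z ≤ 0 := Finset.sum_nonpos h
    linarith
  by_cases hbz : b = z
  · have := (hq z hz hwz).2
    rw [hbz] at this
    simp only [sub_self, norm_zero] at this
    nlinarith [sq_nonneg (longestSide V)]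
  obtain ⟨z', hz', hwz', hzz'⟩ : ∃ z' ∈ V, 0 < w z' ∧ z ≠ z' := by
    by_contra! h
    have h0 : ∀ z' ∈ V, z' ≠ z → w z' = 0 := fun z' hz' hne =>
      le_antisymm (not_lt.1 fun hlt => hne (h z' hz' hlt).symm) (hw0 z' hz')
    rw [Finset.sum_eq_single_of_mem z hz h0] at hw1
    rw [Finset.sum_eq_single_of_mem z hz (fun z' hz' hne => by rw [h0 z' hz' hne, zero_smul]),
      hw1, one_smul] at hwb
    exact hbz hwb.symm
  obtain ⟨ho, hn⟩ := hq z hz hwz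
  obtain ⟨ho', hn'⟩ := hq z' hz' hwz'
  have hp0 : b - x ≠ 0 := by
    rw [← norm_pos_iff, hpn]; exact hr
  have hnn : ‖z - b‖ = ‖z' - b‖ := by
    rw [← sq_eq_sq₀ (norm_nonneg _) (norm_nonneg _), hn, hn']
  -- A line meets the circle in points symmetric about the foot `b` of the perpendicular from the
  -- centre.
  have hneg : z - b = -(z' - b) := by
    rcases eq_or_eq_neg_of_inner_eq_zero hp0 ho ho' hnn with h | h
    · exact absurd (sub_left_injective h) hzz'
    · exact h
  have hdist : dist z z' = 2 * ‖z - b‖ := by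
    have : z - z' = (2 : ℝ) • (z - b) := by
      have h2 : z - z' = (z - b) - (z' - b) := by abel
      rw [h2, two_smul]
      nth_rewrite 3 [hneg]
      abel
    rw [dist_eq_norm, this, norm_smul]
    norm_num
  have hseg : segment ℝ z z' ⊆ frontier (polygon V) := by
    intro y hy
    have hyP : y ∈ P := hPconv.segment_subset (hVP z hz) (hVP z' hz') hy
    rw [hPcl.frontier_eq]
    refine ⟨hyP, fun hyi => ?_⟩
    have hyin : inner ℝ (y - x) (b - x) = r ^ 2 := by
      obtain ⟨s, t, hs, ht, hst, rfl⟩ := hy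
      have : s • z + t • z' - x = s • (z - x) + t • (z' - x) := by
        rw [smul_sub, smul_sub]
        have : x = s • x + t • x := by rw [← add_smul, hst, one_smul]
        nth_rewrite 1 [this]
        abel
      rw [this, inner_add_left, real_inner_smul_left, real_inner_smul_left, hF z hz hwz,
        hF z' hz' hwz', ← add_mul, hst, one_mul]
    -- An interior point of the polygon on the supporting line could be pushed across it.
    obtain ⟨ε, hε, hεP⟩ := Metric.mem_nhds_iff.1 (mem_interior_iff_mem_nhds.1 hyi)
    have hmem : y + (ε / (2 * r)) • (b - x) ∈ P := by
      apply hεP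
      rw [Metric.mem_ball, dist_self_add_left, norm_smul, hpn, Real.norm_eq_abs,
        abs_of_pos (by positivity)]
      field_simp
      linarith
    have := hsupp _ hmem
    rw [add_sub_right_comm, inner_add_left, hyin, real_inner_smul_left,
      real_inner_self_eq_norm_sq, hpn] at this
    have : 0 < ε / (2 * r) * r ^ 2 := by positivity
    linarith
  have hH := dist_le_longestSide hz hz' hzz' hseg
  rw [hdist] at hH
  have : (2 * ‖z - b‖) ^ 2 ≤ longestSide V ^ 2 := by gcongr
  nlinarith

theorem inradiusAt_le_dist {x y : Plane} {V : Finset Plane} (hy : y ∉ polygon V) :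
    inradiusAt x V ≤ dist x y :=
  Metric.infDist_le_dist_of_mem hy

/-! ### Triangles of a mesh -/

theorem exists_affineBasis_of_card_eq_three {s : Finset Plane}
    (hi : AffineIndependent ℝ ((↑) : s → Plane)) (hc : s.card = 3) :
    ∃ b : AffineBasis s ℝ Plane, ∀ p, b p = p := by
  refine ⟨⟨_, hi, ?_⟩, fun p => rfl⟩
  rw [hi.affineSpan_eq_top_iff_card_eq_finrank_add_one]
  simp [hc]

theorem range_affineBasis {s : Finset Plane} {b : AffineBasis s ℝ Plane} (hb : ∀ p, b p = p) :
    Set.range b = (s : Set Plane) := by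
  have : (b : s → Plane) = (↑) := funext hb
  rw [this, Subtype.range_coe]

theorem mem_convexHull_iff_coord {s : Finset Plane} {b : AffineBasis s ℝ Plane}
    (hb : ∀ p, b p = p) {x : Plane} :
    x ∈ convexHull ℝ (s : Set Plane) ↔ ∀ p, 0 ≤ b.coord p x := by
  rw [← range_affineBasis hb, b.convexHull_eq_nonneg_coord]; rfl

theorem mem_interior_convexHull_iff_coord {s : Finset Plane} {b : AffineBasis s ℝ Plane}
    (hb : ∀ p, b p = p) {x : Plane} :
    x ∈ interior (convexHull ℝ (s : Set Plane)) ↔ ∀ p, 0 < b.coord p x := by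
  rw [← range_affineBasis hb, b.interior_convexHull]; rfl

theorem mem_convexHull_erase {s : Finset Plane} {b : AffineBasis s ℝ Plane}
    (hb : ∀ p, b p = p) {x : Plane} (hx : x ∈ convexHull ℝ (s : Set Plane)) {p : s}
    (hp : b.coord p x = 0) : x ∈ convexHull ℝ ((s.erase p : Finset Plane) : Set Plane) := by
  rw [mem_convexHull_iff_coord hb] at hx
  have h1 : ∑ q ∈ Finset.univ.erase p, b.coord q x • b q = x := by
    conv_rhs => rw [← b.linear_combination_coord_eq_self x]
    exact Finset.sum_erase _ (by rw [hp, zero_smul])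
  rw [← h1]
  refine (convex_convexHull ℝ _).sum_mem (fun q _ => hx q) ?_ (fun q hq => ?_)
  · rw [Finset.sum_erase (f := fun q => b.coord q x) _ hp]
    exact b.sum_coord_apply_eq_one x
  · apply subset_convexHull
    rw [hb]
    simp only [Finset.coe_erase, Set.mem_sdiff, Finset.mem_coe, Set.mem_singleton_iff]
    exact ⟨q.2, fun h => (Finset.mem_erase.1 hq).1 (Subtype.ext h)⟩

theorem volume_convexHull_eq_zero {s : Finset Plane} (hs : s.card ≤ 2) :
    volume (convexHull ℝ (s : Set Plane)) = 0 := by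
  rcases s.eq_empty_or_nonempty with rfl | hne
  · simp
  refine measure_mono_null (convexHull_subset_affineSpan _)
    (Measure.addHaar_affineSubspace volume _ fun htop => ?_)
  obtain ⟨n, hn⟩ : ∃ n, s.card = n + 1 := ⟨s.card - 1, by have := hne.card_pos; omega⟩
  classical
  have h1 := finrank_vectorSpan_image_finset_le ℝ (id : Plane → Plane) s hn
  rw [Finset.image_id] at h1
  have h2 : vectorSpan ℝ (s : Set Plane) = ⊤ := by
    rw [← direction_affineSpan, htop, AffineSubspace.direction_top]
  rw [h2, finrank_top] at h1
  simp at h1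
  omega

/-- By conformity the intersection lies in the hull of the common vertices, and distinct triangles
share at most two. -/
theorem volume_convexHull_inter_eq_zero {K : Geometry.SimplicialComplex ℝ Plane}
    {s t : Finset Plane} (hs : s ∈ triangles K) (ht : t ∈ triangles K) (hst : s ≠ t) :
    volume (convexHull ℝ (s : Set Plane) ∩ convexHull ℝ (t : Set Plane)) = 0 := by
  classical
  refine measure_mono_null (K.inter_subset_convexHull hs.1 ht.1) ?_
  rw [← Finset.coe_inter]
  apply volume_convexHull_eq_zero
  by_contra! h
  have h1 : s ∩ t = s := Finset.eq_of_subset_of_card_le Finset.inter_subset_left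
    (by rw [hs.2]; omega)
  have h2 : s ∩ t = t := Finset.eq_of_subset_of_card_le Finset.inter_subset_right
    (by rw [ht.2]; omega)
  exact hst (h1.symm.trans h2)

/-- The intersection of the interiors is open and null, hence empty. -/
theorem disjoint_interior_convexHull {K : Geometry.SimplicialComplex ℝ Plane}
    {s t : Finset Plane} (hs : s ∈ triangles K) (ht : t ∈ triangles K) (hst : s ≠ t) :
    Disjoint (interior (convexHull ℝ (s : Set Plane)))
      (interior (convexHull ℝ (t : Set Plane))) := by
  rw [Set.disjoint_iff_inter_eq_empty]
  have ho : IsOpen (interior (convexHull ℝ (s : Set Plane)) ∩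
    interior (convexHull ℝ (t : Set Plane))) := isOpen_interior.inter isOpen_interior
  refine (ho.measure_eq_zero_iff (μ := volume)).1 (measure_mono_null ?_
    (volume_convexHull_inter_eq_zero hs ht hst))
  exact Set.inter_subset_inter interior_subset interior_subset

theorem isCompact_convexHull_finset (s : Finset Plane) :
    IsCompact (convexHull ℝ (s : Set Plane)) :=
  s.finite_toSet.isCompact_convexHull ℝ

section

variable {Ω : Set Plane} {δ : ℝ} {K : Geometry.SimplicialComplex ℝ Plane}

theorem IsConsistentTriangulation.isClosed_space (hK : IsConsistentTriangulation Ω δ K) :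
    IsClosed K.space :=
  hK.finite.isClosed_biUnion fun s _ => (isCompact_convexHull_finset s).isClosed

theorem IsConsistentTriangulation.finite_triangles (hK : IsConsistentTriangulation Ω δ K) :
    (triangles K).Finite :=
  hK.finite.subset fun _ h => h.1

theorem IsConsistentTriangulation.exists_triangle (hK : IsConsistentTriangulation Ω δ K)
    {x : Plane} (hx : x ∈ K.space) : ∃ t ∈ triangles K, x ∈ convexHull ℝ (t : Set Plane) := by
  obtain ⟨s, hs, hxs⟩ := Geometry.SimplicialComplex.mem_space_iff.1 hx
  obtain ⟨t, ht, hst⟩ := hK.pure s hs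
  exact ⟨t, ht, convexHull_mono (by exact_mod_cast hst) hxs⟩

/-- A point of the triangle at which a barycentric coordinate vanishes lies on the opposite edge. -/
theorem mem_interior_of_notMem_skeleton {t : Finset Plane} (ht : t ∈ triangles K) {x : Plane}
    (hx : x ∈ convexHull ℝ (t : Set Plane)) (hxs : x ∉ skeleton K) :
    x ∈ interior (convexHull ℝ (t : Set Plane)) := by
  obtain ⟨b, hb⟩ := exists_affineBasis_of_card_eq_three (K.indep ht.1) ht.2
  rw [mem_interior_convexHull_iff_coord hb]
  by_contra! h
  obtain ⟨p, hp⟩ := h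
  have hp0 : b.coord p x = 0 := le_antisymm hp ((mem_convexHull_iff_coord hb).1 hx p)
  have hmem := mem_convexHull_erase hb hx hp0
  have hcard : (t.erase (p : Plane)).card = 2 := by
    rw [Finset.card_erase_of_mem p.2, ht.2]
  apply hxs
  simp only [skeleton, Set.mem_iUnion]
  refine ⟨t.erase p, ⟨K.down_closed ht.1 (Finset.erase_subset _ _) ?_, hcard⟩, hmem⟩
  rw [← Finset.card_pos, hcard]; norm_num

/-- A connected part of the meshed region that meets no edge lies in a single triangle. -/
theorem IsConsistentTriangulation.exists_subset_triangle (hK : IsConsistentTriangulation Ω δ K)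
    {A : Set Plane} (hA : IsPreconnected A) (hne : A.Nonempty) (hAK : A ⊆ K.space)
    (hAs : Disjoint A (skeleton K)) : ∃ t ∈ triangles K, A ⊆ convexHull ℝ (t : Set Plane) := by
  have hint : ∀ x ∈ A, ∃ t ∈ triangles K, x ∈ interior (convexHull ℝ (t : Set Plane)) := by
    intro x hx
    obtain ⟨t, ht, hxt⟩ := hK.exists_triangle (hAK hx)
    exact ⟨t, ht, mem_interior_of_notMem_skeleton ht hxt (Set.disjoint_left.1 hAs hx)⟩
  obtain ⟨x, hx⟩ := hne
  obtain ⟨t, ht, hxt⟩ := hint x hx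
  refine ⟨t, ht, subset_trans ?_ interior_subset⟩
  -- Off the edges `A` is covered by the pairwise disjoint open interiors of triangles, so
  -- connectedness leaves room for only one.
  refine IsPreconnected.subset_left_of_subset_union (u := interior (convexHull ℝ (t : Set Plane)))
    (v := ⋃ s ∈ triangles K \ {t}, interior (convexHull ℝ (s : Set Plane))) isOpen_interior
    (isOpen_biUnion fun _ _ => isOpen_interior) ?_ ?_ ⟨x, hx, hxt⟩ hA
  · rw [Set.disjoint_iUnion₂_right]
    intro s hs
    exact disjoint_interior_convexHull ht hs.1 (fun h => hs.2 h.symm)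
  · intro y hy
    obtain ⟨s, hs, hys⟩ := hint y hy
    by_cases hst : s = t
    · left; rwa [← hst]
    · right
      simp only [Set.mem_iUnion]
      exact ⟨s, ⟨hs, hst⟩, hys⟩

end

/-! ### The enlarged domain -/

theorem ball_subset_enlarged_of_mem_frontier {Ω : Set Plane} {δ : ℝ} {z : Plane}
    (hz : z ∈ frontier Ω) : Metric.ball z δ ⊆ enlarged Ω δ := by
  intro y hy
  by_cases hyΩ : y ∈ Ω
  · exact Or.inl hyΩ
  · exact Or.inr ⟨hyΩ, (Metric.infDist_le_dist_of_mem hz).trans_lt hy⟩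

theorem exists_mem_frontier_segment {Ω : Set Plane} {x y : Plane} (hx : x ∈ Ω) (hy : y ∉ Ω) :
    ∃ z ∈ frontier Ω, z ∈ segment ℝ x y := by
  by_contra! h
  have hpc : IsPreconnected (segment ℝ x y) := (convex_segment x y).isPreconnected
  have hd : Disjoint (segment ℝ x y) (frontier Ω) := Set.disjoint_right.2 h
  have hsub : segment ℝ x y ⊆ interior Ω ∪ (closure Ω)ᶜ := by
    intro z hz
    by_cases hzi : z ∈ interior Ω
    · exact Or.inl hzi
    · right
      exact fun hzc => h z ⟨hzc, hzi⟩ hz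
  have hxi : x ∈ interior Ω := by
    rcases hsub (left_mem_segment ℝ x y) with h1 | h1
    · exact h1
    · exact absurd (subset_closure hx) h1
  have := hpc.subset_left_of_subset_union isOpen_interior isClosed_closure.isOpen_compl
    (Set.disjoint_compl_right_iff_subset.2 (interior_subset.trans subset_closure)) hsub
    ⟨x, left_mem_segment ℝ x y, hxi⟩
  exact hy (interior_subset (this (right_mem_segment ℝ x y)))

theorem exists_mem_frontier_dist_le {Ω : Set Plane} {x y : Plane} (hx : x ∈ Ω) (hy : y ∉ Ω) :
    ∃ z ∈ frontier Ω, dist z y ≤ dist x y := by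
  obtain ⟨z, hz, hzs⟩ := exists_mem_frontier_segment hx hy
  refine ⟨z, hz, ?_⟩
  have : segment ℝ x y ⊆ Metric.closedBall y (dist x y) :=
    (convex_closedBall y _).segment_subset (by simp) (by simp [dist_nonneg])
  exact this hzs

theorem ball_subset_enlarged_of_mem {Ω : Set Plane} {δ : ℝ} {x : Plane}
    (hx : x ∈ Ω) : Metric.ball x δ ⊆ enlarged Ω δ := by
  intro y hy
  by_cases hyΩ : y ∈ Ω
  · exact Or.inl hyΩ
  · obtain ⟨z, hz, hzd⟩ := exists_mem_frontier_dist_le hx hyΩ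
    rw [Metric.mem_ball, dist_comm] at hy
    refine Or.inr ⟨hyΩ, (Metric.infDist_le_dist_of_mem hz).trans_lt ?_⟩
    rw [dist_comm]
    exact hzd.trans_lt hy

/-- The circle around a collar point `y` may leave the meshed region. The ball around a nearby `z`
does not, and it will be shown to contain an arc of that circle of fixed angle. -/
theorem exists_ball_subset_enlarged {Ω : Set Plane} (hΩ : Ω.Nonempty) {δ : ℝ} (hδ : 0 < δ)
    {y : Plane} (hy : y ∈ enlarged Ω δ) :
    ∃ z, dist y z ≤ δ ∧ Metric.ball z δ ⊆ enlarged Ω δ := by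
  rcases hy with hy | hy
  · exact ⟨y, by simpa using hδ.le, ball_subset_enlarged_of_mem hy⟩
  · have hne : (frontier Ω).Nonempty := by
      obtain ⟨x, hx⟩ := hΩ
      obtain ⟨z, hz, -⟩ := exists_mem_frontier_dist_le hx hy.1
      exact ⟨z, hz⟩
    obtain ⟨z, hz, hzd⟩ := (Metric.infDist_lt_iff hne).1 hy.2
    exact ⟨z, hzd.le, ball_subset_enlarged_of_mem_frontier hz⟩

/-! ### Arcs of circles and the number of vertices of nocaps polygons -/

/-- The point at angle `θ` on the circle of radius `δ` around `y`, angles being measured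
from the direction of `e`. -/
def circlePoint (y e : Plane) (δ θ : ℝ) : Plane :=
  y + ((δ * Real.cos θ) • e + (δ * Real.sin θ) • rotation e)

theorem norm_sq_combination {e : Plane} (he : ‖e‖ = 1) (a b : ℝ) :
    ‖a • e + b • rotation e‖ ^ 2 = a ^ 2 + b ^ 2 := by
  have h : e 0 ^ 2 + e 1 ^ 2 = 1 := by rw [← norm_sq_plane, he, one_pow]
  rw [norm_sq_plane]
  simp only [PiLp.add_apply, PiLp.smul_apply, smul_eq_mul, rotation_apply_zero, rotation_apply_one]
  linear_combination (a ^ 2 + b ^ 2) * h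

theorem continuous_circlePoint (y e : Plane) (δ : ℝ) : Continuous (circlePoint y e δ) := by
  unfold circlePoint
  fun_prop

theorem circlePoint_mem_sphere {e : Plane} (he : ‖e‖ = 1) (y : Plane) {δ : ℝ} (hδ : 0 ≤ δ)
    (θ : ℝ) : circlePoint y e δ θ ∈ Metric.sphere y δ := by
  rw [mem_sphere_iff_norm, ← sq_eq_sq₀ (norm_nonneg _) hδ, circlePoint, add_sub_cancel_left,
    norm_sq_combination he]
  linear_combination δ ^ 2 * Real.cos_sq_add_sin_sq θ

theorem dist_circlePoint_sq {e : Plane} (he : ‖e‖ = 1) (y : Plane) (δ θ φ : ℝ) :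
    dist (circlePoint y e δ θ) (circlePoint y e δ φ) ^ 2 =
      (2 * δ * Real.sin ((θ - φ) / 2)) ^ 2 := by
  have h1 : circlePoint y e δ θ - circlePoint y e δ φ =
      (δ * Real.cos θ - δ * Real.cos φ) • e + (δ * Real.sin θ - δ * Real.sin φ) • rotation e := by
    unfold circlePoint
    rw [sub_smul, sub_smul]
    abel
  rw [dist_eq_norm, h1, norm_sq_combination he, mul_pow, Real.sin_sq_eq_half_sub,
    mul_div_cancel₀ _ two_ne_zero, Real.cos_sub]
  linear_combination δ ^ 2 * Real.cos_sq_add_sin_sq θ + δ ^ 2 * Real.cos_sq_add_sin_sq φ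

/-- The squared distance to the shifted centre is `δ² - d (2 δ cos θ - d)`, and `cos θ ≥ 1/2` for
`|θ| ≤ 1`. So an arc of two radians stays in the ball. -/
theorem circlePoint_mem_closedBall {e : Plane} (he : ‖e‖ = 1) (y : Plane) {δ d θ : ℝ}
    (hd : 0 ≤ d) (hdδ : d ≤ δ) (hθ : θ ∈ Set.Icc (-1 : ℝ) 1) :
    circlePoint y e δ θ ∈ Metric.closedBall (y + d • e) δ := by
  have hδ : 0 ≤ δ := hd.trans hdδ
  rw [mem_closedBall_iff_norm, ← sq_le_sq₀ (norm_nonneg _) hδ]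
  have h1 : circlePoint y e δ θ - (y + d • e) =
      (δ * Real.cos θ - d) • e + (δ * Real.sin θ) • rotation e := by
    unfold circlePoint
    rw [sub_smul]
    abel
  rw [h1, norm_sq_combination he]
  have h2 : 1 / 2 ≤ Real.cos θ := by
    have := Real.one_sub_sq_div_two_le_cos (x := θ)
    nlinarith [hθ.1, hθ.2]
  have h3 := Real.cos_sq_add_sin_sq θ
  have h4 : (δ * Real.cos θ - d) ^ 2 + (δ * Real.sin θ) ^ 2 =
      δ ^ 2 - d * (2 * δ * Real.cos θ - d) := by linear_combination δ ^ 2 * h3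
  have h5 : 0 ≤ 2 * δ * Real.cos θ - d := by nlinarith
  rw [h4]
  nlinarith [mul_nonneg hd h5]

theorem exists_unit_direction {y z : Plane} :
    ∃ e : Plane, ‖e‖ = 1 ∧ z = y + dist y z • e := by
  by_cases h : z = y
  · exact ⟨EuclideanSpace.single 0 1, by simp, by simp [h]⟩
  · have hn : ‖z - y‖ ≠ 0 := norm_ne_zero_iff.2 (sub_ne_zero.2 h)
    refine ⟨(‖z - y‖)⁻¹ • (z - y), ?_, ?_⟩
    · rw [norm_smul, norm_inv, norm_norm, inv_mul_cancel₀ hn]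
    · rw [dist_comm, dist_eq_norm, smul_smul, mul_inv_cancel₀ hn, one_smul, add_sub_cancel]

/-- The number of vertices of a nocaps polygon is at least of the order `δ / h`. -/
theorem div_le_card_of_isNocaps {Ω : Set Plane} {δ h : ℝ}
    {K : Geometry.SimplicialComplex ℝ Plane} (hΩ : Ω.Nonempty)
    (hK : IsConsistentTriangulation Ω δ K) (hh : 0 < h) (hhδ : h < δ)
    (hdiam : ∀ s ∈ triangles K, Metric.diam (convexHull ℝ (s : Set Plane)) ≤ h)
    {y : Plane} (hy : y ∈ enlarged Ω δ) {V : Finset Plane} (hV : IsInscribed y δ V)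
    (hVK : IsNocaps K δ y V) : δ / (4 * h) ≤ V.card := by
  have hδ : 0 < δ := hh.trans hhδ
  obtain ⟨z, hyz, hz⟩ := exists_ball_subset_enlarged hΩ hδ hy
  obtain ⟨e, he, hze⟩ := exists_unit_direction (y := y) (z := z)
  have hcb : Metric.closedBall z δ ⊆ K.space := by
    rw [← closure_ball z hδ.ne']
    exact closure_minimal (hz.trans hK.covers) hK.isClosed_space
  have hcirc : ∀ θ ∈ Set.Icc (-1 : ℝ) 1, circlePoint y e δ θ ∈ K.space := by
    intro θ hθ
    apply hcb
    rw [hze]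
    exact circlePoint_mem_closedBall he y dist_nonneg hyz hθ
  -- The two radians are cut into `N` cells of angle `τ`. Only the first half of each cell is
  -- searched for a vertex; the gaps between these halves keep the vertices found distinct.
  set τ : ℝ := 4 * h / δ with hτ
  have hτ0 : 0 < τ := by positivity
  set N : ℕ := ⌊δ / (2 * h)⌋₊ with hN
  have hNτ : N * τ ≤ 2 := by
    have : (N : ℝ) ≤ δ / (2 * h) := Nat.floor_le (by positivity)
    calc N * τ ≤ δ / (2 * h) * τ := by gcongr
      _ = 2 := by rw [hτ]; field_simp; norm_num
  have hval : ∀ i : Fin N, ∃ θ ∈ Set.Icc (-1 + i * τ) (-1 + i * τ + τ / 2),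
      circlePoint y e δ θ ∈ V := by
    intro i
    have hi : ((i : ℕ) : ℝ) + 1 ≤ N := by exact_mod_cast i.2
    have hsub : Set.Icc (-1 + i * τ) (-1 + i * τ + τ / 2) ⊆ Set.Icc (-1 : ℝ) 1 := by
      apply Set.Icc_subset_Icc
      · have : 0 ≤ (i : ℝ) * τ := by positivity
        linarith
      · nlinarith
    have hle : -1 + i * τ ≤ -1 + i * τ + τ / 2 := by linarith
    have : ∃ θ ∈ Set.Icc (-1 + i * τ) (-1 + i * τ + τ / 2),
        circlePoint y e δ θ ∈ skeleton K := by
      by_contra! hno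
      obtain ⟨t, ht, hsubt⟩ := hK.exists_subset_triangle
        (A := circlePoint y e δ '' Set.Icc (-1 + i * τ) (-1 + i * τ + τ / 2))
        (isPreconnected_Icc.image _ (continuous_circlePoint y e δ).continuousOn)
        ((Set.nonempty_Icc.2 hle).image _)
        (by rintro _ ⟨θ, hθ, rfl⟩; exact hcirc θ (hsub hθ))
        (by
          rw [Set.disjoint_left]
          rintro _ ⟨θ, hθ, rfl⟩
          exact hno θ hθ)
      have hd := Metric.dist_le_diam_of_mem (isCompact_convexHull_finset t).isBounded
        (hsubt ⟨-1 + i * τ + τ / 2, Set.right_mem_Icc.2 hle, rfl⟩)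
        (hsubt ⟨-1 + i * τ, Set.left_mem_Icc.2 hle, rfl⟩)
      have hd2 := hd.trans (hdiam t ht)
      have hd3 := dist_circlePoint_sq he y δ (-1 + i * τ + τ / 2) (-1 + i * τ)
      have harg : (-1 + i * τ + τ / 2 - (-1 + i * τ)) / 2 = h / δ := by
        rw [hτ]; field_simp; ring
      rw [harg] at hd3
      have hlt : h / δ < 1 := (div_lt_one hδ).2 hhδ
      have hsin := Real.mul_le_sin (x := h / δ) (by positivity)
        (by linarith [Real.pi_gt_three])
      -- The chord of half a cell exceeds the diameter of a triangle, because `sin t ≥ 2t/π` and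
      -- `4/π > 1`. Hence the arc cannot lie in a single triangle.
      have h1 : h < 2 * δ * Real.sin (h / δ) := by
        have : 2 * δ * (2 / Real.pi * (h / δ)) = 4 / Real.pi * h := by field_simp; norm_num
        have h4 : 1 < 4 / Real.pi := (one_lt_div Real.pi_pos).2 Real.pi_lt_four
        nlinarith
      nlinarith [dist_nonneg (x := circlePoint y e δ (-1 + i * τ + τ / 2))
        (y := circlePoint y e δ (-1 + i * τ))]
    obtain ⟨θ, hθ, hθs⟩ := this
    refine ⟨θ, hθ, ?_⟩
    have : circlePoint y e δ θ ∈ (V : Set Plane) ∩ K.space := by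
      rw [show (V : Set Plane) ∩ K.space = _ from hVK]
      exact ⟨circlePoint_mem_sphere he y hδ.le θ, hθs⟩
    exact this.1
  choose θ hθ hθV using hval
  have hinj : Function.Injective fun i : Fin N => (⟨circlePoint y e δ (θ i), hθV i⟩ : V) := by
    have hlt : ∀ i j : Fin N, i < j → circlePoint y e δ (θ j) ≠ circlePoint y e δ (θ i) := by
      intro i j hij heq
      have hd := dist_circlePoint_sq he y δ (θ j) (θ i)
      rw [heq, dist_self] at hd
      have hij' : ((i : ℕ) : ℝ) + 1 ≤ (j : ℕ) := by exact_mod_cast hij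
      have hj : ((j : ℕ) : ℝ) + 1 ≤ N := by exact_mod_cast j.2
      have h1 : 0 < θ j - θ i := by nlinarith [(hθ i).2, (hθ j).1]
      have h2 : θ j - θ i ≤ 2 := by
        have : 0 ≤ (i : ℝ) * τ := by positivity
        nlinarith [(hθ i).1, (hθ j).2]
      have h3 : 0 < Real.sin ((θ j - θ i) / 2) :=
        Real.sin_pos_of_pos_of_lt_pi (by linarith) (by linarith [Real.pi_gt_three])
      have : 0 < (2 * δ * Real.sin ((θ j - θ i) / 2)) ^ 2 := by positivity
      rw [← hd] at this
      norm_num at this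
    intro i j hij
    have hij' : circlePoint y e δ (θ i) = circlePoint y e δ (θ j) := congrArg Subtype.val hij
    rcases lt_trichotomy i j with h1 | h1 | h1
    · exact absurd hij'.symm (hlt i j h1)
    · exact h1
    · exact absurd hij' (hlt j i h1)
  have hcard := Fintype.card_le_of_injective _ hinj
  simp only [Fintype.card_fin, Fintype.card_coe] at hcard
  have hcard' : (N : ℝ) ≤ V.card := by exact_mod_cast hcard
  have h3 : (3 : ℝ) ≤ V.card := by exact_mod_cast hV.2
  have hfl := Nat.lt_floor_add_one (δ / (2 * h))
  rw [← hN] at hfl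
  have h2q : δ / (2 * h) = 2 * (δ / (4 * h)) := by field_simp; norm_num
  rw [h2q] at hfl
  -- With `q = δ/(4h)` the count exceeds `2q - 1`, which is at least `q` for `q ≥ 1`. Small `q` is
  -- covered by the three vertices of any polygon.
  by_cases hq : δ / (4 * h) ≤ 3 <;> linarith

/-- The longest sides of the polygons are of the order of the mesh size. -/
theorem exists_longestSide_le {ι : Type*} {Ω : Set Plane} (hΩ : Ω.Nonempty) {δ h : ι → ℝ}
    (hh : ∀ k, 0 < h k ∧ h k < δ k) {K : ι → Geometry.SimplicialComplex ℝ Plane}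
    (hK : ∀ k, IsConsistentTriangulation Ω (δ k) (K k))
    (hdiam : ∀ k, ∀ s ∈ triangles (K k), Metric.diam (convexHull ℝ (s : Set Plane)) ≤ h k)
    {V : ι → Plane → Finset Plane}
    (hV : ∀ k, ∀ x ∈ enlarged Ω (δ k), IsInscribed x (δ k) (V k x)) {C₁ : ℝ}
    (hC₁ : 0 < C₁) (hVq : ∀ k, ∀ x ∈ enlarged Ω (δ k),
      longestSide (V k x) / (2 * Real.sin (Real.pi / (V k x).card)) ≤ C₁ * δ k)
    (hVK : PolygonsMatchMesh (fun k => enlarged Ω (δ k)) δ h K V) :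
    ∃ C > 0, ∀ k, ∀ x ∈ enlarged Ω (δ k), longestSide (V k x) ≤ C * h k := by
  obtain ⟨c, hc, hcard⟩ : ∃ c > 0, ∀ k, ∀ x ∈ enlarged Ω (δ k),
      c * (δ k / h k) ≤ ((V k x).card : ℝ) := by
    rcases hVK with hno | ⟨c, hc, C, -, hcC⟩
    · refine ⟨1 / 4, by norm_num, fun k x hx => ?_⟩
      have := div_le_card_of_isNocaps hΩ (hK k) (hh k).1 (hh k).2 (hdiam k) hx (hV k x hx)
        (hno k x hx)
      refine le_trans (le_of_eq ?_) this
      have := (hh k).1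
      field_simp
    · exact ⟨c, hc, fun k x hx => (hcC k x hx).1⟩
  -- With `n` sides, weak quasi-uniformity gives `H ≤ 2 C₁ δ sin(π/n) ≤ 2π C₁ δ/n`, and `n ≥ c δ/h`.
  refine ⟨2 * Real.pi * C₁ / c, by positivity, fun k x hx => ?_⟩
  have hh0 := (hh k).1
  have hδ0 : 0 < δ k := hh0.trans (hh k).2
  have hn3 : (3 : ℝ) ≤ (V k x).card := by exact_mod_cast (hV k x hx).2
  have hn0 : (0 : ℝ) < (V k x).card := by linarith
  have hang : 0 < Real.pi / (V k x).card := by positivity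
  have hsin : 0 < Real.sin (Real.pi / (V k x).card) := by
    apply Real.sin_pos_of_pos_of_lt_pi hang
    apply div_lt_self Real.pi_pos; linarith
  have h1 := hVq k x hx
  rw [div_le_iff₀ (by positivity)] at h1
  have h2 : Real.sin (Real.pi / (V k x).card) ≤ Real.pi / (V k x).card := Real.sin_le hang.le
  have h3 : Real.pi / (V k x).card ≤ Real.pi / (c * (δ k / h k)) :=
    div_le_div_of_nonneg_left Real.pi_pos.le (by positivity) (hcard k x hx)
  calc longestSide (V k x) ≤ C₁ * δ k * (2 * Real.sin (Real.pi / (V k x).card)) := h1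
    _ ≤ C₁ * δ k * (2 * (Real.pi / (c * (δ k / h k)))) := by gcongr; exact h2.trans h3
    _ = 2 * Real.pi * C₁ / c * h k := by field_simp

/-! ### Piecewise linear functions -/

theorem PiecewiseLinear.measurable {S : Set (Finset Plane)} (hS : S.Finite) {v : Plane → ℝ}
    (hv : PiecewiseLinear S v) : Measurable v := by
  choose! a ha using hv.1
  intro B hB
  have hmeas : ∀ s : Finset Plane, MeasurableSet (convexHull ℝ (s : Set Plane)) := fun s =>
    (isCompact_convexHull_finset s).measurableSet
  have : v ⁻¹' B = (⋃ s ∈ S, convexHull ℝ (s : Set Plane) ∩ a s ⁻¹' B) ∪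
      ((⋃ s ∈ S, convexHull ℝ (s : Set Plane))ᶜ ∩ (fun _ => (0 : ℝ)) ⁻¹' B) := by
    ext x
    by_cases hx : x ∈ ⋃ s ∈ S, convexHull ℝ (s : Set Plane)
    · simp only [Set.mem_preimage, Set.mem_union, Set.mem_inter_iff, Set.mem_compl_iff, hx,
        not_true, false_and, or_false]
      simp only [Set.mem_iUnion, Set.mem_inter_iff, Set.mem_preimage, exists_prop] at hx ⊢
      constructor
      · intro hxB
        obtain ⟨s, hs, hxs⟩ := hx
        exact ⟨s, hs, hxs, by rwa [← ha s hs x hxs]⟩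
      · rintro ⟨s, hs, hxs, hxB⟩
        rwa [ha s hs x hxs]
    · simp only [Set.mem_preimage, Set.mem_union, Set.mem_inter_iff, Set.mem_compl_iff, hx,
        not_false_eq_true, true_and, hv.2 x hx]
      simp only [Set.mem_iUnion, Set.mem_inter_iff, Set.mem_preimage, exists_prop] at hx ⊢
      constructor
      · exact fun h => Or.inr h
      · rintro (⟨s, hs, hxs, -⟩ | h)
        · exact absurd ⟨s, hs, hxs⟩ hx
        · exact h
  rw [this]
  have hac : ∀ s, Continuous (a s) := fun s => (a s).continuous_of_finiteDimensional
  refine (hS.measurableSet_biUnion fun s _ => (hmeas s).inter ((hac s).measurable hB)).union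
    ((hS.measurableSet_biUnion fun s _ => hmeas s).compl.inter (measurable_const hB))

theorem PiecewiseLinear.exists_abs_le {S : Set (Finset Plane)} (hS : S.Finite) {v : Plane → ℝ}
    (hv : PiecewiseLinear S v) : ∃ B, 0 ≤ B ∧ ∀ x, |v x| ≤ B := by
  choose! a ha using hv.1
  have hb : ∀ s ∈ S, ∃ B, ∀ x ∈ convexHull ℝ (s : Set Plane), |v x| ≤ B := by
    intro s hs
    obtain ⟨B, hB⟩ := (isCompact_convexHull_finset s).exists_bound_of_continuousOn
      (a s).continuous_of_finiteDimensional.continuousOn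
    exact ⟨B, fun x hx => by rw [ha s hs x hx]; exact hB x hx⟩
  choose! B hB using hb
  refine ⟨∑ s ∈ hS.toFinset, |B s|, Finset.sum_nonneg fun _ _ => abs_nonneg _, fun x => ?_⟩
  by_cases hx : x ∈ ⋃ s ∈ S, convexHull ℝ (s : Set Plane)
  · simp only [Set.mem_iUnion, exists_prop] at hx
    obtain ⟨s, hs, hxs⟩ := hx
    calc |v x| ≤ B s := hB s hs x hxs
      _ ≤ |B s| := le_abs_self _
      _ ≤ _ := Finset.single_le_sum (f := fun s => |B s|) (fun _ _ => abs_nonneg _)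
        (hS.mem_toFinset.2 hs)
  · rw [hv.2 x hx, abs_zero]
    exact Finset.sum_nonneg fun _ _ => abs_nonneg _

theorem PiecewiseLinear.sub {S : Set (Finset Plane)} {v w : Plane → ℝ}
    (hv : PiecewiseLinear S v) (hw : PiecewiseLinear S w) : PiecewiseLinear S (v - w) := by
  refine ⟨fun s hs => ?_, fun x hx => by simp [hv.2 x hx, hw.2 x hx]⟩
  obtain ⟨a, ha⟩ := hv.1 s hs
  obtain ⟨b, hb⟩ := hw.1 s hs
  exact ⟨a - b, fun x hx => by simp [ha x hx, hb x hx]⟩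

/-! ### Nodal interpolation on triangles -/

theorem exists_affineMap_eq_on_vertices {s : Finset Plane}
    (hi : AffineIndependent ℝ ((↑) : s → Plane)) (hc : s.card = 3) (φ : Plane → ℝ) :
    ∃ a : Plane →ᵃ[ℝ] ℝ, ∀ p ∈ s, a p = φ p := by
  obtain ⟨b, hb⟩ := exists_affineBasis_of_card_eq_three hi hc
  obtain ⟨a, ha⟩ : ∃ a : Plane →ᵃ[ℝ] ℝ, ∀ x, a x = ∑ p : s, φ p * b.coord p x := by
    refine ⟨∑ p : s, φ p • b.coord p, fun x => ?_⟩
    have : ∀ T : Finset s, (∑ p ∈ T, φ p • b.coord p) x = ∑ p ∈ T, φ p * b.coord p x := by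
      classical
      intro T
      induction T using Finset.induction_on with
      | empty => simp
      | insert p T hp ih => rw [Finset.sum_insert hp, Finset.sum_insert hp]; simp [ih]
    exact this _
  refine ⟨a, fun p hp => ?_⟩
  rw [ha, Finset.sum_eq_single_of_mem (⟨p, hp⟩ : s) (Finset.mem_univ _)]
  · have := b.coord_apply_eq (⟨p, hp⟩ : s)
    rw [hb] at this
    rw [this, mul_one]
  · intro q _ hq
    have := b.coord_apply_ne (j := (⟨p, hp⟩ : s)) hq
    rw [hb] at this
    rw [this, mul_zero]

/-- Nodal interpolation in the space of continuous piecewise linear functions. -/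
theorem exists_piecewiseLinear_interpolant {K : Geometry.SimplicialComplex ℝ Plane}
    {S : Set (Finset Plane)} (hS : S ⊆ triangles K) (φ : Plane → ℝ) :
    ∃ v, PiecewiseLinear S v ∧ ∀ s ∈ S, ∀ p ∈ s, v p = φ p := by
  classical
  have hex : ∀ s ∈ S, ∃ a : Plane →ᵃ[ℝ] ℝ, ∀ p ∈ s, a p = φ p := fun s hs =>
    exists_affineMap_eq_on_vertices (K.indep (hS hs).1) (hS hs).2 φ
  choose! a ha using hex
  -- Two triangles meet inside the hull of their common vertices, where the two affine pieces take
  -- the same nodal values; so the pieces glue.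
  have hcons : ∀ s ∈ S, ∀ t ∈ S, ∀ x ∈ convexHull ℝ (s : Set Plane),
      x ∈ convexHull ℝ (t : Set Plane) → a s x = a t x := by
    intro s hs t ht x hxs hxt
    have hx := K.inter_subset_convexHull (hS hs).1 (hS ht).1 ⟨hxs, hxt⟩
    have hconv : Convex ℝ ((a s - a t) ⁻¹' {0}) := (convex_singleton (0 : ℝ)).affine_preimage _
    have hsub : (s ∩ t : Set Plane) ⊆ (a s - a t) ⁻¹' {0} := by
      intro p hp
      have h1 := ha s hs p hp.1
      have h2 := ha t ht p hp.2
      simp [h1, h2]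
    have := convexHull_min hsub hconv hx
    simpa [sub_eq_zero] using this
  set v : Plane → ℝ := fun x =>
    if h : ∃ s ∈ S, x ∈ convexHull ℝ (s : Set Plane) then a h.choose x else 0 with hv
  have hva : ∀ s ∈ S, ∀ x ∈ convexHull ℝ (s : Set Plane), v x = a s x := by
    intro s hs x hx
    have h : ∃ s ∈ S, x ∈ convexHull ℝ (s : Set Plane) := ⟨s, hs, hx⟩
    simp only [hv, dif_pos h]
    exact hcons _ h.choose_spec.1 s hs x h.choose_spec.2 hx
  refine ⟨v, ⟨fun s hs => ⟨a s, hva s hs⟩, fun x hx => ?_⟩, fun s hs p hp => ?_⟩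
  · simp only [Set.mem_iUnion, exists_prop] at hx
    simp only [hv, dif_neg hx]
  · rw [hva s hs p (subset_convexHull ℝ _ hp), ha s hs p hp]

/-- An affine function that is close to `u` at the vertices of a triangle is close to `u` at a
point around which `u` is close to a linear function. -/
theorem abs_affine_sub_le {s : Finset Plane} {a : Plane →ᵃ[ℝ] ℝ} {u : Plane → ℝ} {x : Plane}
    (hx : x ∈ convexHull ℝ (s : Set Plane)) {L : Plane →L[ℝ] ℝ} {ε E : ℝ}
    (ha : ∀ p ∈ s, |a p - u p| ≤ ε) (hu : ∀ p ∈ s, |u p - u x - L (p - x)| ≤ E) :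
    |a x - u x| ≤ ε + E := by
  -- `G` is `a` minus the linearisation of `u` at `x`. Being affine, it inherits at `x` any interval
  -- bound that holds at the vertices, and `G x = a x - u x`.
  set G : Plane →ᵃ[ℝ] ℝ := a - L.toLinearMap.toAffineMap + AffineMap.const ℝ Plane (L x - u x)
  have hG : ∀ y, G y = a y - u x - L (y - x) := by
    intro y
    simp only [G, AffineMap.coe_add, AffineMap.coe_sub, Pi.add_apply, Pi.sub_apply,
      LinearMap.coe_toAffineMap, ContinuousLinearMap.coe_coe, AffineMap.const_apply, map_sub]
    ring
  have hconv : Convex ℝ (G ⁻¹' Set.Icc (-(ε + E)) (ε + E)) :=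
    (convex_Icc _ _).affine_preimage G
  have hsub : (s : Set Plane) ⊆ G ⁻¹' Set.Icc (-(ε + E)) (ε + E) := by
    intro p hp
    rw [Set.mem_preimage, Set.mem_Icc, ← abs_le, hG]
    have h1 := ha p hp
    have h2 := hu p hp
    have : a p - u x - L (p - x) = (a p - u p) + (u p - u x - L (p - x)) := by ring
    rw [this]
    exact (abs_add_le _ _).trans (add_le_add h1 h2)
  have := convexHull_min hsub hconv hx
  rw [Set.mem_preimage, Set.mem_Icc, ← abs_le, hG] at this
  simpa using this

/-- Linear interpolation error on a triangle, no regularity of the triangle being needed. -/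
theorem abs_affine_sub_le_of_diam_le {s : Finset Plane} {a : Plane →ᵃ[ℝ] ℝ} {u : Plane → ℝ}
    {S : Set Plane} (hS : IsOpen S) {M h ε : ℝ} (hu : ContDiffOn ℝ 2 u S)
    (hM : ∀ x ∈ S, ‖iteratedFDeriv ℝ 2 u x‖ ≤ M)
    (hdiam : Metric.diam (convexHull ℝ (s : Set Plane)) ≤ h)
    (hc : ContinuousOn u (convexHull ℝ (s : Set Plane)))
    (ha : ∀ p ∈ s, |a p - u p| ≤ ε) {x : Plane} (hx : x ∈ convexHull ℝ (s : Set Plane))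
    (hseg : ∀ p ∈ s, ∀ t ∈ Set.Ico (0 : ℝ) 1, x + t • (p - x) ∈ S) :
    |a x - u x| ≤ ε + M * h ^ 2 := by
  refine abs_affine_sub_le hx (L := fderiv ℝ u x) ha fun p hp => ?_
  have hps : p ∈ convexHull ℝ (s : Set Plane) := subset_convexHull ℝ _ hp
  refine (abs_sub_linear_le hS hu hM (hseg p hp)
    (hc.mono ((convex_convexHull ℝ _).segment_subset hx hps))).trans ?_
  have hM0 : 0 ≤ M := (norm_nonneg _).trans (hM _ (hseg p hp 0 (by simp)))
  have hd := Metric.dist_le_diam_of_mem (isCompact_convexHull_finset s).isBounded hps hx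
  rw [dist_eq_norm] at hd
  have := hd.trans hdiam
  gcongr

/-! ### Null sets -/

section

variable {Ω : Set Plane}

theorem IsPolygonalDomain.isOpen (hΩ : IsPolygonalDomain Ω) : IsOpen Ω := hΩ.1

theorem IsPolygonalDomain.nonempty (hΩ : IsPolygonalDomain Ω) : Ω.Nonempty := hΩ.2.1

theorem IsPolygonalDomain.isCompact_closure (hΩ : IsPolygonalDomain Ω) :
    IsCompact (closure Ω) := by
  obtain ⟨S, hS, -, hcl⟩ := hΩ.2.2.2
  rw [hcl]
  exact hS.isCompact_biUnion fun s _ => isCompact_convexHull_finset s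

/-- A frontier point interior to one of the triangles would be interior to `closure Ω`, hence in
`Ω`. So the frontier lies in the triangles' boundaries, which are null by convexity. -/
theorem IsPolygonalDomain.volume_frontier (hΩ : IsPolygonalDomain Ω) :
    volume (frontier Ω) = 0 := by
  obtain ⟨ho, -, hint, S, hS, -, hcl⟩ := hΩ
  refine measure_mono_null (t := ⋃ s ∈ S, frontier (convexHull ℝ (s : Set Plane))) ?_ ?_
  · intro x hx
    rw [ho.frontier_eq] at hx
    have hx1 : x ∈ ⋃ s ∈ S, convexHull ℝ (s : Set Plane) := hcl ▸ hx.1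
    simp only [Set.mem_iUnion, exists_prop] at hx1 ⊢
    obtain ⟨s, hs, hxs⟩ := hx1
    refine ⟨s, hs, subset_closure hxs, fun hxi => hx.2 ?_⟩
    rw [← hint]
    refine interior_mono ?_ hxi
    rw [hcl]
    exact Set.subset_biUnion_of_mem (u := fun s : Finset Plane => convexHull ℝ (s : Set Plane)) hs
  · rw [measure_biUnion_null_iff hS.countable]
    exact fun s _ => (convex_convexHull ℝ _).addHaar_frontier volume

theorem isOpen_enlarged (ho : IsOpen Ω) (hne : (frontier Ω).Nonempty) (δ : ℝ) :
    IsOpen (enlarged Ω δ) := by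
  have : enlarged Ω δ = Ω ∪ Metric.thickening δ (frontier Ω) := by
    ext x
    have hm : x ∈ Metric.thickening δ (frontier Ω) ↔ Metric.infDist x (frontier Ω) < δ := by
      rw [Metric.mem_thickening_iff, Metric.infDist_lt_iff hne]
    simp only [enlarged, interactionDomain, Set.mem_union, hm, Set.mem_ofPred_eq]
    tauto
  rw [this]
  exact ho.union Metric.isOpen_thickening

theorem IsPolygonalDomain.ne_univ (hΩ : IsPolygonalDomain Ω) : Ω ≠ Set.univ := by
  intro h
  have := hΩ.isCompact_closure
  rw [h, closure_univ] at this
  exact noncompact_univ Plane this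

theorem IsPolygonalDomain.nonempty_frontier (hΩ : IsPolygonalDomain Ω) :
    (frontier Ω).Nonempty :=
  nonempty_frontier_iff.2 ⟨hΩ.nonempty, hΩ.ne_univ⟩

theorem IsPolygonalDomain.isOpen_enlarged (hΩ : IsPolygonalDomain Ω) (δ : ℝ) :
    IsOpen (enlarged Ω δ) :=
  NonlocalFEM.isOpen_enlarged hΩ.isOpen hΩ.nonempty_frontier δ

theorem enlarged_mono {δ δ' : ℝ} (h : δ ≤ δ') : enlarged Ω δ ⊆ enlarged Ω δ' := by
  rintro x (hx | hx)
  · exact Or.inl hx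
  · exact Or.inr ⟨hx.1, hx.2.trans_le h⟩

theorem closure_subset_enlarged {δ : ℝ} (hδ : 0 < δ) : closure Ω ⊆ enlarged Ω δ := by
  intro x hx
  by_cases hxΩ : x ∈ Ω
  · exact Or.inl hxΩ
  · refine Or.inr ⟨hxΩ, ?_⟩
    rw [Metric.infDist_zero_of_mem]
    · exact hδ
    · exact ⟨hx, fun h => hxΩ (interior_subset h)⟩

/-! ### Mesh functions up to null sets -/

variable {δ : ℝ} {K : Geometry.SimplicialComplex ℝ Plane}

theorem IsConsistentTriangulation.ae_mem_interior (hK : IsConsistentTriangulation Ω δ K) :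
    ∀ᵐ x : Plane, (∀ s ∈ triangles K, x ∈ convexHull ℝ (s : Set Plane) →
      x ∈ interior (convexHull ℝ (s : Set Plane))) ∧
      ∀ s ∈ triangles K, ∀ t ∈ triangles K, x ∈ convexHull ℝ (s : Set Plane) →
        x ∈ convexHull ℝ (t : Set Plane) → s = t := by
  have hc := hK.finite_triangles.countable
  refine Filter.Eventually.and ?_ ?_
  · rw [ae_ball_iff hc]
    intro s hs
    have h0 := (convex_convexHull ℝ (s : Set Plane)).addHaar_frontier volume
    filter_upwards [compl_mem_ae_iff.2 h0] with x hx hxs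
    by_contra hni
    exact hx ⟨subset_closure hxs, hni⟩
  · rw [ae_ball_iff hc]
    intro s hs
    rw [ae_ball_iff hc]
    intro t ht
    by_cases hst : s = t
    · exact ae_of_all _ fun _ _ _ => hst
    filter_upwards [compl_mem_ae_iff.2 (volume_convexHull_inter_eq_zero hs ht hst)] with x hx h1 h2
    exact absurd ⟨h1, h2⟩ hx

/-- Almost every point of `closure Ω` lies in a domain triangle and in no other. On `∂Ω` itself
collar functions need not vanish. -/
theorem IsConsistentTriangulation.ae_collar_eq_zero (hK : IsConsistentTriangulation Ω δ K)
    {v : Plane → ℝ} (hv : v ∈ collarSpace Ω K) : ∀ᵐ x : Plane, x ∈ closure Ω → v x = 0 := by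
  filter_upwards [hK.ae_mem_interior] with x hx hxΩ
  apply hv.2
  simp only [Set.mem_iUnion, exists_prop, not_exists, not_and]
  intro t ht hxt
  rw [← hK.consistent] at hxΩ
  simp only [Set.mem_iUnion, exists_prop] at hxΩ
  obtain ⟨s, hs, hxs⟩ := hxΩ
  have := hx.2 s hs.1 t ht.1 hxs hxt
  exact ht.2 (this ▸ hs.2)

theorem IsConsistentTriangulation.domain_eq_zero (hK : IsConsistentTriangulation Ω δ K)
    {v : Plane → ℝ} (hv : v ∈ domainSpace Ω K) {x : Plane} (hx : x ∉ closure Ω) : v x = 0 := by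
  apply hv.2
  rwa [hK.consistent]

/-- The nodal interpolant on the mesh of the domain. -/
theorem IsConsistentTriangulation.exists_domain_interpolant
    (hK : IsConsistentTriangulation Ω δ K) {u : Plane → ℝ} {S : Set Plane} (hS : IsOpen S)
    (hΩS : closure Ω ⊆ S) {M h : ℝ} (hu : ContDiffOn ℝ 2 u S)
    (hM : ∀ x ∈ S, ‖iteratedFDeriv ℝ 2 u x‖ ≤ M)
    (hdiam : ∀ s ∈ triangles K, Metric.diam (convexHull ℝ (s : Set Plane)) ≤ h) :
    ∃ v ∈ domainSpace Ω K, ∀ x ∈ closure Ω, |v x - u x| ≤ M * h ^ 2 := by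
  obtain ⟨v, hv, hvu⟩ := exists_piecewiseLinear_interpolant
    (S := domainTriangles Ω K) (K := K) (fun s hs => hs.1) u
  refine ⟨v, hv, fun x hx => ?_⟩
  rw [← hK.consistent] at hx
  simp only [Set.mem_iUnion, exists_prop] at hx
  obtain ⟨s, hs, hxs⟩ := hx
  obtain ⟨a, ha⟩ := hv.1 s hs
  rw [ha x hxs]
  have hsS : convexHull ℝ (s : Set Plane) ⊆ S := hs.2.trans hΩS
  have := abs_affine_sub_le_of_diam_le (a := a) (ε := 0) hS hu hM (hdiam s hs.1)
    (hu.continuousOn.mono hsS) (fun p hp => by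
      rw [← ha p (subset_convexHull ℝ _ hp), hvu s hs p hp, sub_self, abs_zero]) hxs
    (fun p hp t ht => hsS ((convex_convexHull ℝ _).add_smul_sub_mem hxs
      (subset_convexHull ℝ _ hp) ⟨ht.1, ht.2.le⟩))
  simpa using this

/-- The discrete volume constraint approximates the volume constraint. -/
theorem IsConsistentTriangulation.ae_abs_collar_sub_le (hΩ : IsPolygonalDomain Ω)
    (hK : IsConsistentTriangulation Ω δ K) {g gh : Plane → ℝ} {M N h : ℝ}
    (hgc : ContinuousOn g (collar Ω K)) (hg : CbBound 2 (interior (collar Ω K)) M g)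
    (hgh : gh ∈ collarSpace Ω K)
    (hghn : ∀ s ∈ collarTriangles Ω K, ∀ p ∈ s, |gh p - g p| ≤ N * h ^ 2)
    (hdiam : ∀ s ∈ triangles K, Metric.diam (convexHull ℝ (s : Set Plane)) ≤ h) :
    ∀ᵐ x : Plane, x ∈ interactionDomain Ω δ → |gh x - g x| ≤ N * h ^ 2 + M * h ^ 2 := by
  filter_upwards [hK.ae_mem_interior, compl_mem_ae_iff.2 hΩ.volume_frontier] with x hx hxf hxI
  obtain ⟨t, ht, hxt⟩ := hK.exists_triangle (hK.covers (Or.inr hxI))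
  have htc : t ∈ collarTriangles Ω K := by
    refine ⟨ht, fun hsub => hxf ?_⟩
    rw [hΩ.isOpen.frontier_eq]
    exact ⟨hsub hxt, hxI.1⟩
  have hti := hx.1 t ht hxt
  have hcol : convexHull ℝ (t : Set Plane) ⊆ collar Ω K :=
    Set.subset_biUnion_of_mem (u := fun s : Finset Plane => convexHull ℝ (s : Set Plane)) htc
  obtain ⟨a, ha⟩ := hgh.1 t htc
  rw [ha x hxt]
  refine abs_affine_sub_le_of_diam_le isOpen_interior (by exact_mod_cast hg.1)
    (fun y hy => hg.2 2 le_rfl y hy) (hdiam t ht) (hgc.mono hcol) (fun p hp => ?_) hxt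
    (fun p hp t' ht' => ?_)
  · rw [← ha p (subset_convexHull ℝ _ hp)]
    exact hghn t htc p hp
  -- The derivative bounds on `g` hold only inside the collar. The segment from the interior point
  -- `x` to a vertex stays inside until its end.
  · have h1 := (convex_convexHull ℝ (t : Set Plane)).add_smul_sub_mem_interior
      (x := p) (y := x) (t := 1 - t') (subset_convexHull ℝ _ hp) hti
      ⟨by linarith [ht'.2], by linarith [ht'.1]⟩
    have h2 : p + (1 - t') • (x - p) = x + t' • (p - x) := by
      rw [sub_smul, one_smul, smul_sub, smul_sub]; abel
    rw [h2] at h1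
    exact interior_mono hcol h1

end

/-! ### The nonlocal Poincaré inequality -/

/-- After `N` steps `z` the support is left, so `w x` telescopes into `N` increments. Cauchy–Schwarz
costs one factor `N`; the increments have equal integrals by translation invariance, which costs the
other. -/
theorem lintegral_sq_le_lintegral_translate {w : Plane → ℝ} (hw : Measurable w) {A : Set Plane}
    (hwA : ∀ x, x ∉ A → w x = 0) {d : ℝ} (hd : ∀ x ∈ A, ∀ y ∈ A, dist x y ≤ d) {z : Plane} {N : ℕ}
    (hN : d < N * ‖z‖) :
    ∫⁻ x, ENNReal.ofReal (w x ^ 2) ≤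
      ENNReal.ofReal (N ^ 2) * ∫⁻ x, ENNReal.ofReal ((w (x + z) - w x) ^ 2) := by
  have hpt : ∀ x, w x ^ 2 ≤ N * ∑ j ∈ Finset.range N,
      (w (x + (j : ℝ) • z + z) - w (x + (j : ℝ) • z)) ^ 2 := by
    intro x
    by_cases hx : x ∈ A
    · have hxN : w (x + (N : ℝ) • z) = 0 := by
        apply hwA
        intro hA
        have := hd _ hA x hx
        rw [dist_self_add_left, norm_smul, Real.norm_natCast] at this
        linarith
      have hsum : ∑ j ∈ Finset.range N, (w (x + (j : ℝ) • z + z) - w (x + (j : ℝ) • z)) = -w x := by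
        have h1 : ∀ j : ℕ, x + (j : ℝ) • z + z = x + ((j + 1 : ℕ) : ℝ) • z := by
          intro j
          push_cast
          rw [add_smul, one_smul, add_assoc]
        simp_rw [h1]
        rw [Finset.sum_range_sub (fun j : ℕ => w (x + (j : ℝ) • z)), hxN]
        simp
      have := sq_sum_le_card_mul_sum_sq (s := Finset.range N)
        (f := fun j : ℕ => w (x + (j : ℝ) • z + z) - w (x + (j : ℝ) • z))
      rw [hsum, neg_sq, Finset.card_range] at this
      exact this
    · rw [hwA x hx]
      have : 0 ≤ ∑ j ∈ Finset.range N,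
        (w (x + (j : ℝ) • z + z) - w (x + (j : ℝ) • z)) ^ 2 :=
        Finset.sum_nonneg fun _ _ => sq_nonneg _
      nlinarith [Nat.cast_nonneg (α := ℝ) N, mul_nonneg (Nat.cast_nonneg (α := ℝ) N) this]
  have hmeas : Measurable fun x => ENNReal.ofReal ((w (x + z) - w x) ^ 2) := by fun_prop
  calc ∫⁻ x, ENNReal.ofReal (w x ^ 2)
      ≤ ∫⁻ x, ENNReal.ofReal N * ∑ j ∈ Finset.range N,
        ENNReal.ofReal ((w (x + (j : ℝ) • z + z) - w (x + (j : ℝ) • z)) ^ 2) := by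
        refine lintegral_mono fun x => ?_
        rw [← ENNReal.ofReal_sum_of_nonneg (fun _ _ => sq_nonneg _),
          ← ENNReal.ofReal_mul (Nat.cast_nonneg _)]
        exact ENNReal.ofReal_le_ofReal (hpt x)
    _ = ENNReal.ofReal N * ∑ j ∈ Finset.range N, ∫⁻ x,
        ENNReal.ofReal ((w (x + (j : ℝ) • z + z) - w (x + (j : ℝ) • z)) ^ 2) := by
        rw [lintegral_const_mul' _ _ ENNReal.ofReal_ne_top, lintegral_finsetSum]
        intro j _
        fun_prop
    _ = ENNReal.ofReal N * ∑ j ∈ Finset.range N, ∫⁻ x,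
        ENNReal.ofReal ((w (x + z) - w x) ^ 2) := by
        congr 1
        refine Finset.sum_congr rfl fun j _ => ?_
        exact lintegral_add_right_eq_self
          (fun x => ENNReal.ofReal ((w (x + z) - w x) ^ 2)) ((j : ℝ) • z)
    _ = _ := by
        rw [Finset.sum_const, Finset.card_range, nsmul_eq_mul, ← mul_assoc, pow_two,
          ENNReal.ofReal_mul (Nat.cast_nonneg _), ENNReal.ofReal_natCast]

theorem volume_annulus {r s : ℝ} (hs : 0 ≤ s) (hsr : s ≤ r) (x : Plane) :
    volume (Metric.ball x r \ Metric.ball x s) = ENNReal.ofReal (Real.pi * (r ^ 2 - s ^ 2)) := by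
  have hfin : volume (Metric.ball x r \ Metric.ball x s) ≠ ⊤ :=
    (measure_mono Set.sdiff_subset |>.trans_lt measure_ball_lt_top).ne
  rw [← ENNReal.ofReal_toReal hfin]
  congr 1
  have := measureReal_sdiff (μ := (volume : Measure Plane)) (Metric.ball_subset_ball hsr)
    (Metric.isOpen_ball (x := x) (ε := s)).measurableSet
  rw [volume_real_ball x hs, volume_real_ball x (hs.trans hsr)] at this
  rw [← Measure.real, this]
  ring

/-- The translation bound is integrated over the steps with `r/2 ≤ ‖z‖ < r`, an annulus of area at
least `r²`. For these `N ≤ (2d + r₀)/r` steps suffice, whence `N²/r² ≤ (2d + r₀)²/r⁴`. -/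
theorem lintegral_sq_le_lintegral_ball {w : Plane → ℝ} (hw : Measurable w) {A : Set Plane}
    (hwA : ∀ x, x ∉ A → w x = 0) {d r r₀ : ℝ} (hd0 : 0 ≤ d)
    (hd : ∀ x ∈ A, ∀ y ∈ A, dist x y ≤ d) (hr : 0 < r) (hr₀ : r ≤ r₀) :
    ∫⁻ x, ENNReal.ofReal (w x ^ 2) ≤ ENNReal.ofReal ((2 * d + r₀) ^ 2 / r ^ 4) *
      ∫⁻ x, ∫⁻ y in Metric.ball x r, ENNReal.ofReal ((w y - w x) ^ 2) := by
  set N : ℕ := ⌊2 * d / r⌋₊ + 1 with hN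
  set Q := ∫⁻ x, ∫⁻ y in Metric.ball x r, ENNReal.ofReal ((w y - w x) ^ 2)
  set Z := Metric.ball (0 : Plane) r \ Metric.ball 0 (r / 2) with hZ
  have hZm : MeasurableSet Z :=
    Metric.isOpen_ball.measurableSet.diff Metric.isOpen_ball.measurableSet
  have hN1 : 2 * d / r < N := by rw [hN]; push_cast; exact Nat.lt_floor_add_one _
  have hN2 : (N : ℝ) ≤ (2 * d + r₀) / r := by
    rw [hN]
    push_cast
    have := Nat.floor_le (show 0 ≤ 2 * d / r by positivity)
    rw [add_div]
    have : 1 ≤ r₀ / r := (one_le_div hr).2 hr₀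
    linarith
  have hz : ∀ z ∈ Z, ∫⁻ x, ENNReal.ofReal (w x ^ 2) ≤
      ENNReal.ofReal (N ^ 2) * ∫⁻ x, ENNReal.ofReal ((w (x + z) - w x) ^ 2) := by
    intro z hz
    refine lintegral_sq_le_lintegral_translate hw hwA hd ?_
    have h1 : r / 2 ≤ ‖z‖ := by
      have := hz.2
      rw [mem_ball_zero_iff, not_lt] at this
      exact this
    rw [div_lt_iff₀ hr] at hN1
    have : (0 : ℝ) ≤ N := Nat.cast_nonneg _
    nlinarith
  have hshift : ∀ x, ∫⁻ z in Metric.ball (0 : Plane) r, ENNReal.ofReal ((w (x + z) - w x) ^ 2) =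
      ∫⁻ y in Metric.ball x r, ENNReal.ofReal ((w y - w x) ^ 2) := by
    intro x
    have := (measurePreserving_add_left (volume : Measure Plane) x).setLIntegral_comp_preimage_emb
      (measurableEmbedding_addLeft x) (fun y => ENNReal.ofReal ((w y - w x) ^ 2)) (Metric.ball x r)
    rw [← this]
    congr 2
    ext z; simp
  have hint : ∫⁻ z in Z, ∫⁻ x, ENNReal.ofReal (w x ^ 2) ≤ ENNReal.ofReal (N ^ 2) * Q := by
    calc ∫⁻ z in Z, ∫⁻ x, ENNReal.ofReal (w x ^ 2)
        ≤ ∫⁻ z in Z, ENNReal.ofReal (N ^ 2) * ∫⁻ x, ENNReal.ofReal ((w (x + z) - w x) ^ 2) :=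
          setLIntegral_mono' hZm hz
      _ ≤ ∫⁻ z in Metric.ball 0 r,
          ENNReal.ofReal (N ^ 2) * ∫⁻ x, ENNReal.ofReal ((w (x + z) - w x) ^ 2) :=
          lintegral_mono_set Set.sdiff_subset
      _ = ENNReal.ofReal (N ^ 2) * ∫⁻ z in Metric.ball 0 r,
          ∫⁻ x, ENNReal.ofReal ((w (x + z) - w x) ^ 2) :=
          lintegral_const_mul' _ _ ENNReal.ofReal_ne_top
      _ = ENNReal.ofReal (N ^ 2) * ∫⁻ x, ∫⁻ z in Metric.ball 0 r,
          ENNReal.ofReal ((w (x + z) - w x) ^ 2) := by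
          congr 1
          refine lintegral_lintegral_swap ?_
          refine Measurable.aemeasurable ?_
          simp only [Function.uncurry_def]
          fun_prop
      _ = ENNReal.ofReal (N ^ 2) * Q := by simp_rw [hshift]; rfl
  rw [setLIntegral_const, hZ, volume_annulus (by positivity) (by linarith)] at hint
  set I := ∫⁻ x, ENNReal.ofReal (w x ^ 2)
  have hr2 : r ^ 2 ≤ Real.pi * (r ^ 2 - (r / 2) ^ 2) := by nlinarith [Real.pi_gt_three, sq_nonneg r]
  have h1 : I * ENNReal.ofReal (r ^ 2) ≤ ENNReal.ofReal (((2 * d + r₀) / r) ^ 2) * Q := by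
    calc _ ≤ I * ENNReal.ofReal (Real.pi * (r ^ 2 - (r / 2) ^ 2)) := by gcongr
      _ ≤ ENNReal.ofReal (N ^ 2) * Q := hint
      _ ≤ _ := by gcongr
  have h2 : I = ENNReal.ofReal ((r ^ 2)⁻¹) * (I * ENNReal.ofReal (r ^ 2)) := by
    rw [mul_comm I, ← mul_assoc, ← ENNReal.ofReal_mul (by positivity),
      inv_mul_cancel₀ (by positivity), ENNReal.ofReal_one, one_mul]
  rw [h2]
  calc _ ≤ ENNReal.ofReal ((r ^ 2)⁻¹) * (ENNReal.ofReal (((2 * d + r₀) / r) ^ 2) * Q) := by gcongr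
    _ = _ := by
      rw [← mul_assoc, ← ENNReal.ofReal_mul (by positivity)]
      congr 2
      field_simp

/-- The nonlocal Poincaré inequality, with a constant that is explicit in the horizon. -/
theorem lintegral_sq_le_energy {w : Plane → ℝ} (hw : Measurable w) {A D : Set Plane}
    (hD : MeasurableSet D)
    (hwA : ∀ x, x ∉ A → w x = 0) {d r r₀ c : ℝ} (hd0 : 0 ≤ d)
    (hd : ∀ x ∈ A, ∀ y ∈ A, dist x y ≤ d) (hr : 0 < r) (hr₀ : r ≤ r₀) (hc : 0 < c)
    (hAD : A ⊆ D) (hball : ∀ x ∈ A, Metric.ball x r ⊆ D) {γ : Plane → Plane → ℝ}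
    (hγ : ∀ x ∈ D, ∀ y ∈ D, dist x y < r → c ≤ γ x y) :
    ∫⁻ x, ENNReal.ofReal (w x ^ 2) ≤ ENNReal.ofReal ((2 * d + r₀) ^ 2 / (r ^ 4 * c)) *
      ∫⁻ x in D, ∫⁻ y in D, ENNReal.ofReal ((w y - w x) ^ 2 * γ x y) := by
  -- Pairs at distance below `r` that are not both in `D` contribute nothing, as neither point can
  -- be in the support.
  have hzero : ∀ x y, dist x y < r → (x ∉ D ∨ y ∉ D) → w y - w x = 0 := by
    intro x y hxy hor
    have hx : x ∉ A := by
      intro hx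
      rcases hor with h | h
      · exact h (hAD hx)
      · exact h (hball x hx (by rwa [Metric.mem_ball, dist_comm]))
    have hy : y ∉ A := by
      intro hy
      rcases hor with h | h
      · exact h (hball y hy hxy)
      · exact h (hAD hy)
    rw [hwA x hx, hwA y hy, sub_zero]
  have hle : ∫⁻ x, ∫⁻ y in Metric.ball x r, ENNReal.ofReal ((w y - w x) ^ 2) ≤
      ENNReal.ofReal c⁻¹ *
        ∫⁻ x in D, ∫⁻ y in D, ENNReal.ofReal ((w y - w x) ^ 2 * γ x y) := by
    rw [← lintegral_const_mul' _ _ ENNReal.ofReal_ne_top, ← lintegral_indicator hD]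
    refine lintegral_mono fun x => ?_
    by_cases hx : x ∈ D
    · rw [Set.indicator_of_mem hx, ← lintegral_const_mul' _ _ ENNReal.ofReal_ne_top,
        ← lintegral_indicator hD, ← lintegral_indicator Metric.isOpen_ball.measurableSet]
      refine lintegral_mono fun y => ?_
      by_cases hy : y ∈ Metric.ball x r
      · rw [Set.indicator_of_mem hy]
        rw [Metric.mem_ball, dist_comm] at hy
        by_cases hyD : y ∈ D
        · rw [Set.indicator_of_mem hyD, ← ENNReal.ofReal_mul (by positivity)]
          apply ENNReal.ofReal_le_ofReal
          have h1 := hγ x hx y hyD hy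
          have h2 : (w y - w x) ^ 2 * c ≤ (w y - w x) ^ 2 * γ x y := by gcongr
          calc (w y - w x) ^ 2 = c⁻¹ * ((w y - w x) ^ 2 * c) := by field_simp
            _ ≤ _ := by gcongr
        · rw [hzero x y hy (Or.inr hyD)]; simp
      · rw [Set.indicator_of_notMem hy]; exact zero_le
    · rw [Set.indicator_of_notMem hx]
      refine le_of_eq ?_
      rw [setLIntegral_congr_fun (g := fun _ => 0) Metric.isOpen_ball.measurableSet, lintegral_zero]
      intro y hy
      rw [Metric.mem_ball, dist_comm] at hy
      simp only
      rw [hzero x y hy (Or.inl hx)]; simp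
  refine (lintegral_sq_le_lintegral_ball hw hwA hd0 hd hr hr₀).trans ?_
  calc _ ≤ ENNReal.ofReal ((2 * d + r₀) ^ 2 / r ^ 4) * (ENNReal.ofReal c⁻¹ *
        ∫⁻ x in D, ∫⁻ y in D, ENNReal.ofReal ((w y - w x) ^ 2 * γ x y)) := by gcongr
    _ = _ := by
      rw [← mul_assoc, ← ENNReal.ofReal_mul (by positivity)]
      congr 2
      field_simp

/-! ### The area of the interaction domain -/

/-- With `ε = δ/r`, the offset `y - q` is `ε` times a vector of length below `r`. Thus `y` is the
dilate by `1 + ε` of a convex combination of `q` and a point of the inscribed disc. -/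
theorem mem_image_homothety_of_dist_lt {T : Set Plane} (hT : Convex ℝ T) {c : Plane} {r δ : ℝ}
    (hr : 0 < r) (hδ : 0 < δ) (hc : Metric.closedBall c r ⊆ T) {y q : Plane} (hq : q ∈ T)
    (hyq : dist y q < δ) : y ∈ AffineMap.homothety c (1 + δ / r) '' T := by
  set ε := δ / r with hε
  have hε0 : 0 < ε := by positivity
  have h1 : c + ε⁻¹ • (y - q) ∈ T := by
    apply hc
    rw [Metric.mem_closedBall, dist_self_add_left, norm_smul, ← dist_eq_norm, norm_inv,
      Real.norm_eq_abs, abs_of_pos hε0, hε, inv_div, div_mul_eq_mul_div, div_le_iff₀ hδ]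
    gcongr
  refine ⟨(1 + ε)⁻¹ • q + (ε * (1 + ε)⁻¹) • (c + ε⁻¹ • (y - q)), ?_, ?_⟩
  · refine hT hq h1 (by positivity) (by positivity) ?_
    field_simp
  · ext i
    simp only [AffineMap.homothety_apply, vsub_eq_sub, vadd_eq_add, PiLp.add_apply, PiLp.smul_apply,
      PiLp.sub_apply, smul_eq_mul]
    field_simp
    ring

/-- The shell lies between `T` and its dilate by `1 + δ/r`, so its area is at most `((1 + δ/r)² -
1)|T|`, which is linear in `δ` up to `δ₀`. -/
theorem exists_volume_neighbourhood_le {T : Set Plane} (hT : Convex ℝ T) (hTc : IsCompact T)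
    (hTi : (interior T).Nonempty) (δ₀ : ℝ) : ∃ C, 0 ≤ C ∧ ∀ δ, 0 < δ → δ ≤ δ₀ →
      volume {y | y ∉ T ∧ ∃ q ∈ T, dist y q < δ} ≤ ENNReal.ofReal (C * δ) := by
  obtain ⟨c, hc⟩ := hTi
  obtain ⟨r, hr, hcr⟩ := Metric.nhds_basis_closedBall.mem_iff.1 (mem_interior_iff_mem_nhds.1 hc)
  by_cases hδ₀ : 0 < δ₀
  swap
  · exact ⟨0, le_rfl, fun δ h1 h2 => absurd (h1.trans_le h2) hδ₀⟩
  have hTfin : volume T ≠ ⊤ := hTc.measure_lt_top.ne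
  refine ⟨(2 / r + δ₀ / r ^ 2) * (volume T).toReal, by positivity, fun δ hδ hδ0 => ?_⟩
  set H := AffineMap.homothety c (1 + δ / r) '' T with hH
  have hsub : {y | y ∉ T ∧ ∃ q ∈ T, dist y q < δ} ⊆ H \ T := by
    rintro y ⟨hyT, q, hq, hyq⟩
    exact ⟨mem_image_homothety_of_dist_lt hT hr hδ hcr hq hyq, hyT⟩
  have hTH : T ⊆ H := fun y hy =>
    mem_image_homothety_of_dist_lt hT hr hδ hcr hy (by rwa [dist_self])
  have hvH : volume H = ENNReal.ofReal ((1 + δ / r) ^ 2) * volume T := by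
    rw [hH, Measure.addHaar_image_homothety]
    congr 2
    rw [abs_of_nonneg (by positivity)]
    simp
  refine (measure_mono hsub).trans ?_
  rw [measure_sdiff hTH hTc.measurableSet.nullMeasurableSet hTfin, hvH]
  conv_lhs => rw [← ENNReal.ofReal_toReal hTfin]
  rw [← ENNReal.ofReal_mul (by positivity), ← ENNReal.ofReal_sub _ ENNReal.toReal_nonneg]
  apply ENNReal.ofReal_le_ofReal
  have : (1 + δ / r) ^ 2 * (volume T).toReal - (volume T).toReal =
      (2 / r + δ / r ^ 2) * (volume T).toReal * δ := by field_simp; ring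
  rw [this]
  gcongr

/-- Up to the null frontier, the collar is covered by the shells of the finitely many triangles. Its
thinness gains half a power of `δ` for the data error in the collar. -/
theorem IsPolygonalDomain.exists_volume_interactionDomain_le {Ω : Set Plane}
    (hΩ : IsPolygonalDomain Ω) (δ₀ : ℝ) : ∃ C, 0 ≤ C ∧ ∀ δ, 0 < δ → δ ≤ δ₀ →
      volume (interactionDomain Ω δ) ≤ ENNReal.ofReal (C * δ) := by
  obtain ⟨S, hS, hS3, hcl⟩ := hΩ.2.2.2
  have hex : ∀ s ∈ S, ∃ C, 0 ≤ C ∧ ∀ δ, 0 < δ → δ ≤ δ₀ →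
      volume {y | y ∉ convexHull ℝ (s : Set Plane) ∧
        ∃ q ∈ convexHull ℝ (s : Set Plane), dist y q < δ} ≤ ENNReal.ofReal (C * δ) := by
    intro s hs
    refine exists_volume_neighbourhood_le (convex_convexHull ℝ _) (isCompact_convexHull_finset s)
      ?_ δ₀
    obtain ⟨b, hb⟩ := exists_affineBasis_of_card_eq_three (hS3 s hs).2 (hS3 s hs).1
    rw [interior_convexHull_nonempty_iff_affineSpan_eq_top, ← range_affineBasis hb]
    exact b.tot
  choose! C hC0 hC using hex
  refine ⟨∑ s ∈ hS.toFinset, C s,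
    Finset.sum_nonneg fun s hs => hC0 s (hS.mem_toFinset.1 hs), fun δ hδ hδ0 => ?_⟩
  have hsub : interactionDomain Ω δ ⊆ frontier Ω ∪ ⋃ s ∈ hS.toFinset,
      {y | y ∉ convexHull ℝ (s : Set Plane) ∧
        ∃ q ∈ convexHull ℝ (s : Set Plane), dist y q < δ} := by
    intro y hy
    by_cases hyc : y ∈ closure Ω
    · left
      rw [hΩ.isOpen.frontier_eq]
      exact ⟨hyc, hy.1⟩
    right
    obtain ⟨q, hq, hyq⟩ := (Metric.infDist_lt_iff hΩ.nonempty_frontier).1 hy.2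
    have hqc : q ∈ closure Ω := frontier_subset_closure hq
    rw [hcl] at hqc hyc
    simp only [Set.mem_iUnion, exists_prop, not_exists, not_and] at hqc hyc
    obtain ⟨s, hs, hqs⟩ := hqc
    simp only [Set.mem_iUnion]
    exact ⟨s, hS.mem_toFinset.2 hs, hyc s hs, q, hqs, hyq⟩
  refine (measure_mono hsub).trans ((measure_union_le _ _).trans ?_)
  rw [hΩ.volume_frontier, zero_add, Finset.sum_mul,
    ENNReal.ofReal_sum_of_nonneg fun s hs => mul_nonneg (hC0 s (hS.mem_toFinset.1 hs)) hδ.le]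
  exact (measure_biUnion_finset_le _ _).trans
    (Finset.sum_le_sum fun s hs => hC s (hS.mem_toFinset.1 hs) δ hδ hδ0)

/-! ### Essentially bounded functions and quadratic energies -/

/-- `f` is measurable and essentially bounded. -/
def EssBdd {α : Type*} [MeasurableSpace α] (f : α → ℝ) (μ : Measure α) : Prop :=
  AEStronglyMeasurable f μ ∧ ∃ B, ∀ᵐ x ∂μ, ‖f x‖ ≤ B

section

variable {α β : Type*} [MeasurableSpace α] [MeasurableSpace β] {μ : Measure α} {ν : Measure β}
  {f g : α → ℝ}

theorem EssBdd.of_measurable (hf : Measurable f) {B : ℝ} (hB : ∀ x, |f x| ≤ B) : EssBdd f μ :=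
  ⟨hf.aestronglyMeasurable, B, ae_of_all _ hB⟩

theorem EssBdd.integrable [IsFiniteMeasure μ] (hf : EssBdd f μ) : Integrable f μ := by
  obtain ⟨h, B, hB⟩ := hf
  exact Integrable.of_bound h B hB

theorem EssBdd.add (hf : EssBdd f μ) (hg : EssBdd g μ) : EssBdd (fun x => f x + g x) μ := by
  obtain ⟨h, B, hB⟩ := hf
  obtain ⟨h', B', hB'⟩ := hg
  refine ⟨h.add h', B + B', ?_⟩
  filter_upwards [hB, hB'] with x h1 h2
  exact (norm_add_le _ _).trans (add_le_add h1 h2)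

theorem EssBdd.sub (hf : EssBdd f μ) (hg : EssBdd g μ) : EssBdd (fun x => f x - g x) μ := by
  obtain ⟨h, B, hB⟩ := hf
  obtain ⟨h', B', hB'⟩ := hg
  refine ⟨h.sub h', B + B', ?_⟩
  filter_upwards [hB, hB'] with x h1 h2
  exact (norm_sub_le _ _).trans (add_le_add h1 h2)

theorem EssBdd.mul (hf : EssBdd f μ) (hg : EssBdd g μ) : EssBdd (fun x => f x * g x) μ := by
  obtain ⟨h, B, hB⟩ := hf
  obtain ⟨h', B', hB'⟩ := hg
  refine ⟨h.mul h', B * B', ?_⟩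
  filter_upwards [hB, hB'] with x h1 h2
  rw [norm_mul]
  exact mul_le_mul h1 h2 (norm_nonneg _) ((norm_nonneg _).trans h1)

theorem EssBdd.sq (hf : EssBdd f μ) : EssBdd (fun x => f x ^ 2) μ := by
  simpa only [pow_two] using hf.mul hf

theorem EssBdd.const_mul (hf : EssBdd f μ) (c : ℝ) : EssBdd (fun x => c * f x) μ := by
  refine EssBdd.mul ⟨aestronglyMeasurable_const, ‖c‖, ae_of_all _ fun _ => le_rfl⟩ hf

theorem EssBdd.comp_fst [SFinite ν] (hf : EssBdd f μ) :
    EssBdd (fun p : α × β => f p.1) (μ.prod ν) := by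
  obtain ⟨h, B, hB⟩ := hf
  exact ⟨h.comp_fst, B, Measure.quasiMeasurePreserving_fst.ae hB⟩

theorem EssBdd.comp_snd [SFinite μ] [SFinite ν] {f : β → ℝ} (hf : EssBdd f ν) :
    EssBdd (fun p : α × β => f p.2) (μ.prod ν) := by
  obtain ⟨h, B, hB⟩ := hf
  exact ⟨h.comp_snd, B, Measure.quasiMeasurePreserving_snd.ae hB⟩

theorem EssBdd.integral_prod_left [SFinite μ] [IsFiniteMeasure ν] {F : α × β → ℝ}
    (hF : EssBdd F (μ.prod ν)) : EssBdd (fun x => ∫ y, F (x, y) ∂ν) μ := by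
  obtain ⟨h, B, hB⟩ := hF
  refine ⟨h.integral_prod_right', B * ν.real Set.univ, ?_⟩
  filter_upwards [Measure.ae_ae_of_ae_prod hB] with x hx
  exact norm_integral_le_of_norm_le_const hx

theorem EssBdd.mono_measure {μ' : Measure α} (hf : EssBdd f μ) (h : μ' ≤ μ) : EssBdd f μ' :=
  ⟨hf.1.mono_measure h, hf.2.imp fun _ hB => ae_mono h hB⟩

end

/-- The bilinear form of the energy. -/
def energyForm {α : Type*} [MeasurableSpace α] (μ : Measure α) (γ : α → α → ℝ) (u v : α → ℝ) : ℝ :=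
  ∫ p, (u p.2 - u p.1) * (v p.2 - v p.1) * γ p.1 p.2 ∂(μ.prod μ)

theorem energyForm_self_nonneg {α : Type*} [MeasurableSpace α] {μ : Measure α}
    {γ : α → α → ℝ} (h0 : ∀ x y, 0 ≤ γ x y) (u : α → ℝ) :
    0 ≤ energyForm μ γ u u :=
  integral_nonneg fun _ => mul_nonneg (mul_self_nonneg _) (h0 _ _)

/-! ### Inequalities for the energy form -/

section

variable {α : Type*} [MeasurableSpace α] {μ : Measure α} [IsFiniteMeasure μ] {γ : α → α → ℝ}

theorem EssBdd.diff {u : α → ℝ} (hu : EssBdd u μ) :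
    EssBdd (fun p : α × α => u p.2 - u p.1) (μ.prod μ) :=
  hu.comp_snd.sub hu.comp_fst

theorem EssBdd.energyDensity (hγ : EssBdd (fun p : α × α => γ p.1 p.2) (μ.prod μ)) {u v : α → ℝ}
    (hu : EssBdd u μ) (hv : EssBdd v μ) :
    EssBdd (fun p : α × α => (u p.2 - u p.1) * (v p.2 - v p.1) * γ p.1 p.2) (μ.prod μ) :=
  (hu.diff.mul hv.diff).mul hγ

/-- Nonlocal integration by parts: the terms with `w y` and with `w x` are exchanged by swapping the
variables. -/
theorem energyForm_eq (hγ : EssBdd (fun p : α × α => γ p.1 p.2) (μ.prod μ))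
    (hs : ∀ x y, γ x y = γ y x) {u w : α → ℝ} (hu : EssBdd u μ) (hw : EssBdd w μ) :
    energyForm μ γ u w = -2 * ∫ x, w x * ∫ y, (u y - u x) * γ x y ∂μ ∂μ := by
  set A : α × α → ℝ := fun p => w p.1 * ((u p.2 - u p.1) * γ p.1 p.2) with hA
  have hAb : EssBdd A (μ.prod μ) := hw.comp_fst.mul (hu.diff.mul hγ)
  have hsw : ∫ p, A p.swap ∂(μ.prod μ) = ∫ p, A p ∂(μ.prod μ) := integral_prod_swap A
  have hAi := hAb.integrable
  have h1 : energyForm μ γ u w = ∫ p, (-A p - A p.swap) ∂(μ.prod μ) := by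
    unfold energyForm
    congr 1
    ext p
    simp only [hA, Prod.fst_swap, Prod.snd_swap, hs p.2 p.1]
    ring
  have hAs : Integrable (fun p : α × α => A p.swap) (μ.prod μ) := hAi.swap
  have hAn : Integrable (fun p => -A p) (μ.prod μ) := hAi.neg
  rw [h1, integral_sub hAn hAs, integral_neg, hsw, integral_prod _ hAi]
  simp only [hA, integral_const_mul]
  ring

theorem lintegral_energy_eq (hγ : EssBdd (fun p : α × α => γ p.1 p.2) (μ.prod μ))
    (h0 : ∀ x y, 0 ≤ γ x y) {u : α → ℝ} (hu : EssBdd u μ) :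
    ∫⁻ x, ∫⁻ y, ENNReal.ofReal ((u y - u x) ^ 2 * γ x y) ∂μ ∂μ =
      ENNReal.ofReal (energyForm μ γ u u) := by
  have hb := hγ.energyDensity hu hu
  unfold energyForm
  rw [ofReal_integral_eq_lintegral_ofReal hb.integrable
    (ae_of_all _ fun p => mul_nonneg (mul_self_nonneg _) (h0 _ _)),
    lintegral_prod _ hb.1.aemeasurable.ennreal_ofReal]
  simp only [pow_two]

theorem energyForm_add_le (hγ : EssBdd (fun p : α × α => γ p.1 p.2) (μ.prod μ))
    (h0 : ∀ x y, 0 ≤ γ x y) {u v : α → ℝ} (hu : EssBdd u μ) (hv : EssBdd v μ) :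
    energyForm μ γ (fun x => u x + v x) (fun x => u x + v x) ≤
      2 * energyForm μ γ u u + 2 * energyForm μ γ v v := by
  unfold energyForm
  rw [← integral_const_mul, ← integral_const_mul, ← integral_add]
  · refine integral_mono (hγ.energyDensity (hu.add hv) (hu.add hv)).integrable
      (((hγ.energyDensity hu hu).const_mul 2).add
        ((hγ.energyDensity hv hv).const_mul 2)).integrable fun p => ?_
    simp only
    nlinarith [h0 p.1 p.2, mul_nonneg (h0 p.1 p.2)
      (sq_nonneg ((u p.2 - u p.1) - (v p.2 - v p.1)))]
  · exact ((hγ.energyDensity hu hu).const_mul 2).integrable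
  · exact ((hγ.energyDensity hv hv).const_mul 2).integrable

/-- Stability: a Galerkin type identity and a Poincaré inequality control the energy of `w` by
that of `z` and by the residual. -/
theorem energyForm_le_of_galerkin (hγ : EssBdd (fun p : α × α => γ p.1 p.2) (μ.prod μ))
    (h0 : ∀ x y, 0 ≤ γ x y) {z w R : α → ℝ} (hz : EssBdd z μ) (hw : EssBdd w μ) (hR : EssBdd R μ)
    {P : ℝ} (hP : 0 < P) (hpoinc : ∫ x, w x ^ 2 ∂μ ≤ P * energyForm μ γ w w)
    (hgal : energyForm μ γ (fun x => z x + w x) w = ∫ x, R x * w x ∂μ) :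
    energyForm μ γ w w ≤ 2 * energyForm μ γ z z + 2 * P * ∫ x, R x ^ 2 ∂μ := by
  have h1 : energyForm μ γ w w = energyForm μ γ (fun x => z x + w x) w +
      ∫ p, -((z p.2 - z p.1) * (w p.2 - w p.1) * γ p.1 p.2) ∂(μ.prod μ) := by
    have hn : Integrable (fun p : α × α => -((z p.2 - z p.1) * (w p.2 - w p.1) * γ p.1 p.2))
      (μ.prod μ) := (hγ.energyDensity hz hw).integrable.neg
    unfold energyForm
    rw [← integral_add (hγ.energyDensity (hz.add hw) hw).integrable hn]
    congr 1
    ext p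
    ring
  -- Young's inequality leaves a quarter of the energy of `w` here, and another quarter comes from
  -- the residual through Poincaré. Their sum, one half, is absorbed on the left.
  have h2 : ∫ p, -((z p.2 - z p.1) * (w p.2 - w p.1) * γ p.1 p.2) ∂(μ.prod μ) ≤
      energyForm μ γ z z + 1 / 4 * energyForm μ γ w w := by
    unfold energyForm
    rw [← integral_const_mul, ← integral_add (hγ.energyDensity hz hz).integrable
      ((hγ.energyDensity hw hw).const_mul _).integrable]
    refine integral_mono (hγ.energyDensity hz hw).integrable.neg
      ((hγ.energyDensity hz hz).add ((hγ.energyDensity hw hw).const_mul _)).integrable fun p => ?_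
    simp only
    nlinarith [mul_nonneg (h0 p.1 p.2)
      (sq_nonneg ((z p.2 - z p.1) + 1 / 2 * (w p.2 - w p.1)))]
  have h3 : ∫ x, R x * w x ∂μ ≤ P * ∫ x, R x ^ 2 ∂μ + 1 / (4 * P) * ∫ x, w x ^ 2 ∂μ := by
    rw [← integral_const_mul, ← integral_const_mul, ← integral_add (hR.sq.const_mul _).integrable
      (hw.sq.const_mul _).integrable]
    refine integral_mono (hR.mul hw).integrable
      ((hR.sq.const_mul _).add (hw.sq.const_mul _)).integrable fun x => ?_
    simp only
    have : 0 ≤ P * (R x - 1 / (2 * P) * w x) ^ 2 := by positivity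
    have h4 : P * (R x - 1 / (2 * P) * w x) ^ 2 =
        P * R x ^ 2 + 1 / (4 * P) * w x ^ 2 - R x * w x := by
      field_simp
      ring
    linarith
  have h5 : 1 / (4 * P) * ∫ x, w x ^ 2 ∂μ ≤ 1 / 4 * energyForm μ γ w w := by
    calc _ ≤ 1 / (4 * P) * (P * energyForm μ γ w w) := by gcongr
      _ = _ := by field_simp
  rw [hgal] at h1
  linarith

/-- From `(a - b)² ≤ 2a² + 2b²` and symmetry. It converts `L²` interpolation errors into energy at
the price of the kernel mass, here of order `δ⁻²`. -/
theorem energyForm_self_le (hγ : EssBdd (fun p : α × α => γ p.1 p.2) (μ.prod μ))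
    (h0 : ∀ x y, 0 ≤ γ x y) (hs : ∀ x y, γ x y = γ y x) {κ : ℝ}
    (hκ : ∀ x, ∫ y, γ x y ∂μ ≤ κ) {z : α → ℝ} (hz : EssBdd z μ) :
    energyForm μ γ z z ≤ 4 * κ * ∫ x, z x ^ 2 ∂μ := by
  set A : α × α → ℝ := fun p => z p.1 ^ 2 * γ p.1 p.2 with hA
  have hAb : EssBdd A (μ.prod μ) := hz.sq.comp_fst.mul hγ
  have hAi := hAb.integrable
  have hAs : Integrable (fun p : α × α => A p.swap) (μ.prod μ) := hAi.swap
  have hsw : ∫ p, A p.swap ∂(μ.prod μ) = ∫ p, A p ∂(μ.prod μ) := integral_prod_swap A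
  have h1 : energyForm μ γ z z ≤ ∫ p, (2 * A p + 2 * A p.swap) ∂(μ.prod μ) := by
    refine integral_mono (hγ.energyDensity hz hz).integrable
      ((hAi.const_mul 2).add (hAs.const_mul 2)) fun p => ?_
    simp only [hA, Prod.fst_swap, Prod.snd_swap, hs p.2 p.1]
    nlinarith [mul_nonneg (h0 p.1 p.2) (sq_nonneg (z p.2 + z p.1))]
  rw [integral_add (hAi.const_mul 2) (hAs.const_mul 2), integral_const_mul, integral_const_mul, hsw,
    integral_prod _ hAi] at h1
  have h2 : ∫ x, ∫ y, A (x, y) ∂μ ∂μ ≤ ∫ x, κ * z x ^ 2 ∂μ := by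
    refine integral_mono hAb.integral_prod_left.integrable (hz.sq.const_mul κ).integrable
      fun x => ?_
    simp only [hA, integral_const_mul]
    nlinarith [hκ x, sq_nonneg (z x)]
  rw [integral_const_mul] at h2
  linarith

end

/-! ### The polygonal kernel -/

theorem constKernel_nonneg (δ : ℝ) (x y : Plane) : 0 ≤ constKernel δ x y := by
  unfold constKernel
  have := Real.pi_pos
  split_ifs <;> positivity

theorem constKernel_le (δ : ℝ) (x y : Plane) : constKernel δ x y ≤ 4 / (Real.pi * δ ^ 4) := by
  unfold constKernel
  have := Real.pi_pos
  split_ifs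
  · exact le_rfl
  · positivity

theorem polyKernel_symm (δ : ℝ) (V : Plane → Finset Plane) (x y : Plane) :
    polyKernel δ V x y = polyKernel δ V y x := by
  unfold polyKernel constKernel
  rw [dist_comm, add_comm ((polygon (V x)).indicator _ y)]

theorem indicator_one_nonneg (s : Set Plane) (y : Plane) : 0 ≤ s.indicator (fun _ => (1 : ℝ)) y :=
  Set.indicator_nonneg (fun _ _ => zero_le_one) y

theorem indicator_one_le (s : Set Plane) (y : Plane) : s.indicator (fun _ => (1 : ℝ)) y ≤ 1 :=
  Set.indicator_le_self' (fun _ _ => zero_le_one) y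

theorem polyKernel_nonneg (δ : ℝ) (V : Plane → Finset Plane) (x y : Plane) :
    0 ≤ polyKernel δ V x y := by
  unfold polyKernel
  have h1 := constKernel_nonneg δ x y
  have h2 := indicator_one_nonneg (polygon (V x)) y
  have h3 := indicator_one_nonneg (polygon (V y)) x
  positivity

theorem polyKernel_le_constKernel (δ : ℝ) (V : Plane → Finset Plane) (x y : Plane) :
    polyKernel δ V x y ≤ constKernel δ x y := by
  unfold polyKernel
  have h1 := constKernel_nonneg δ x y
  have h2 := indicator_one_le (polygon (V x)) y
  have h3 := indicator_one_le (polygon (V y)) x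
  nlinarith

theorem polyKernel_eq {δ : ℝ} {V : Plane → Finset Plane} {x y : Plane} (hxy : dist x y ≤ δ)
    (hx : y ∈ polygon (V x)) (hy : x ∈ polygon (V y)) :
    polyKernel δ V x y = 4 / (Real.pi * δ ^ 4) := by
  unfold polyKernel constKernel
  rw [if_pos hxy, Set.indicator_of_mem hx, Set.indicator_of_mem hy]
  ring

/-- The polygonal kernel, cut off outside a set. -/
def kernelOn (D : Set Plane) (δ : ℝ) (V : Plane → Finset Plane) (x y : Plane) : ℝ :=
  (D ×ˢ D).indicator (fun p => polyKernel δ V p.1 p.2) (x, y)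

section

variable {D : Set Plane} {δ : ℝ} {V : Plane → Finset Plane}

theorem kernelOn_of_mem {x y : Plane} (hx : x ∈ D) (hy : y ∈ D) :
    kernelOn D δ V x y = polyKernel δ V x y := by
  unfold kernelOn
  rw [Set.indicator_of_mem (Set.mk_mem_prod hx hy)]

theorem kernelOn_symm (x y : Plane) : kernelOn D δ V x y = kernelOn D δ V y x := by
  by_cases h : x ∈ D ∧ y ∈ D
  · rw [kernelOn_of_mem h.1 h.2, kernelOn_of_mem h.2 h.1, polyKernel_symm]
  · unfold kernelOn
    rw [Set.indicator_of_notMem, Set.indicator_of_notMem]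
    · exact fun h' => h ⟨h'.2, h'.1⟩
    · exact fun h' => h ⟨h'.1, h'.2⟩

theorem kernelOn_nonneg (x y : Plane) : 0 ≤ kernelOn D δ V x y :=
  Set.indicator_nonneg (fun _ _ => polyKernel_nonneg _ _ _ _) _

theorem kernelOn_le_constKernel (x y : Plane) : kernelOn D δ V x y ≤ constKernel δ x y := by
  unfold kernelOn
  by_cases h : (x, y) ∈ D ×ˢ D
  · rw [Set.indicator_of_mem h]
    exact polyKernel_le_constKernel _ _ _ _
  · rw [Set.indicator_of_notMem h]
    exact constKernel_nonneg _ _ _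

theorem abs_kernelOn_le (x y : Plane) : |kernelOn D δ V x y| ≤ 4 / (Real.pi * δ ^ 4) := by
  rw [abs_of_nonneg (kernelOn_nonneg x y)]
  exact (kernelOn_le_constKernel x y).trans (constKernel_le δ x y)

/-- The polygons are controlled only for centres in `D`, so measurability needs the cut-off in both
variables. -/
theorem measurable_kernelOn (hD : MeasurableSet D)
    (hVm : MeasurableSet {p : Plane × Plane | p.1 ∈ D ∧ p.2 ∈ polygon (V p.1)}) :
    Measurable fun p : Plane × Plane => kernelOn D δ V p.1 p.2 := by
  set P := {p : Plane × Plane | p.1 ∈ D ∧ p.2 ∈ polygon (V p.1)} with hP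
  set F : Plane × Plane → ℝ := fun p => 1 / 2 * constKernel δ p.1 p.2 *
    (P.indicator (fun _ => (1 : ℝ)) p + P.indicator (fun _ => (1 : ℝ)) p.swap) with hF
  have hFm : Measurable F := by
    have h1 : Measurable fun p : Plane × Plane => constKernel δ p.1 p.2 := by
      unfold constKernel
      exact Measurable.ite (measurableSet_le (by fun_prop) measurable_const) measurable_const
        measurable_const
    have h2 : Measurable (P.indicator fun _ => (1 : ℝ)) := measurable_const.indicator hVm
    exact (h1.const_mul _).mul (h2.add (h2.comp measurable_swap))
  have : (fun p : Plane × Plane => kernelOn D δ V p.1 p.2) = (D ×ˢ D).indicator F := by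
    ext p
    by_cases hp : p ∈ D ×ˢ D
    · rw [Set.indicator_of_mem hp, kernelOn_of_mem hp.1 hp.2]
      have h1 : P.indicator (fun _ => (1 : ℝ)) p =
          (polygon (V p.1)).indicator (fun _ => (1 : ℝ)) p.2 := by
        by_cases h : p.2 ∈ polygon (V p.1)
        · rw [Set.indicator_of_mem h, Set.indicator_of_mem (show p ∈ P from ⟨hp.1, h⟩)]
        · rw [Set.indicator_of_notMem h, Set.indicator_of_notMem (fun h' : p ∈ P => h h'.2)]
      have h2 : P.indicator (fun _ => (1 : ℝ)) p.swap =
          (polygon (V p.2)).indicator (fun _ => (1 : ℝ)) p.1 := by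
        by_cases h : p.1 ∈ polygon (V p.2)
        · rw [Set.indicator_of_mem h, Set.indicator_of_mem (show p.swap ∈ P from ⟨hp.2, h⟩)]
        · rw [Set.indicator_of_notMem h, Set.indicator_of_notMem (fun h' : p.swap ∈ P => h h'.2)]
      rw [hF]
      simp only [h1, h2]
      rfl
    · rw [Set.indicator_of_notMem hp]
      exact Set.indicator_of_notMem hp _
  rw [this]
  exact hFm.indicator (hD.prod hD)

theorem integral_kernelOn_le (hδ : 0 < δ) (hD : MeasurableSet D)
    (hVm : MeasurableSet {p : Plane × Plane | p.1 ∈ D ∧ p.2 ∈ polygon (V p.1)})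
    (x : Plane) : ∫ y in D, kernelOn D δ V x y ≤ 4 / δ ^ 2 := by
  have hcl : volume (Metric.closedBall x δ) = ENNReal.ofReal (Real.pi * δ ^ 2) := by
    rw [Measure.addHaar_closedBall_eq_addHaar_ball,
      ← ENNReal.ofReal_toReal (measure_ball_lt_top (x := x) (r := δ)).ne, ← Measure.real,
      volume_real_ball x hδ.le]
  have hm : Measurable (kernelOn D δ V x) :=
    (measurable_kernelOn hD hVm).comp measurable_prodMk_left
  have hint : Integrable ((Metric.closedBall x δ).indicator
      fun _ : Plane => 4 / (Real.pi * δ ^ 4)) :=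
    (integrable_indicator_iff Metric.isClosed_closedBall.measurableSet).2
      (integrableOn_const (by rw [hcl]; exact ENNReal.ofReal_ne_top))
  have hle : ∀ y, kernelOn D δ V x y ≤
      (Metric.closedBall x δ).indicator (fun _ : Plane => 4 / (Real.pi * δ ^ 4)) y := by
    intro y
    refine (kernelOn_le_constKernel x y).trans (le_of_eq ?_)
    unfold constKernel
    by_cases hy : dist x y ≤ δ
    · rw [if_pos hy, Set.indicator_of_mem (by rwa [Metric.mem_closedBall, dist_comm])]
    · rw [if_neg hy, Set.indicator_of_notMem (by rwa [Metric.mem_closedBall, dist_comm])]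
  calc ∫ y in D, kernelOn D δ V x y ≤ ∫ y, kernelOn D δ V x y := by
        refine setIntegral_le_integral ?_ (ae_of_all _ (kernelOn_nonneg x))
        refine hint.mono' hm.aestronglyMeasurable (ae_of_all _ fun y => ?_)
        rw [Real.norm_eq_abs, abs_of_nonneg (kernelOn_nonneg x y)]
        exact hle y
    _ ≤ ∫ y, (Metric.closedBall x δ).indicator (fun _ : Plane => 4 / (Real.pi * δ ^ 4)) y :=
        integral_mono_of_nonneg (ae_of_all _ (kernelOn_nonneg x)) hint (ae_of_all _ hle)
    _ = 4 / δ ^ 2 := by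
        rw [integral_indicator Metric.isClosed_closedBall.measurableSet, setIntegral_const,
          Measure.real, hcl, ENNReal.toReal_ofReal (by positivity), smul_eq_mul]
        field_simp

/-! ### Consistency of the polygonal operator -/

/-- The inradius is at least `√(δ² - H²/4)`. The maximum with `0` covers long sides, `H ≥ 2δ`, for
which no disc is guaranteed. -/
theorem mem_polygon_of_dist_lt {x y : Plane} (hV : IsInscribed x δ (V x)) {H s : ℝ}
    (hr : 0 < inradiusAt x (V x)) (hH : longestSide (V x) ≤ H)
    (hs : s ^ 2 ≤ max 0 (δ ^ 2 - H ^ 2 / 4)) (hxy : dist x y < s) :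
    y ∈ polygon (V x) := by
  by_contra hy
  have h1 := inradiusAt_le_dist (x := x) hy
  have h2 := sq_le_inradiusAt_sq_add hV hr
  have h3 : longestSide (V x) ^ 2 ≤ H ^ 2 := by
    have := longestSide_nonneg (V x)
    gcongr
  have h4 : inradiusAt x (V x) < s := h1.trans_lt hxy
  have h5 : inradiusAt x (V x) ^ 2 < s ^ 2 := by gcongr
  rcases le_max_iff.1 hs with h | h
  · nlinarith
  · linarith

/-- The nonlocal operator with polygonal kernel is consistent up to the caps. -/
theorem abs_poly_operator_sub_laplacian_le {u : Plane → ℝ} {S : Set Plane} (hS : IsOpen S)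
    {M H : ℝ} (hu : CbBound 4 S M u) (hδ : 0 < δ) (hD : MeasurableSet D) (hDS : D ⊆ S)
    (hVm : MeasurableSet {p : Plane × Plane | p.1 ∈ D ∧ p.2 ∈ polygon (V p.1)})
    (hV : ∀ x ∈ D, IsInscribed x δ (V x)) (hr : ∀ x ∈ D, 0 < inradiusAt x (V x))
    (hH : ∀ x ∈ D, longestSide (V x) ≤ H) {x : Plane} (hx : Metric.ball x δ ⊆ D) :
    |2 * (∫ y in D, (u y - u x) * kernelOn D δ V x y) - Laplacian.laplacian u x| ≤
      8 * M * δ ^ 2 + 2 * M * H ^ 2 / δ ^ 3 := by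
  have hxD : x ∈ D := hx (Metric.mem_ball_self hδ)
  have hM0 : 0 ≤ M := (norm_nonneg _).trans (hu.2 0 (by norm_num) x (hDS hxD))
  have hub : ∀ y ∈ S, |u y| ≤ M := by
    intro y hy
    have := hu.2 0 (by norm_num) y hy
    rwa [norm_iteratedFDeriv_zero] at this
  have hmb : MeasurableSet (Metric.ball x δ) := Metric.isOpen_ball.measurableSet
  have hcont : ContinuousOn u S := hu.1.continuousOn
  have hiu : IntegrableOn u (Metric.ball x δ) := by
    refine IntegrableOn.of_bound measure_ball_lt_top
      ((hcont.mono (hx.trans hDS)).aestronglyMeasurable hmb) M ?_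
    rw [ae_restrict_iff' hmb]
    exact ae_of_all _ fun y hy => hub y (hDS (hx hy))
  have hlip : ∀ y ∈ Metric.ball x δ, |u y - u x| ≤ M * δ := by
    intro y hy
    have hseg : ∀ t ∈ Set.Icc (0 : ℝ) 1, x + t • (y - x) ∈ S := by
      intro t ht
      exact hDS (hx ((convex_ball x δ).add_smul_sub_mem (Metric.mem_ball_self hδ) hy ht))
    have := abs_sub_taylor_le (n := 0) hS (by exact_mod_cast hu.1.of_le (by norm_num))
      (hu.2 1 (by norm_num)) hseg
    simp only [zero_add, Finset.range_one, Finset.sum_singleton, Nat.factorial_zero, Nat.cast_one,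
      inv_one, iteratedFDeriv_zero_apply, one_mul, pow_one, add_sub_cancel] at this
    refine this.trans ?_
    rw [mem_ball_iff_norm] at hy
    gcongr
  set κ : ℝ := 4 / (Real.pi * δ ^ 4) with hκ
  have hκ0 : 0 < κ := by have := Real.pi_pos; positivity
  have hball := abs_ball_operator_sub_laplacian_le hS hu.1 (hu.2 4 le_rfl) hδ (hx.trans hDS) hiu
  have hiF : IntegrableOn (fun y => u y - u x) (Metric.ball x δ) :=
    hiu.sub (integrableOn_const measure_ball_lt_top.ne)
  have hm : Measurable (kernelOn D δ V x) :=
    (measurable_kernelOn hD hVm).comp measurable_prodMk_left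
  -- The kernel vanishes beyond distance `δ`, and the circle itself is null.
  have hred : ∫ y in D, (u y - u x) * kernelOn D δ V x y =
      ∫ y in Metric.ball x δ, (u y - u x) * kernelOn D δ V x y := by
    refine setIntegral_eq_of_subset_of_ae_sdiff_eq_zero hD.nullMeasurableSet hx ?_
    have hsph : volume (Metric.sphere x δ) = 0 := Measure.addHaar_sphere _ _ _
    filter_upwards [compl_mem_ae_iff.2 hsph] with y hy hyD
    have h1 : ¬ dist x y ≤ δ := by
      intro hle
      have h2 : δ ≤ dist y x := not_lt.1 hyD.2
      rw [dist_comm] at h2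
      exact hy (by rw [Metric.mem_sphere, dist_comm]; exact le_antisymm hle h2)
    have h2 : kernelOn D δ V x y = 0 := by
      refine le_antisymm ((kernelOn_le_constKernel x y).trans (le_of_eq ?_)) (kernelOn_nonneg x y)
      unfold constKernel
      rw [if_neg h1]
    rw [h2, mul_zero]
  -- Points of `D` closer than `s` lie in each other's polygons, so there the polygonal kernel
  -- equals the constant one. The kernels differ only in the annulus `T`, of area at most `π H²/4`,
  -- where `|u y - u x| ≤ M δ`.
  set s : ℝ := Real.sqrt (max 0 (δ ^ 2 - H ^ 2 / 4)) with hs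
  have hs2 : s ^ 2 = max 0 (δ ^ 2 - H ^ 2 / 4) := Real.sq_sqrt (le_max_left _ _)
  have hsδ : s ≤ δ := by
    rw [hs, Real.sqrt_le_left hδ.le]
    exact max_le (by positivity) (by nlinarith [sq_nonneg H])
  have hs0 : 0 ≤ s := Real.sqrt_nonneg _
  set T := Metric.ball x δ \ Metric.ball x s with hT
  have hTm : MeasurableSet T := hmb.diff Metric.isOpen_ball.measurableSet
  have hTv : volume T = ENNReal.ofReal (Real.pi * (δ ^ 2 - s ^ 2)) := volume_annulus hs0 hsδ x
  have hdiff : ‖∫ y in Metric.ball x δ,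
      ((u y - u x) * κ - (u y - u x) * kernelOn D δ V x y)‖ ≤ M * H ^ 2 / δ ^ 3 := by
    have hint : Integrable (T.indicator fun _ : Plane => M * δ * κ)
        (volume.restrict (Metric.ball x δ)) :=
      ((integrable_indicator_iff hTm).2
        (integrableOn_const (by rw [hTv]; exact ENNReal.ofReal_ne_top))).integrableOn
    refine (norm_integral_le_of_norm_le hint ?_).trans ?_
    · rw [ae_restrict_iff' hmb]
      refine ae_of_all _ fun y hy => ?_
      rw [← mul_sub, norm_mul]
      have hyD := hx hy
      by_cases hyT : y ∈ T
      · rw [Set.indicator_of_mem hyT]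
        have h1 := kernelOn_nonneg (D := D) (δ := δ) (V := V) x y
        have h2 : ‖κ - kernelOn D δ V x y‖ ≤ κ := by
          have h3 := (kernelOn_le_constKernel (D := D) (V := V) x y).trans (constKernel_le δ x y)
          rw [Real.norm_eq_abs, abs_of_nonneg (sub_nonneg.2 h3)]
          linarith
        exact mul_le_mul (hlip y hy) h2 (norm_nonneg _) (by positivity)
      · rw [Set.indicator_of_notMem hyT]
        have hys : dist x y < s := by
          by_contra hlt
          refine hyT ⟨hy, fun hys => hlt ?_⟩
          rwa [Metric.mem_ball, dist_comm] at hys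
        rw [kernelOn_of_mem hxD hyD, polyKernel_eq (hys.le.trans hsδ)
          (mem_polygon_of_dist_lt (hV x hxD) (hr x hxD) (hH x hxD) hs2.le hys)
          (mem_polygon_of_dist_lt (hV y hyD) (hr y hyD) (hH y hyD) hs2.le
            (by rwa [dist_comm]))]
        simp [hκ]
    · calc ∫ y in Metric.ball x δ, T.indicator (fun _ : Plane => M * δ * κ) y
          ≤ ∫ y, T.indicator (fun _ : Plane => M * δ * κ) y := by
            refine setIntegral_le_integral ((integrable_indicator_iff hTm).2
              (integrableOn_const (by rw [hTv]; exact ENNReal.ofReal_ne_top)))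
              (ae_of_all _ fun y => Set.indicator_nonneg (fun _ _ => by positivity) y)
        _ = Real.pi * (δ ^ 2 - s ^ 2) * (M * δ * κ) := by
            rw [integral_indicator hTm, setIntegral_const, Measure.real, hTv,
              ENNReal.toReal_ofReal, smul_eq_mul]
            have : s ^ 2 ≤ δ ^ 2 := by gcongr
            exact mul_nonneg Real.pi_pos.le (by linarith)
        _ ≤ Real.pi * (H ^ 2 / 4) * (M * δ * κ) := by
            have : δ ^ 2 - s ^ 2 ≤ H ^ 2 / 4 := by
              rw [hs2]
              linarith [le_max_right 0 (δ ^ 2 - H ^ 2 / 4)]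
            have := Real.pi_pos
            gcongr
        _ = M * H ^ 2 / δ ^ 3 := by
            rw [hκ]
            field_simp
  have hi1 : IntegrableOn (fun y => (u y - u x) * κ) (Metric.ball x δ) := hiF.mul_const κ
  have hi2 : IntegrableOn (fun y => (u y - u x) * kernelOn D δ V x y) (Metric.ball x δ) :=
    hiF.mul_bdd (c := κ) hm.aestronglyMeasurable (ae_of_all _ fun y => abs_kernelOn_le x y)
  rw [integral_sub hi1 hi2, ← hred, Real.norm_eq_abs] at hdiff
  set I₁ := ∫ y in Metric.ball x δ, (u y - u x) * κ
  set I₂ := ∫ y in D, (u y - u x) * kernelOn D δ V x y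
  have : 2 * I₂ - Laplacian.laplacian u x =
      (2 * I₁ - Laplacian.laplacian u x) - 2 * (I₁ - I₂) := by ring
  rw [this]
  refine (abs_sub _ _).trans (add_le_add hball ?_)
  rw [abs_mul, abs_two]
  calc 2 * |I₁ - I₂| ≤ 2 * (M * H ^ 2 / δ ^ 3) := by gcongr
    _ = _ := by ring

end

/-! ### The Galerkin identity -/

theorem EssBdd.kernel_section {ν : Measure Plane} {G : Plane → Plane → ℝ}
    (hG : Measurable fun p : Plane × Plane => G p.1 p.2) {κ : ℝ} (hκ : ∀ x y, |G x y| ≤ κ)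
    (x : Plane) : EssBdd (G x) ν :=
  EssBdd.of_measurable (hG.comp measurable_prodMk_left) (hκ x)

theorem essBdd_const {α : Type*} [MeasurableSpace α] {μ : Measure α} (c : ℝ) :
    EssBdd (fun _ : α => c) μ :=
  ⟨aestronglyMeasurable_const, ‖c‖, ae_of_all _ fun _ => le_rfl⟩

/-- Up to null sets `uh` and `w` live on `Ω` and `gh` on `I`. The two inner integrals of the CDG
equation are therefore the two parts of a single one for `uh + gh` over `Ω ∪ I`, the form to which
the symmetric energy applies. -/
theorem integral_mul_integral_eq_of_cdg {Ω I : Set Plane} (hΩ : MeasurableSet Ω)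
    (hI : MeasurableSet I) (hdisj : Disjoint Ω I) (hfΩ : volume Ω ≠ ⊤) (hfI : volume I ≠ ⊤)
    {γ G : Plane → Plane → ℝ} (hG : Measurable fun p : Plane × Plane => G p.1 p.2) {κ : ℝ}
    (hκ : ∀ x y, |G x y| ≤ κ) (hγG : ∀ x ∈ Ω ∪ I, ∀ y ∈ Ω ∪ I, G x y = γ x y)
    {uh gh w f : Plane → ℝ} (hu : Measurable uh) {Bu : ℝ} (hub : ∀ x, |uh x| ≤ Bu)
    (hg : Measurable gh) {Bg : ℝ} (hgb : ∀ x, |gh x| ≤ Bg)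
    (hw : Measurable w) {Bw : ℝ} (hwb : ∀ x, |w x| ≤ Bw)
    (hgΩ : ∀ᵐ x : Plane, x ∈ Ω → gh x = 0) (huI : ∀ᵐ x : Plane, x ∈ I → uh x = 0)
    (hwI : ∀ᵐ x : Plane, x ∈ I → w x = 0)
    (heq : -2 * ∫ x in Ω, w x * ∫ y in Ω, (uh y - uh x) * γ x y =
      (∫ x in Ω, f x * w x) + 2 * ∫ x in Ω, w x * ∫ y in I, (gh y - uh x) * γ x y) :
    -2 * ∫ x in Ω ∪ I, w x * ∫ y in Ω ∪ I, ((uh y + gh y) - (uh x + gh x)) * G x y =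
      ∫ x in Ω, f x * w x := by
  have : IsFiniteMeasure (volume.restrict Ω) :=
    ⟨by rw [Measure.restrict_apply_univ]; exact hfΩ.lt_top⟩
  have : IsFiniteMeasure (volume.restrict I) :=
    ⟨by rw [Measure.restrict_apply_univ]; exact hfI.lt_top⟩
  have hub' : ∀ ν : Measure Plane, EssBdd uh ν := fun ν => EssBdd.of_measurable hu hub
  have hgb' : ∀ ν : Measure Plane, EssBdd gh ν := fun ν => EssBdd.of_measurable hg hgb
  have hwb' : ∀ ν : Measure Plane, EssBdd w ν := fun ν => EssBdd.of_measurable hw hwb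
  have hGb : ∀ (ν : Measure Plane) x, EssBdd (G x) ν := fun ν x => EssBdd.kernel_section hG hκ x
  have hGp : ∀ ν : Measure (Plane × Plane), EssBdd (fun p : Plane × Plane => G p.1 p.2) ν :=
    fun ν => EssBdd.of_measurable hG fun p => hκ p.1 p.2
  have h1 : ∫ x in Ω ∪ I, w x * ∫ y in Ω ∪ I, ((uh y + gh y) - (uh x + gh x)) * G x y =
      ∫ x in Ω, w x * ∫ y in Ω ∪ I, ((uh y + gh y) - (uh x + gh x)) * G x y := by
    refine setIntegral_eq_of_subset_of_ae_sdiff_eq_zero (hΩ.union hI).nullMeasurableSet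
      Set.subset_union_left ?_
    filter_upwards [hwI] with x hx hxI
    rw [hx (hxI.1.resolve_left hxI.2), zero_mul]
  have hinner : ∀ᵐ x ∂(volume.restrict Ω),
      w x * ∫ y in Ω ∪ I, ((uh y + gh y) - (uh x + gh x)) * G x y =
      w x * (∫ y in Ω, (uh y - uh x) * G x y) + w x * ∫ y in I, (gh y - uh x) * G x y := by
    rw [ae_restrict_iff' hΩ]
    filter_upwards [hgΩ] with x hx hxΩ
    rw [hx hxΩ, add_zero, ← mul_add]
    congr 1
    have hb : ∀ ν : Measure Plane, EssBdd (fun y => ((uh y + gh y) - uh x) * G x y) ν := fun ν =>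
      (((hub' ν).add (hgb' ν)).sub (essBdd_const _)).mul (hGb ν x)
    rw [setIntegral_union hdisj hI (hb _).integrable (hb _).integrable]
    congr 1
    · refine setIntegral_congr_ae hΩ ?_
      filter_upwards [hgΩ] with y hy hyΩ
      rw [hy hyΩ, add_zero]
    · refine setIntegral_congr_ae hI ?_
      filter_upwards [huI] with y hy hyI
      rw [hy hyI, zero_add]
  have e1 : EssBdd (fun x => w x * ∫ y in Ω, (uh y - uh x) * G x y) (volume.restrict Ω) :=
    (hwb' _).mul (EssBdd.integral_prod_left (ν := volume.restrict Ω)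
      (F := fun p : Plane × Plane => (uh p.2 - uh p.1) * G p.1 p.2)
      (((hub' _).comp_snd.sub (hub' _).comp_fst).mul (hGp _)))
  have e2 : EssBdd (fun x => w x * ∫ y in I, (gh y - uh x) * G x y) (volume.restrict Ω) :=
    (hwb' _).mul (EssBdd.integral_prod_left (ν := volume.restrict I)
      (F := fun p : Plane × Plane => (gh p.2 - uh p.1) * G p.1 p.2)
      (((hgb' _).comp_snd.sub (hub' _).comp_fst).mul (hGp _)))
  have c1 : ∫ x in Ω, w x * ∫ y in Ω, (uh y - uh x) * G x y =
      ∫ x in Ω, w x * ∫ y in Ω, (uh y - uh x) * γ x y := by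
    refine setIntegral_congr_fun hΩ fun x hx => ?_
    congr 1
    exact setIntegral_congr_fun hΩ fun y hy => by
      simp only [hγG x (Or.inl hx) y (Or.inl hy)]
  have c2 : ∫ x in Ω, w x * ∫ y in I, (gh y - uh x) * G x y =
      ∫ x in Ω, w x * ∫ y in I, (gh y - uh x) * γ x y := by
    refine setIntegral_congr_fun hΩ fun x hx => ?_
    congr 1
    exact setIntegral_congr_fun hI fun y hy => by
      simp only [hγG x (Or.inl hx) y (Or.inr hy)]
  rw [h1, integral_congr_ae hinner, integral_add e1.integrable e2.integrable, c1, c2, mul_add, heq]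
  ring

/-! ### From quadratic forms to norms -/

theorem eLpNorm_two_le_of_integral_sq_le {α : Type*} [MeasurableSpace α] {μ : Measure α}
    {f : α → ℝ} (hi : Integrable (fun x => f x ^ 2) μ) {B : ℝ} (hB : ∫ x, f x ^ 2 ∂μ ≤ B) :
    eLpNorm f 2 μ ≤ ENNReal.ofReal (Real.sqrt B) := by
  have h0 : 0 ≤ B := (integral_nonneg fun _ => sq_nonneg _).trans hB
  rw [eLpNorm_eq_lintegral_rpow_enorm_toReal two_ne_zero ENNReal.ofNat_ne_top]
  have h1 : ∫⁻ x, ‖f x‖ₑ ^ (ENNReal.toReal 2) ∂μ = ENNReal.ofReal (∫ x, f x ^ 2 ∂μ) := by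
    rw [ofReal_integral_eq_lintegral_ofReal hi (ae_of_all _ fun _ => sq_nonneg _)]
    refine lintegral_congr fun x => ?_
    rw [← Real.enorm_of_nonneg (sq_nonneg (f x)), enorm_pow]
    simp
  rw [h1, Real.sqrt_eq_rpow, ← ENNReal.ofReal_rpow_of_nonneg h0 (by norm_num)]
  have h2 : (1 / ENNReal.toReal 2 : ℝ) = 1 / 2 := by simp
  rw [h2]
  gcongr

theorem energyNorm_le_of_lintegral_le {D : Set Plane} {γ : Plane → Plane → ℝ} {u : Plane → ℝ}
    {B : ℝ} (h0 : 0 ≤ B)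
    (hB : ∫⁻ x in D, ∫⁻ y in D, ENNReal.ofReal ((u y - u x) ^ 2 * γ x y) ≤ ENNReal.ofReal B) :
    energyNorm D γ u ≤ ENNReal.ofReal (Real.sqrt B) := by
  rw [energyNorm, Real.sqrt_eq_rpow, ← ENNReal.ofReal_rpow_of_nonneg h0 (by norm_num)]
  gcongr

/-! ### The error of a single discretization -/

set_option maxHeartbeats 1000000 in
theorem error_le_of_discretization {Ω : Set Plane} (hΩ : IsPolygonalDomain Ω) {δ h δ₀ : ℝ}
    (hδ : 0 < δ) (hδ₀ : δ ≤ δ₀) {ue : Plane → ℝ} {M : ℝ}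
    (hue : CbBound 4 (enlarged Ω δ₀) M ue) {f : Plane → ℝ}
    (hfm : AEStronglyMeasurable f (volume.restrict Ω)) {Mf : ℝ}
    (hf : ∀ x ∈ Ω, |f x + Laplacian.laplacian ue x| ≤ Mf * δ ^ 2)
    {K : Geometry.SimplicialComplex ℝ Plane} (hK : IsConsistentTriangulation Ω δ K)
    (hdiam : ∀ s ∈ triangles K, Metric.diam (convexHull ℝ (s : Set Plane)) ≤ h)
    {V : Plane → Finset Plane} (hV : ∀ x ∈ enlarged Ω δ, IsInscribed x δ (V x))
    (hVm : MeasurableSet {p : Plane × Plane | p.1 ∈ enlarged Ω δ ∧ p.2 ∈ polygon (V p.1)})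
    {η CH : ℝ} (hη : 0 < η) (hη1 : η ≤ 1)
    (hr : ∀ x ∈ enlarged Ω δ, η * δ ≤ inradiusAt x (V x))
    (hH : ∀ x ∈ enlarged Ω δ, longestSide (V x) ≤ CH * h)
    {gh uh : Plane → ℝ} (hgh : gh ∈ collarSpace Ω K) {E : ℝ}
    (hE : ∀ᵐ x : Plane, x ∈ interactionDomain Ω δ → |gh x - ue x| ≤ E)
    (huh : IsCDGSolution Ω δ K (polyKernel δ V) f gh uh) {d A : ℝ} (hd0 : 0 ≤ d)
    (hd : ∀ x ∈ closure Ω, ∀ y ∈ closure Ω, dist x y ≤ d)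
    (hA0 : 0 ≤ A) (hA : volume (interactionDomain Ω δ) ≤ ENNReal.ofReal A)
    {P Z R₂ : ℝ} (hP0 : 0 < P) (hP : (2 * d + δ₀) ^ 2 * Real.pi / (4 * η ^ 4) ≤ P)
    (hZ : (M * h ^ 2) ^ 2 * volume.real Ω + E ^ 2 * A ≤ Z)
    (hR₂ : (Mf * δ ^ 2 + (8 * M * δ ^ 2 + 2 * M * (CH * h) ^ 2 / δ ^ 3)) ^ 2 * volume.real Ω ≤ R₂) :
    energyNorm (enlarged Ω δ) (polyKernel δ V) (ue - (uh + gh)) ≤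
        ENNReal.ofReal (Real.sqrt (96 / δ ^ 2 * Z + 4 * P * R₂)) ∧
      eLpNorm (ue - (uh + gh)) 2 (volume.restrict Ω) ≤
        ENNReal.ofReal (Real.sqrt (2 * Z + 2 * P * (32 / δ ^ 2 * Z + 2 * P * R₂))) := by
  set I := interactionDomain Ω δ with hI
  set D := enlarged Ω δ with hD
  have hDU : D = Ω ∪ I := rfl
  have hΩo := hΩ.isOpen
  have hDo : IsOpen D := hΩ.isOpen_enlarged δ
  have hDm := hDo.measurableSet
  have hDS : D ⊆ enlarged Ω δ₀ := enlarged_mono hδ₀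
  have hSo : IsOpen (enlarged Ω δ₀) := hΩ.isOpen_enlarged δ₀
  have hdisj : Disjoint Ω I := Set.disjoint_left.2 fun x hx hx' => hx'.1 hx
  have hIm : MeasurableSet I := by
    have : I = D \ Ω := by
      rw [hDU, Set.union_sdiff_left, hdisj.symm.sdiff_eq_left]
    rw [this]
    exact hDm.diff hΩo.measurableSet
  have hΩfin : volume Ω ≠ ⊤ :=
    ((measure_mono subset_closure).trans_lt hΩ.isCompact_closure.measure_lt_top).ne
  have hIfin : volume I ≠ ⊤ := (hA.trans_lt ENNReal.ofReal_lt_top).ne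
  have hDfin : volume D ≠ ⊤ := by
    rw [hDU]
    exact measure_union_ne_top hΩfin hIfin
  have : IsFiniteMeasure (volume.restrict Ω) :=
    ⟨by rw [Measure.restrict_apply_univ]; exact hΩfin.lt_top⟩
  have : IsFiniteMeasure (volume.restrict I) :=
    ⟨by rw [Measure.restrict_apply_univ]; exact hIfin.lt_top⟩
  have : IsFiniteMeasure (volume.restrict D) :=
    ⟨by rw [Measure.restrict_apply_univ]; exact hDfin.lt_top⟩
  set μ := volume.restrict D with hμ
  have hΩD : Ω ⊆ D := Set.subset_union_left
  have hID : I ⊆ D := Set.subset_union_right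
  have hclD : closure Ω ⊆ D := closure_subset_enlarged hδ
  obtain ⟨x₀, hx₀⟩ := hΩ.nonempty
  have hM0 : 0 ≤ M := (norm_nonneg _).trans (hue.2 0 (by norm_num) x₀ (hDS (hΩD hx₀)))
  -- the kernel
  set G := kernelOn D δ V with hG
  set κ : ℝ := 4 / (Real.pi * δ ^ 4) with hκ
  have hκ0 : 0 < κ := by have := Real.pi_pos; positivity
  have hGm : Measurable fun p : Plane × Plane => G p.1 p.2 := measurable_kernelOn hDm hVm
  have hGκ : ∀ x y, |G x y| ≤ κ := fun x y => abs_kernelOn_le x y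
  have hG0 : ∀ x y, 0 ≤ G x y := fun x y => kernelOn_nonneg x y
  have hGs : ∀ x y, G x y = G y x := fun x y => kernelOn_symm x y
  have hGD : ∀ x ∈ D, ∀ y ∈ D, G x y = polyKernel δ V x y := fun x hx y hy =>
    kernelOn_of_mem hx hy
  have hGb : EssBdd (fun p : Plane × Plane => G p.1 p.2) (μ.prod μ) :=
    EssBdd.of_measurable hGm fun p => hGκ p.1 p.2
  -- the functions
  set u : Plane → ℝ := D.indicator ue with hu
  have huD : ∀ x ∈ D, u x = ue x := fun x hx => Set.indicator_of_mem hx _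
  have hueM : ∀ x ∈ D, |ue x| ≤ M := by
    intro x hx
    have := hue.2 0 (by norm_num) x (hDS hx)
    rwa [norm_iteratedFDeriv_zero] at this
  have hub : EssBdd u μ := by
    refine ⟨?_, M, ?_⟩
    · refine ((hue.1.continuousOn.mono hDS).aestronglyMeasurable hDm).congr ?_
      exact (ae_restrict_iff' hDm).2 (ae_of_all _ fun x hx => (huD x hx).symm)
    · exact (ae_restrict_iff' hDm).2 (ae_of_all _ fun x hx => by
        rw [huD x hx]; exact hueM x hx)
  have hfd : (domainTriangles Ω K).Finite := hK.finite_triangles.subset fun s hs => hs.1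
  have hfc : (collarTriangles Ω K).Finite := hK.finite_triangles.subset fun s hs => hs.1
  obtain ⟨v, hv, hvu⟩ := hK.exists_domain_interpolant hSo (hclD.trans hDS)
    (hue.1.of_le (by norm_num)) (hue.2 2 (by norm_num)) hdiam
  have huhS := huh.1
  have hwS : v - uh ∈ domainSpace Ω K := PiecewiseLinear.sub hv huhS
  have hvm := PiecewiseLinear.measurable hfd hv
  have huhm := PiecewiseLinear.measurable hfd huhS
  have hghm := PiecewiseLinear.measurable hfc hgh
  obtain ⟨Bv, -, hBv⟩ := PiecewiseLinear.exists_abs_le hfd hv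
  obtain ⟨Bu, -, hBu⟩ := PiecewiseLinear.exists_abs_le hfd huhS
  obtain ⟨Bg, -, hBg⟩ := PiecewiseLinear.exists_abs_le hfc hgh
  set w : Plane → ℝ := v - uh with hw
  have hwm : Measurable w := hvm.sub huhm
  obtain ⟨Bw, -, hBw⟩ := PiecewiseLinear.exists_abs_le hfd hwS
  have hw0 : ∀ x, x ∉ closure Ω → w x = 0 := fun x hx => hK.domain_eq_zero hwS hx
  -- On `D` the error is `z + w`: `z` measures approximation by the discrete spaces, and `w` is an
  -- admissible test function.
  set z : Plane → ℝ := fun x => u x - (v x + gh x) with hz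
  have hvb : EssBdd v μ := EssBdd.of_measurable hvm hBv
  have huhb : EssBdd uh μ := EssBdd.of_measurable huhm hBu
  have hghb : EssBdd gh μ := EssBdd.of_measurable hghm hBg
  have hwb : EssBdd w μ := EssBdd.of_measurable hwm hBw
  have hzb : EssBdd z μ := hub.sub (hvb.add hghb)
  -- almost everywhere facts
  have haeΩ : ∀ᵐ x : Plane, x ∈ Ω → gh x = 0 := by
    filter_upwards [hK.ae_collar_eq_zero hgh] with x hx hxΩ
    exact hx (subset_closure hxΩ)
  have haeI : ∀ᵐ x : Plane, x ∈ I → x ∉ closure Ω := by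
    filter_upwards [compl_mem_ae_iff.2 hΩ.volume_frontier] with x hx hxI hxc
    exact hx (by rw [hΩo.frontier_eq]; exact ⟨hxc, hxI.1⟩)
  have hwI : ∀ᵐ x : Plane, x ∈ I → w x = 0 := by
    filter_upwards [haeI] with x hx hxI
    exact hw0 x (hx hxI)
  -- the interpolation error
  have hzΩ : ∫ x in Ω, z x ^ 2 ≤ (M * h ^ 2) ^ 2 * volume.real Ω := by
    have hle : ∀ᵐ x ∂(volume.restrict Ω), z x ^ 2 ≤ (M * h ^ 2) ^ 2 := by
      rw [ae_restrict_iff' hΩo.measurableSet]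
      filter_upwards [haeΩ] with x hx hxΩ
      rw [hz]
      simp only
      rw [huD x (hΩD hxΩ), hx hxΩ, add_zero, ← sq_abs, abs_sub_comm]
      have := hvu x (subset_closure hxΩ)
      gcongr
    have := integral_mono_ae (hzb.mono_measure (Measure.restrict_mono hΩD le_rfl)).sq.integrable
      (integrable_const _) hle
    simpa [Measure.real, mul_comm] using this
  have hzI : ∫ x in I, z x ^ 2 ≤ E ^ 2 * A := by
    have hle : ∀ᵐ x ∂(volume.restrict I), z x ^ 2 ≤ E ^ 2 := by
      rw [ae_restrict_iff' hIm]
      filter_upwards [haeI, hE] with x hx hxE hxI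
      rw [hz]
      simp only
      rw [huD x (hID hxI), hK.domain_eq_zero hv (hx hxI), zero_add, ← sq_abs, abs_sub_comm]
      have := hxE hxI
      gcongr
    have h1 := integral_mono_ae
      (hzb.mono_measure (Measure.restrict_mono hID le_rfl)).sq.integrable
      (integrable_const _) hle
    have h2 : volume.real I ≤ A := ENNReal.toReal_le_of_le_ofReal hA0 hA
    have h3 : ∫ _ in I, E ^ 2 = E ^ 2 * volume.real I := by
      rw [setIntegral_const, smul_eq_mul, mul_comm]
    rw [h3] at h1
    exact h1.trans (by gcongr)
  have hzD : ∫ x, z x ^ 2 ∂μ ≤ Z := by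
    rw [hμ, hDU, setIntegral_union hdisj hIm
      (hzb.mono_measure (Measure.restrict_mono hΩD le_rfl)).sq.integrable
      (hzb.mono_measure (Measure.restrict_mono hID le_rfl)).sq.integrable]
    linarith
  have hzE : energyForm μ G z z ≤ 16 / δ ^ 2 * Z := by
    have h1 := energyForm_self_le hGb hG0 hGs (integral_kernelOn_le hδ hDm hVm) hzb
    calc _ ≤ _ := h1
      _ ≤ 4 * (4 / δ ^ 2) * Z := by gcongr
      _ = _ := by ring
  -- the Poincaré inequality
  have hpoinc : ∫ x, w x ^ 2 ∂μ ≤ P * energyForm μ G w w := by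
    have hball : ∀ x ∈ closure Ω, Metric.ball x (η * δ) ⊆ D := by
      intro x hx
      have hle : η * δ ≤ δ := by nlinarith
      refine (Metric.ball_subset_ball hle).trans ?_
      by_cases hxΩ : x ∈ Ω
      · exact ball_subset_enlarged_of_mem hxΩ
      · exact ball_subset_enlarged_of_mem_frontier (by rw [hΩo.frontier_eq]; exact ⟨hx, hxΩ⟩)
    have hlow : ∀ x ∈ D, ∀ y ∈ D, dist x y < η * δ → κ ≤ G x y := by
      intro x hx y hy hxy
      have hle : η * δ ≤ δ := by nlinarith
      have hmem : ∀ a ∈ D, ∀ b, dist a b < η * δ → b ∈ polygon (V a) := by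
        intro a ha b hab
        by_contra hb
        exact absurd (inradiusAt_le_dist (x := a) hb) (not_le.2 (hab.trans_le (hr a ha)))
      rw [hGD x hx y hy, polyKernel_eq (hxy.le.trans hle) (hmem x hx y hxy)
        (hmem y hy x (by rwa [dist_comm]))]
    have h1 := lintegral_sq_le_energy hwm hDm hw0 hd0 hd (by positivity : 0 < η * δ)
      ((by nlinarith : η * δ ≤ δ).trans hδ₀) hκ0 hclD hball hlow
    rw [lintegral_energy_eq hGb hG0 hwb, ← ENNReal.ofReal_mul (by positivity)] at h1
    have h2 : ENNReal.ofReal (∫ x, w x ^ 2 ∂μ) ≤ ∫⁻ x, ENNReal.ofReal (w x ^ 2) := by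
      rw [ofReal_integral_eq_lintegral_ofReal hwb.sq.integrable
        (ae_of_all _ fun _ => sq_nonneg _)]
      exact setLIntegral_le_lintegral _ _
    have hE0 := energyForm_self_nonneg (μ := μ) hG0 w
    have h3 := (ENNReal.ofReal_le_ofReal_iff (by positivity)).1 (h2.trans h1)
    refine h3.trans (mul_le_mul_of_nonneg_right ?_ hE0)
    -- With radius `η δ` and kernel bound `κ = 4/(π δ⁴)` the powers of `δ` cancel, so `P` is uniform
    -- in the horizon.
    refine le_trans (le_of_eq ?_) hP
    have := Real.pi_pos
    rw [hκ]
    field_simp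
  -- the residual
  set L : Plane → ℝ := fun x => ∫ y in D, (u y - u x) * G x y with hL
  have hLb : EssBdd L μ := EssBdd.integral_prod_left (ν := μ)
    (F := fun p : Plane × Plane => (u p.2 - u p.1) * G p.1 p.2) (hub.diff.mul hGb)
  have hLx : ∀ x ∈ Ω, |f x + 2 * L x| ≤
      Mf * δ ^ 2 + (8 * M * δ ^ 2 + 2 * M * (CH * h) ^ 2 / δ ^ 3) := by
    intro x hx
    have h1 := abs_poly_operator_sub_laplacian_le hSo hue hδ hDm hDS hVm hV
      (fun x hx => (by positivity : 0 < η * δ).trans_le (hr x hx)) hH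
      (ball_subset_enlarged_of_mem (δ := δ) hx)
    have h2 : L x = ∫ y in D, (ue y - ue x) * G x y := by
      refine setIntegral_congr_fun hDm fun y hy => ?_
      simp only [huD y hy, huD x (hΩD hx)]
    rw [h2]
    have h3 : f x + 2 * (∫ y in D, (ue y - ue x) * G x y) = (f x + Laplacian.laplacian ue x) +
        (2 * (∫ y in D, (ue y - ue x) * G x y) - Laplacian.laplacian ue x) := by ring
    rw [h3]
    exact (abs_add_le _ _).trans (add_le_add (hf x hx) h1)
  set R : Plane → ℝ := Ω.indicator fun x => -(f x + 2 * L x) with hR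
  have hLΩ : EssBdd L (volume.restrict Ω) := hLb.mono_measure (Measure.restrict_mono hΩD le_rfl)
  have hRm : AEStronglyMeasurable (fun x => -(f x + 2 * L x)) (volume.restrict Ω) :=
    (hfm.add (hLΩ.const_mul 2).1).neg
  set ρ := Mf * δ ^ 2 + (8 * M * δ ^ 2 + 2 * M * (CH * h) ^ 2 / δ ^ 3) with hρ
  have hρ0 : 0 ≤ ρ := (abs_nonneg _).trans (hLx x₀ hx₀)
  have hRle : ∀ x, |R x| ≤ ρ := by
    intro x
    by_cases hx : x ∈ Ω
    · rw [hR, Set.indicator_of_mem hx, abs_neg]; exact hLx x hx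
    · rw [hR, Set.indicator_of_notMem hx, abs_zero]; exact hρ0
  have hRb : EssBdd R μ := by
    refine ⟨?_, ρ, ae_of_all _ hRle⟩
    exact ((aestronglyMeasurable_indicator_iff hΩo.measurableSet).2 hRm).restrict
  have hRint : ∫ x, R x ^ 2 ∂μ ≤ R₂ := by
    have h1 : ∫ x, R x ^ 2 ∂μ = ∫ x in Ω, R x ^ 2 := by
      refine setIntegral_eq_of_subset_of_forall_sdiff_eq_zero hDm hΩD fun x hx => ?_
      rw [hR, Set.indicator_of_notMem hx.2]
      norm_num
    rw [h1]
    refine le_trans ?_ hR₂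
    have := integral_mono (hRb.mono_measure (Measure.restrict_mono hΩD le_rfl)).sq.integrable
      (integrable_const (ρ ^ 2)) (fun x => by
        rw [← sq_abs]
        have := hRle x
        gcongr : ∀ x, R x ^ 2 ≤ ρ ^ 2)
    simpa [Measure.real, mul_comm] using this
  -- the Galerkin orthogonality
  have hgal : energyForm μ G (fun x => z x + w x) w = ∫ x, R x * w x ∂μ := by
    have heb : EssBdd (fun x => z x + w x) μ := hzb.add hwb
    rw [energyForm_eq hGb hGs heb hwb]
    have hcdg := integral_mul_integral_eq_of_cdg hΩo.measurableSet hIm hdisj hΩfin hIfin hGm hGκ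
      hGD huhm hBu hghm hBg hwm hBw haeΩ
      (by filter_upwards [haeI] with x hx hxI using hK.domain_eq_zero huhS (hx hxI)) hwI
      (huh.2 w hwS)
    rw [← hDU] at hcdg
    set U : Plane → ℝ := fun x => uh x + gh x with hU
    have hUb : EssBdd U μ := huhb.add hghb
    have hUi : EssBdd (fun x => ∫ y in D, (U y - U x) * G x y) μ :=
      EssBdd.integral_prod_left (ν := μ)
        (F := fun p : Plane × Plane => (U p.2 - U p.1) * G p.1 p.2) (hUb.diff.mul hGb)
    have hsplit : ∀ x, w x * ∫ y, ((z y + w y) - (z x + w x)) * G x y ∂μ =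
        w x * L x - w x * ∫ y in D, (U y - U x) * G x y := by
      intro x
      have hGx : EssBdd (G x) μ := EssBdd.kernel_section hGm hGκ x
      rw [← mul_sub, hL]
      simp only
      rw [← integral_sub ((hub.sub (essBdd_const _)).mul hGx).integrable
        ((hUb.sub (essBdd_const _)).mul hGx).integrable]
      congr 2
      ext y
      simp only [hz, hw, hU, Pi.sub_apply]
      ring
    simp_rw [hsplit]
    rw [integral_sub (hwb.mul hLb).integrable (hwb.mul hUi).integrable, mul_sub, hcdg]
    have hf1 : Integrable (fun x => f x * w x) (volume.restrict Ω) := by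
      -- `f` is essentially bounded because its residual `f + 2L` and `L` are.
      have hfb : EssBdd f (volume.restrict Ω) := by
        refine ⟨hfm, ?_⟩
        obtain ⟨-, B, hB⟩ := hLΩ
        refine ⟨ρ + 2 * B, ?_⟩
        filter_upwards [hB, ae_restrict_mem hΩo.measurableSet] with x hx hxΩ
        have h1 := hLx x hxΩ
        rw [Real.norm_eq_abs] at hx ⊢
        have : f x = (f x + 2 * L x) - 2 * L x := by ring
        rw [this]
        refine (abs_sub _ _).trans ?_
        rw [abs_mul, abs_two]
        linarith
      exact (hfb.mul (EssBdd.of_measurable hwm hBw)).integrable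
    have hwL : ∫ x, w x * L x ∂μ = ∫ x in Ω, w x * L x := by
      refine setIntegral_eq_of_subset_of_ae_sdiff_eq_zero hDm.nullMeasurableSet hΩD ?_
      filter_upwards [hwI] with x hx hxD
      rw [hx (hxD.1.resolve_left hxD.2), zero_mul]
    have hRw : ∫ x, R x * w x ∂μ = ∫ x in Ω, (-2 * (w x * L x) - f x * w x) := by
      have h1 : ∫ x, R x * w x ∂μ = ∫ x in Ω, R x * w x := by
        refine setIntegral_eq_of_subset_of_forall_sdiff_eq_zero hDm hΩD fun x hx => ?_
        rw [hR, Set.indicator_of_notMem hx.2, zero_mul]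
      rw [h1]
      refine setIntegral_congr_fun hΩo.measurableSet fun x hx => ?_
      simp only [hR, Set.indicator_of_mem hx]
      ring
    have hwLi : Integrable (fun x => -2 * (w x * L x)) (volume.restrict Ω) :=
      (((EssBdd.of_measurable hwm hBw).mul hLΩ).const_mul (-2)).integrable
    rw [hRw, integral_sub hwLi hf1, integral_const_mul, hwL]
  -- conclusion
  have hwE : energyForm μ G w w ≤ 32 / δ ^ 2 * Z + 2 * P * R₂ := by
    have h1 := energyForm_le_of_galerkin hGb hG0 hzb hwb hRb hP0 hpoinc hgal
    have h2 : 2 * P * ∫ x, R x ^ 2 ∂μ ≤ 2 * P * R₂ := by gcongr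
    have h3 : 2 * (16 / δ ^ 2 * Z) = 32 / δ ^ 2 * Z := by ring
    linarith
  have heE : energyForm μ G (fun x => z x + w x) (fun x => z x + w x) ≤
      96 / δ ^ 2 * Z + 4 * P * R₂ := by
    have h1 := energyForm_add_le hGb hG0 hzb hwb
    have h3 : 96 / δ ^ 2 * Z + 4 * P * R₂ =
      2 * (16 / δ ^ 2 * Z) + 2 * (32 / δ ^ 2 * Z + 2 * P * R₂) := by ring
    linarith
  have heD : ∀ x ∈ D, z x + w x = (ue - (uh + gh)) x := by
    intro x hx
    simp only [hz, hw, huD x hx, Pi.sub_apply, Pi.add_apply]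
    ring
  constructor
  · refine energyNorm_le_of_lintegral_le
      ((energyForm_self_nonneg (μ := μ) hG0 _).trans heE) ?_
    refine le_trans (le_of_eq ?_) (ENNReal.ofReal_le_ofReal heE)
    rw [← lintegral_energy_eq hGb hG0 (hzb.add hwb)]
    refine setLIntegral_congr_fun hDm fun x hx => ?_
    refine setLIntegral_congr_fun hDm fun y hy => ?_
    simp only [← heD x hx, ← heD y hy, hGD x hx y hy]
  · have hres : eLpNorm (ue - (uh + gh)) 2 (volume.restrict Ω) =
        eLpNorm (fun x => z x + w x) 2 (volume.restrict Ω) := by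
      refine eLpNorm_congr_ae ?_
      rw [Filter.EventuallyEq, ae_restrict_iff' hΩo.measurableSet]
      exact ae_of_all _ fun x hx => (heD x (hΩD hx)).symm
    rw [hres]
    refine (eLpNorm_mono_measure _ (Measure.restrict_mono hΩD le_rfl)).trans ?_
    refine eLpNorm_two_le_of_integral_sq_le (hzb.add hwb).sq.integrable ?_
    have h1 : ∫ x, (z x + w x) ^ 2 ∂μ ≤ 2 * ∫ x, z x ^ 2 ∂μ + 2 * ∫ x, w x ^ 2 ∂μ := by
      rw [← integral_const_mul, ← integral_const_mul, ← integral_add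
        (hzb.sq.const_mul 2).integrable (hwb.sq.const_mul 2).integrable]
      refine integral_mono (hzb.add hwb).sq.integrable
        ((hzb.sq.const_mul 2).add (hwb.sq.const_mul 2)).integrable fun x => ?_
      simp only
      nlinarith [sq_nonneg (z x - w x)]
    have h2 : P * energyForm μ G w w ≤ P * (32 / δ ^ 2 * Z + 2 * P * R₂) := by gcongr
    linarith

/-! ### Rates -/

theorem rpow_rate_sq {δ : ℝ} (hδ : 0 < δ) (μ : ℕ) :
    (δ ^ (((3 : ℝ) + μ) / 2)) ^ 2 = δ ^ (3 + μ) := by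
  rw [← Real.rpow_natCast, ← Real.rpow_mul hδ.le, ← Real.rpow_natCast]
  congr 1
  push_cast
  ring

theorem simpleRate_le_rate {δ h : ℝ} (hδ : 0 < δ) (μ : ℕ) :
    simpleRate μ δ h ≤ rate μ 2 δ h := by
  unfold simpleRate rate
  have : 0 ≤ δ⁻¹ * h ^ 2 := by positivity
  norm_num
  linarith

theorem rate_le_simpleRate {δ δ₀ h : ℝ} (hδ : 0 < δ) (hδ₀ : δ ≤ δ₀) (μ : ℕ) :
    rate μ 2 δ h ≤ (1 + δ₀ ^ 2) * simpleRate μ δ h := by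
  unfold simpleRate rate
  have hs : 0 ≤ δ ^ (((3 : ℝ) + μ) / 2) := Real.rpow_nonneg hδ.le _
  have hb : 0 ≤ (δ ^ 3)⁻¹ * h ^ 2 := by positivity
  have ha : δ⁻¹ * h ^ 2 = δ ^ 2 * ((δ ^ 3)⁻¹ * h ^ 2) := by field_simp
  have h2 : δ ^ 2 * ((δ ^ 3)⁻¹ * h ^ 2) ≤ δ₀ ^ 2 * ((δ ^ 3)⁻¹ * h ^ 2) := by gcongr
  norm_num
  rw [ha]
  nlinarith [mul_nonneg (sq_nonneg δ₀) hs]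

/-- The factor `δ²` is extracted to cancel the `δ⁻²` of the energy bound. The collar data contribute
`δ^(4+2μ) · δ = δ² · δ^(3+μ) · δ^μ`, with `δ^μ ≤ 1 + δ₀`. -/
theorem interpolation_error_le_rate {δ δ₀ h M N Mg v A : ℝ} {μ : ℕ} (hμ : μ = 0 ∨ μ = 1)
    (hδ : 0 < δ) (hδ₀ : δ ≤ δ₀) (hv : 0 ≤ v) (hA : 0 ≤ A) :
    (M * h ^ 2) ^ 2 * v + (N * h ^ 2 + Mg * δ ^ (2 + μ)) ^ 2 * (A * δ) ≤
      δ ^ 2 * ((M ^ 2 * v + 2 * A * Mg ^ 2 * (1 + δ₀) + 2 * A * N ^ 2 * δ₀) *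
        rate μ 2 δ h ^ 2) := by
  have hδ₀' : 0 < δ₀ := hδ.trans_le hδ₀
  set s := δ ^ (((3 : ℝ) + μ) / 2) with hs
  have hs0 : 0 ≤ s := Real.rpow_nonneg hδ.le _
  have hs2 : s ^ 2 = δ ^ (3 + μ) := rpow_rate_sq hδ μ
  set a := δ⁻¹ * h ^ 2 with ha
  have ha0 : 0 ≤ a := by positivity
  have hb0 : 0 ≤ (δ ^ 3)⁻¹ * h ^ 2 := by positivity
  have hr : rate μ 2 δ h = s + a + (δ ^ 3)⁻¹ * h ^ 2 := by
    unfold rate; norm_num [hs, ha]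
  have hsr : s ^ 2 ≤ rate μ 2 δ h ^ 2 := by
    rw [hr]; gcongr; linarith
  have har : a ^ 2 ≤ rate μ 2 δ h ^ 2 := by
    rw [hr]; gcongr; linarith
  have hh : h ^ 2 = δ * a := by rw [ha]; field_simp
  have hδμ : δ ^ μ ≤ 1 + δ₀ := by
    rcases hμ with rfl | rfl <;> norm_num <;> linarith
  have h1 : (N * h ^ 2 + Mg * δ ^ (2 + μ)) ^ 2 ≤
      2 * (N * h ^ 2) ^ 2 + 2 * (Mg * δ ^ (2 + μ)) ^ 2 := by
    nlinarith [sq_nonneg (N * h ^ 2 - Mg * δ ^ (2 + μ))]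
  have h2 : (δ ^ (2 + μ)) ^ 2 * δ = δ ^ 2 * (s ^ 2 * δ ^ μ) := by
    rw [hs2]; ring
  calc _ ≤ (M * h ^ 2) ^ 2 * v + (2 * (N * h ^ 2) ^ 2 + 2 * (Mg * δ ^ (2 + μ)) ^ 2) *
        (A * δ) := by gcongr
    _ = δ ^ 2 * (M ^ 2 * v * a ^ 2 + 2 * A * Mg ^ 2 * (s ^ 2 * δ ^ μ) +
        2 * A * N ^ 2 * (a ^ 2 * δ)) := by
        rw [hh]
        linear_combination (2 * Mg ^ 2 * A) * h2
    _ ≤ δ ^ 2 * (M ^ 2 * v * rate μ 2 δ h ^ 2 +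
        2 * A * Mg ^ 2 * (rate μ 2 δ h ^ 2 * (1 + δ₀)) +
        2 * A * N ^ 2 * (rate μ 2 δ h ^ 2 * δ₀)) := by gcongr
    _ = _ := by ring

/-- The consistency order `δ²` is dominated by `δ^((3+μ)/2)` exactly because `μ ≤ 1`; the caps
supply the term `δ⁻³h²`. -/
theorem residual_le_rate {δ δ₀ h M Mf CH : ℝ} {μ : ℕ} (hμ : μ = 0 ∨ μ = 1)
    (hδ : 0 < δ) (hδ₀ : δ ≤ δ₀) (hM : 0 ≤ M) (hMf : 0 ≤ Mf) :
    (Mf * δ ^ 2 + (8 * M * δ ^ 2 + 2 * M * (CH * h) ^ 2 / δ ^ 3)) ^ 2 ≤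
      ((Mf + 8 * M) * (1 + δ₀) + 2 * M * CH ^ 2) ^ 2 * rate μ 2 δ h ^ 2 := by
  have hδ₀' : 0 < δ₀ := hδ.trans_le hδ₀
  set s := δ ^ (((3 : ℝ) + μ) / 2) with hs
  have hs0 : 0 ≤ s := Real.rpow_nonneg hδ.le _
  have hs2 : s ^ 2 = δ ^ (3 + μ) := rpow_rate_sq hδ μ
  set b := (δ ^ 3)⁻¹ * h ^ 2 with hb
  have hb0 : 0 ≤ b := by positivity
  have ha0 : 0 ≤ δ⁻¹ * h ^ 2 := by positivity
  have hr : rate μ 2 δ h = s + δ⁻¹ * h ^ 2 + b := by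
    unfold rate; norm_num [hs, hb]
  have hδs : δ ^ 2 ≤ (1 + δ₀) * s := by
    have h1 : (δ ^ 2) ^ 2 ≤ ((1 + δ₀) * s) ^ 2 := by
      rw [mul_pow, hs2]
      rcases hμ with rfl | rfl
      · have h2 : (δ ^ 2) ^ 2 = δ * δ ^ (3 + 0) := by ring
        rw [h2]
        gcongr
        nlinarith
      · have h2 : (δ ^ 2) ^ 2 = 1 * δ ^ (3 + 1) := by ring
        rw [h2]
        gcongr
        nlinarith
    exact le_of_sq_le_sq h1 (by positivity)
  have hsr : s ≤ rate μ 2 δ h := by rw [hr]; linarith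
  have hbr : b ≤ rate μ 2 δ h := by rw [hr]; linarith
  rw [← mul_pow]
  have hnn : 0 ≤ Mf * δ ^ 2 + (8 * M * δ ^ 2 + 2 * M * (CH * h) ^ 2 / δ ^ 3) := by positivity
  have hle : Mf * δ ^ 2 + (8 * M * δ ^ 2 + 2 * M * (CH * h) ^ 2 / δ ^ 3) ≤
      ((Mf + 8 * M) * (1 + δ₀) + 2 * M * CH ^ 2) * rate μ 2 δ h := by
    calc _ = (Mf + 8 * M) * δ ^ 2 + 2 * M * CH ^ 2 * b := by rw [hb]; ring
      _ ≤ (Mf + 8 * M) * ((1 + δ₀) * rate μ 2 δ h) + 2 * M * CH ^ 2 * rate μ 2 δ h := by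
        gcongr
        exact hδs.trans (by gcongr)
      _ = _ := by ring
  gcongr

theorem rate_nonneg {δ : ℝ} (hδ : 0 < δ) (μ lam : ℕ) (h : ℝ) (hh : 0 ≤ h) :
    0 ≤ rate μ lam δ h := by
  unfold rate
  have := Real.rpow_nonneg hδ.le (((3 : ℝ) + μ) / 2)
  positivity

end NonlocalFEM

end

/-! ### The theorem, with constants uniform over the family -/

theorem mainTheorem2 {ι : Type*}
    -- the domain, the local solution and its extension
    (Ω : Set Plane) (hΩ : IsPolygonalDomain Ω)
    (u₀ f₀ g₀ ue : Plane → ℝ) (δ₀ : ℝ)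
    (hu₀ : ∃ M, CbBound 4 Ω M u₀) (hloc : IsLocalSolution Ω f₀ g₀ u₀)
    (hue : ∃ M, CbBound 4 (enlarged Ω δ₀) M ue) (hext : ∀ x ∈ Ω, ue x = u₀ x)
    -- horizon parameters and mesh sizes
    (δ h : ι → ℝ) (hδ : ∀ k, 0 < δ k ∧ δ k ≤ δ₀) (hh : ∀ k, 0 < h k ∧ h k < δ k)
    -- the data of the nonlocal problems
    (μ : ℕ) (hμ : μ = 0 ∨ μ = 1) (f g : ι → Plane → ℝ)
    (hfm : ∀ k, AEStronglyMeasurable (f k) (volume.restrict Ω))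
    (hf : ∃ M, ∀ k, ∀ x ∈ Ω, |f k x - f₀ x| ≤ M * δ k ^ 2)
    (hg : ∃ M, ∀ k, ∀ x ∈ interactionDomain Ω (δ k), |g k x - ue x| ≤ M * δ k ^ (2 + μ))
    -- the meshes
    (K : ι → Geometry.SimplicialComplex ℝ Plane)
    (hK : ∀ k, IsConsistentTriangulation Ω (δ k) (K k))
    (hKq : ∀ d, ∃ ρ > 0, ∀ k, δ k = d → QuasiUniformMesh (K k) (h k) ρ)
    (hg2 : ∃ M, ∀ k, ContinuousOn (g k) (collar Ω (K k)) ∧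
      CbBound 2 (interior (collar Ω (K k))) M (g k))
    -- the polygons
    (V : ι → Plane → Finset Plane)
    (hV : ∀ k, ∀ x ∈ enlarged Ω (δ k), IsInscribed x (δ k) (V k x))
    (hVm : ∀ k, MeasurableSet
      {p : Plane × Plane | p.1 ∈ enlarged Ω (δ k) ∧ p.2 ∈ polygon (V k p.1)})
    (hVq : WeaklyQuasiUniform (fun k => enlarged Ω (δ k)) δ V)
    (hVK : PolygonsMatchMesh (fun k => enlarged Ω (δ k)) δ h K V)
    (hσ : ∀ i, ∀ x ∈ Ω, Tendsto
      (fun k => firstMoment (enlarged Ω (δ k)) (polyKernel (δ k) (V k)) i x)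
      (comap δ (𝓝 0)) (𝓝 0))
    -- the discrete volume constraints and the CDG solutions
    (gh uh : ι → Plane → ℝ)
    (hgh : ∀ k, gh k ∈ collarSpace Ω (K k))
    (hghn : ∃ M, ∀ k, ∀ s ∈ collarTriangles Ω (K k), ∀ p ∈ s, |gh k p - g k p| ≤ M * h k ^ 2)
    (huh : ∀ k, IsCDGSolution Ω (δ k) (K k) (polyKernel (δ k) (V k)) (f k) (gh k) (uh k)) :
    (∃ C > 0, ∀ k,
      energyNorm (enlarged Ω (δ k)) (polyKernel (δ k) (V k)) (ue - (uh k + gh k)) ≤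
          ENNReal.ofReal (C * rate μ 2 (δ k) (h k)) ∧
        eLpNorm (u₀ - (uh k + gh k)) 2 (volume.restrict Ω) ≤
          ENNReal.ofReal (C * rate μ 2 (δ k) (h k))) ∧
      ∃ c > 0, ∃ C > 0, ∀ k,
        c * simpleRate μ (δ k) (h k) ≤ rate μ 2 (δ k) (h k) ∧
          rate μ 2 (δ k) (h k) ≤ C * simpleRate μ (δ k) (h k) := by
  -- Positivity of `δ₀` comes from a member of the family, so the empty family is treated apart.
  rcases isEmpty_or_nonempty ι with hι | ⟨⟨k₀⟩⟩
  · exact ⟨⟨1, one_pos, fun k => isEmptyElim k⟩, 1, one_pos, 1, one_pos, fun k => isEmptyElim k⟩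
  have hδ₀ : 0 < δ₀ := (hδ k₀).1.trans_le (hδ k₀).2
  refine ⟨?_, 1, one_pos, 1 + δ₀ ^ 2, by positivity, fun k =>
    ⟨by rw [one_mul]; exact simpleRate_le_rate (hδ k).1 μ,
      rate_le_simpleRate (hδ k).1 (hδ k).2 μ⟩⟩
  obtain ⟨M, hM⟩ := hue
  obtain ⟨Mf, hMf⟩ := hf
  obtain ⟨Mg, hMg⟩ := hg
  obtain ⟨Mc, hMc⟩ := hg2
  obtain ⟨Mn, hMn⟩ := hghn
  obtain ⟨C₁, hC₁, C₂, hC₂, hVq⟩ := hVq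
  have hdiam : ∀ k, ∀ s ∈ triangles (K k), Metric.diam (convexHull ℝ (s : Set Plane)) ≤ h k := by
    intro k s hs
    obtain ⟨ρ, -, hρ⟩ := hKq (δ k)
    exact (hρ k rfl s hs).1
  obtain ⟨CH, hCH, hlong⟩ := exists_longestSide_le hΩ.nonempty hh hK hdiam hV hC₁
    (fun k x hx => (hVq k x hx).1) hVK
  obtain ⟨A, hA0, hA⟩ := hΩ.exists_volume_interactionDomain_le δ₀
  obtain ⟨x₀, hx₀⟩ := hΩ.nonempty
  have hM0 : 0 ≤ M := (norm_nonneg _).trans (hM.2 0 (by norm_num) x₀ (Or.inl hx₀))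
  have hlap : ∀ x ∈ Ω, Laplacian.laplacian ue x = -f₀ x := by
    intro x hx
    have h1 : ue =ᶠ[𝓝 x] u₀ := by
      filter_upwards [hΩ.isOpen.mem_nhds hx] with y hy using hext y hy
    rw [(InnerProductSpace.laplacian_congr_nhds h1).eq_of_nhds, ← hloc.2.1 x hx, neg_neg]
  set v := volume.real Ω with hv
  have hv0 : 0 ≤ v := measureReal_nonneg
  -- The minimum with `1` keeps the discs of radius `η δ` around points of `closure Ω` inside the
  -- enlarged domain.
  set η := min C₂ 1 with hη
  have hη0 : 0 < η := lt_min hC₂ one_pos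
  set d := Metric.diam (closure Ω) with hd
  set P := (2 * d + δ₀) ^ 2 * Real.pi / (4 * η ^ 4) with hP
  have hd0 : 0 ≤ d := Metric.diam_nonneg
  have hP0 : 0 < P := by
    have := Real.pi_pos
    positivity
  set KZ := M ^ 2 * v + 2 * A * Mg ^ 2 * (1 + δ₀) + 2 * A * (Mn + Mc) ^ 2 * δ₀ with hKZ
  have hKZ0 : 0 ≤ KZ := by positivity
  set KR := ((|Mf| + 8 * M) * (1 + δ₀) + 2 * M * CH ^ 2) ^ 2 * v with hKR
  have hKR0 : 0 ≤ KR := by positivity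
  -- `C` adds the constants in the bounds for the squared energy error and the squared `L²` error;
  -- the constant of the theorem is `√C`, and the `1` makes it positive.
  set C := 96 * KZ + 4 * P * KR + (2 * δ₀ ^ 2 * KZ + 64 * P * KZ + 4 * P ^ 2 * KR) + 1 with hC
  have hC0 : 0 < C := by positivity
  refine ⟨Real.sqrt C, Real.sqrt_pos.2 hC0, fun k => ?_⟩
  have hδk := (hδ k).1
  have hδk₀ := (hδ k).2
  set r := rate μ 2 (δ k) (h k) with hr
  have hr0 : 0 ≤ r := rate_nonneg hδk μ 2 (h k) (hh k).1.le
  have hE : ∀ᵐ x : Plane, x ∈ interactionDomain Ω (δ k) →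
      |gh k x - ue x| ≤ (Mn + Mc) * h k ^ 2 + Mg * δ k ^ (2 + μ) := by
    filter_upwards [(hK k).ae_abs_collar_sub_le hΩ (hMc k).1 (hMc k).2 (hgh k) (hMn k) (hdiam k)]
      with x hx hxI
    have h1 := hx hxI
    have h2 := hMg k x hxI
    have h3 : gh k x - ue x = (gh k x - g k x) + (g k x - ue x) := by ring
    rw [h3]
    refine (abs_add_le _ _).trans ?_
    linarith
  have hfk : ∀ x ∈ Ω, |f k x + Laplacian.laplacian ue x| ≤ |Mf| * δ k ^ 2 := by
    intro x hx
    rw [hlap x hx, ← sub_eq_add_neg]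
    refine (hMf k x hx).trans ?_
    gcongr
    exact le_abs_self _
  have hZ := interpolation_error_le_rate (h := h k) (M := M) (N := Mn + Mc) (Mg := Mg)
    hμ hδk hδk₀ hv0 hA0
  have hR := mul_le_mul_of_nonneg_right (residual_le_rate (h := h k) (CH := CH) hμ hδk hδk₀ hM0
    (abs_nonneg Mf)) hv0
  have key := error_le_of_discretization hΩ hδk hδk₀ hM (hfm k) hfk (hK k) (hdiam k) (hV k)
    (hVm k) hη0 (min_le_right _ _)
    (fun x hx => (mul_le_mul_of_nonneg_right (min_le_left _ _) hδk.le).trans (hVq k x hx).2)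
    (hlong k) (hgh k) hE (huh k) hd0
    (fun x hx y hy => Metric.dist_le_diam_of_mem hΩ.isCompact_closure.isBounded hx hy)
    (mul_nonneg hA0 hδk.le) (hA _ hδk hδk₀) hP0 le_rfl hZ hR
  have hsqrt : Real.sqrt C * r = Real.sqrt (C * r ^ 2) := by
    rw [Real.sqrt_mul hC0.le, Real.sqrt_sq hr0]
  have hRr : ((|Mf| + 8 * M) * (1 + δ₀) + 2 * M * CH ^ 2) ^ 2 * r ^ 2 * v = KR * r ^ 2 := by
    rw [hKR]; ring
  have hp1 : 0 ≤ KZ * r ^ 2 := by positivity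
  have hp2 : 0 ≤ KR * r ^ 2 := by positivity
  have hp3 : 0 ≤ r ^ 2 := sq_nonneg r
  have hone : 0 ≤ 96 * KZ + 4 * P * KR := by positivity
  have htwo : 0 ≤ 2 * δ₀ ^ 2 * KZ + 64 * P * KZ + 4 * P ^ 2 * KR := by positivity
  rw [← hr, hRr, ← hKZ] at key
  constructor
  · refine key.1.trans (ENNReal.ofReal_le_ofReal ?_)
    rw [hsqrt]
    apply Real.sqrt_le_sqrt
    have h1 : 96 / δ k ^ 2 * (δ k ^ 2 * (KZ * r ^ 2)) + 4 * P * (KR * r ^ 2) =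
        (96 * KZ + 4 * P * KR) * r ^ 2 := by field_simp
    rw [h1]
    gcongr
    linarith
  · have hcongr : eLpNorm (u₀ - (uh k + gh k)) 2 (volume.restrict Ω) =
        eLpNorm (ue - (uh k + gh k)) 2 (volume.restrict Ω) := by
      refine eLpNorm_congr_ae ((ae_restrict_iff' hΩ.isOpen.measurableSet).2
        (ae_of_all _ fun x hx => ?_))
      simp [hext x hx]
    rw [hcongr]
    refine key.2.trans (ENNReal.ofReal_le_ofReal ?_)
    rw [hsqrt]
    apply Real.sqrt_le_sqrt
    have h1 : 2 * (δ k ^ 2 * (KZ * r ^ 2)) + 2 * P * (32 / δ k ^ 2 * (δ k ^ 2 * (KZ * r ^ 2)) +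
        2 * P * (KR * r ^ 2)) =
        (2 * δ k ^ 2 * KZ + 64 * P * KZ + 4 * P ^ 2 * KR) * r ^ 2 := by
      field_simp
      ring
    rw [h1]
    gcongr
    have h2 : 2 * δ k ^ 2 * KZ ≤ 2 * δ₀ ^ 2 * KZ := by gcongr
    linarith
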